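/- Let $X$ be a smooth compact manifold (without boundary) of dimension $n\ge 3$, on which a compact Lie group $G$ acts smoothly. For a smooth Riemannian metric $g$ on $X$ let $s_g$ denote its scalar curvature, $dV_g$ its volume measure, and $$Q(g)=\frac{\int_X s_g\,dV_g}{\left(\int_X dV_g\right)^{\frac{n-2}{n}}}.$$ For a $G$-invariant metric $g$ let $[g]_G$ be the set of smooth $G$-invariant metrics of the form $\psi g$ with $\psi:X\to(0,\infty)$, and let the $G$-Yamabe constant of $[g]_G$ be $$Y(X,[g]_G)=\inf_{\hat g\in[g]_G}Q(\hat g).$$ Let $\{g_\alpha\mid\alpha\in I\}$ be a collection of smooth $G$-invariant Riemannian metrics on $X$. Suppose that there are constants $D_1,D_2$ and a nonempty $G$-invariant open subset $U\subset X$ such that for all $\alpha,\beta\in I$ $$|g_\alpha-g_\beta|_{g_\beta}\le D_1\quad\text{and}\quad |s_{g_\alpha}-s_{g_\beta}|\le D_2\quad\text{on } U,$$ where $|\cdot|_{g_\beta}$ is the pointwise norm of bilinear forms determined by $g_\beta$, i.e. $|(g_\alpha-g_\beta)(v,w)|\le D_1\, g_\beta(v,v)^{1/2}g_\beta(w,w)^{1/2}$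 for all $x\in U$ and $v,w\in T_xX$. Then there exists a constant $D$ such that $Y(X,[g_\alpha]_G)\le D$ for every $\alpha\in I$. -/

import Mathlib

open Set MeasureTheory
open scoped Manifold ContDiff

noncomputable section

namespace EquivariantYamabe

/-! ### Curvature of a metric given by its coefficients on an open set of `ℝⁿ` -/

section Coordinates

variable {n : ℕ}

/-- The `i`-th partial derivative `∂_i f`. -/
def partialDeriv (i : Fin n) (f : EuclideanSpace ℝ (Fin n) → ℝ)
    (y : EuclideanSpace ℝ (Fin n)) : ℝ :=
  fderiv ℝ f y (EuclideanSpace.single i 1)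

/-- The Christoffel symbol
`Γ^k_{ij} = (1/2) ∑_l g^{kl} (∂_i g_{jl} + ∂_j g_{il} - ∂_l g_{ij})`. -/
def christoffel (γ : EuclideanSpace ℝ (Fin n) → Matrix (Fin n) (Fin n) ℝ) (k i j : Fin n)
    (y : EuclideanSpace ℝ (Fin n)) : ℝ :=
  (1 / 2) * ∑ l, (γ y)⁻¹ k l *
    (partialDeriv i (fun z => γ z j l) y + partialDeriv j (fun z => γ z i l) y
      - partialDeriv l (fun z => γ z i j) y)

/-- The Ricci curvature
`R_{ij} = ∑_k (∂_k Γ^k_{ij} - ∂_j Γ^k_{ik} + ∑_l (Γ^k_{kl} Γ^l_{ij} - Γ^k_{jl} Γ^l_{ik}))`. -/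
def ricciCoord (γ : EuclideanSpace ℝ (Fin n) → Matrix (Fin n) (Fin n) ℝ) (i j : Fin n)
    (y : EuclideanSpace ℝ (Fin n)) : ℝ :=
  ∑ k, (partialDeriv k (christoffel γ k i j) y - partialDeriv j (christoffel γ k i k) y
    + ∑ l, (christoffel γ k k l y * christoffel γ l i j y
      - christoffel γ k j l y * christoffel γ l i k y))

/-- The scalar curvature `∑_{ij} g^{ij} R_{ij}`. -/
def scalarCoord (γ : EuclideanSpace ℝ (Fin n) → Matrix (Fin n) (Fin n) ℝ)
    (y : EuclideanSpace ℝ (Fin n)) : ℝ :=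
  ∑ i, ∑ j, (γ y)⁻¹ i j * ricciCoord γ i j y

end Coordinates

/-! ### Riemannian metrics on a smooth `n`-manifold without boundary -/

/-- Smooth Riemannian metrics on `X`. -/
abbrev SmoothMetric (n : ℕ) (X : Type*) [TopologicalSpace X]
    [ChartedSpace (EuclideanSpace ℝ (Fin n)) X] [IsManifold (𝓡 n) ∞ X] :=
  Bundle.ContMDiffRiemannianMetric (𝓡 n) ∞ (EuclideanSpace ℝ (Fin n))
    (fun x : X => TangentSpace (𝓡 n) x)

section Manifold

variable {n : ℕ} {X : Type*} [TopologicalSpace X]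
  [ChartedSpace (EuclideanSpace ℝ (Fin n)) X] [IsManifold (𝓡 n) ∞ X]

/-- The coordinate vector field `∂_i` of the preferred chart at `x₀`, at the point with
coordinates `y`. -/
def coordVector (x₀ : X) (i : Fin n) (y : EuclideanSpace ℝ (Fin n)) :
    TangentSpace (𝓡 n) ((extChartAt (𝓡 n) x₀).symm y) :=
  mfderiv 𝓘(ℝ, EuclideanSpace ℝ (Fin n)) (𝓡 n) (extChartAt (𝓡 n) x₀).symm y
    (EuclideanSpace.single i 1 : EuclideanSpace ℝ (Fin n))

/-- The coefficients `g_{ij} = g(∂_i, ∂_j)` of `g` in the preferred chart at `x₀`, as functions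
of the coordinates; meaningful on the target of that chart. -/
def metricCoeff (g : SmoothMetric n X) (x₀ : X) (y : EuclideanSpace ℝ (Fin n)) :
    Matrix (Fin n) (Fin n) ℝ :=
  Matrix.of fun i j =>
    g.inner ((extChartAt (𝓡 n) x₀).symm y) (coordVector x₀ i y) (coordVector x₀ j y)

/-- The scalar curvature `s_g`, computed at `x` in the preferred chart at `x`. -/
def scalarCurvature (g : SmoothMetric n X) (x : X) : ℝ :=
  scalarCoord (metricCoeff g x) (extChartAt (𝓡 n) x x)

/-- The measure `√(det g_{ij}) dy` on the domain of the preferred chart at `x₀`, extended by zero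
to `X`. -/
def chartVolume [MeasurableSpace X] (g : SmoothMetric n X) (x₀ : X) : Measure X :=
  (((volume : Measure (EuclideanSpace ℝ (Fin n))).restrict (extChartAt (𝓡 n) x₀).target).withDensity
    (fun y => ENNReal.ofReal (Real.sqrt (metricCoeff g x₀ y).det))).map
      (extChartAt (𝓡 n) x₀).symm

/-- The Riemannian volume measure `dV_g`: the least measure that dominates `√(det g_{ij}) dy` on
every chart domain. The measures `√(det g_{ij}) dy` agree on overlaps, so that `dV_g` restricts to
`√(det g_{ij}) dy` on each chart domain. -/
def riemannianVolume [MeasurableSpace X] (g : SmoothMetric n X) : Measure X :=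
  ⨆ x₀ : X, chartVolume g x₀

/-- The normalized Einstein–Hilbert functional
`Q(g) = (∫ s_g dV_g) / (∫ dV_g)^((n-2)/n)`. -/
def einsteinHilbert [MeasurableSpace X] (g : SmoothMetric n X) : ℝ :=
  (∫ x, scalarCurvature g x ∂(riemannianVolume g)) /
    ((riemannianVolume g).real univ) ^ (((n : ℝ) - 2) / (n : ℝ))

/-- `|g - h|_h ≤ C` at `x`: the operator norm of the bilinear form `g - h` on `T_xX`, measured
with the inner product `h`, is at most `C`. -/
def DiffNormLE (g h : SmoothMetric n X) (x : X) (C : ℝ) : Prop :=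
  ∀ v w : TangentSpace (𝓡 n) x,
    |g.inner x v w - h.inner x v w| ≤
      C * (Real.sqrt (h.inner x v v) * Real.sqrt (h.inner x w w))

/-- `G` acts by isometries of `g`. -/
def IsInvariantMetric (G : Type*) [SMul G X] (g : SmoothMetric n X) : Prop :=
  ∀ (a : G) (x : X) (v w : TangentSpace (𝓡 n) x),
    g.inner (a • x) (mfderiv (𝓡 n) (𝓡 n) (fun z : X => a • z) x v)
      (mfderiv (𝓡 n) (𝓡 n) (fun z : X => a • z) x w) = g.inner x v w

/-- The class `[g]_G` of smooth `G`-invariant metrics of the form `ψ g` with `ψ > 0`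
(such a `ψ` is automatically smooth). -/
def conformalClass (G : Type*) [SMul G X] (g : SmoothMetric n X) : Set (SmoothMetric n X) :=
  {h | IsInvariantMetric G h ∧ ∃ ψ : X → ℝ, (∀ x, 0 < ψ x) ∧
    ∀ (x : X) (v w : TangentSpace (𝓡 n) x), h.inner x v w = ψ x * g.inner x v w}

/-- The `G`-Yamabe constant `Y(X, [g]_G)`, the infimum of `Q` over `[g]_G`; it is taken in the
extended reals so that it is the true infimum. -/
def yamabeConstant [MeasurableSpace X] (G : Type*) [SMul G X] (g : SmoothMetric n X) : EReal :=
  ⨅ h ∈ conformalClass G g, (einsteinHilbert h : EReal)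

end Manifold

end EquivariantYamabe

end

set_option linter.unusedSectionVars false

/-! The Yamabe constant is an infimum, so it suffices to find in every class one metric whose
quotient `Q` is bounded independently of the index. The test metrics come from a single function
concentrated in U, the only place where the metrics are known to be comparable.

Averaging a bump function over the compact group gives a smooth invariant φ ≥ 0, not identically
zero, with support in U (`exists_invariant_bump`). For u > 0 the metric u^{4/(n-2)} g has total
scalar curvature ∫ (u² s_g + 4(n-1)/(n-2) |du|²_g) dV_g. The choice u = φ would degenerate off the
support of φ, so u = φ + ε is used. Fix a reference metric g_β and put c = 1 + |D₁|. Since the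
hypothesis is symmetric in the indices, g_α ≤ c g_β and g_β ≤ c g_α on U. This compares volumes
(`det_le_of_quadForm_le`) and norms of differentials (`inv_quadForm_le`), while D₂ bounds s_{g_α} by
s_{g_β}. As φ and dφ vanish off U, the numerator is at most M + 2ε² ∫ |s_{g_α}| dV_{g_α}, with M
independent of α. The last integral is not controlled uniformly, but ε may depend on α and is chosen
to make that term at most 1. For the denominator, on the open set where φ exceeds half of some
positive value the test metric dominates a fixed multiple of g_β, so its volume is at least some v₀
> 0.

Most of the work lies in the energy identity, because scalar curvature is given by a coordinate
formula in a chart that varies with the point, and volume is a supremum of chart measures. The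
identity rests on the independence of scalar curvature from coordinates
(`IsPullbackOn.scalarCoord_eq`), the conformal change formula (`IsCoordMetric.scalarCoord_exp_smul`)
and Green's formula in a chart (`setIntegral_mul_laplaceCoord`), glued by a partition of unity in
`IsConformalExp.integral_scalarCurvature`. -/

namespace EquivariantYamabe

/-! ### Calculus of partial derivatives -/

section PartialDeriv

variable {n : ℕ} {f g : EuclideanSpace ℝ (Fin n) → ℝ} {y : EuclideanSpace ℝ (Fin n)}
  {V : Set (EuclideanSpace ℝ (Fin n))}

theorem contDiffOn_partialDeriv (hV : IsOpen V) (hf : ContDiffOn ℝ ∞ f V) (i : Fin n) :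
    ContDiffOn ℝ ∞ (partialDeriv i f) V := by
  have h := hf.fderiv_of_isOpen (m := ∞) hV (by simp)
  exact h.clm_apply contDiffOn_const

theorem differentiableAt_of_contDiffOn {F : Type*} [NormedAddCommGroup F] [NormedSpace ℝ F]
    {f : EuclideanSpace ℝ (Fin n) → F} (hV : IsOpen V) (hf : ContDiffOn ℝ ∞ f V) (hy : y ∈ V) :
    DifferentiableAt ℝ f y :=
  (hf.contDiffAt (hV.mem_nhds hy)).differentiableAt (by simp)

theorem partialDeriv_congr (h : f =ᶠ[nhds y] g) (i : Fin n) :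
    partialDeriv i f y = partialDeriv i g y := by
  simp only [partialDeriv, h.fderiv_eq]

theorem partialDeriv_const (c : ℝ) (i : Fin n) : partialDeriv i (fun _ => c) y = 0 := by
  simp [partialDeriv]

theorem partialDeriv_add (hf : DifferentiableAt ℝ f y) (hg : DifferentiableAt ℝ g y) (i : Fin n) :
    partialDeriv i (fun z => f z + g z) y = partialDeriv i f y + partialDeriv i g y := by
  simp [partialDeriv, fderiv_fun_add hf hg]

theorem partialDeriv_sub (hf : DifferentiableAt ℝ f y) (hg : DifferentiableAt ℝ g y) (i : Fin n) :
    partialDeriv i (fun z => f z - g z) y = partialDeriv i f y - partialDeriv i g y := by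
  simp [partialDeriv, fderiv_fun_sub hf hg]

theorem partialDeriv_mul (hf : DifferentiableAt ℝ f y) (hg : DifferentiableAt ℝ g y) (i : Fin n) :
    partialDeriv i (fun z => f z * g z) y
      = partialDeriv i f y * g y + f y * partialDeriv i g y := by
  simp [partialDeriv, fderiv_fun_mul hf hg]; ring

theorem partialDeriv_const_mul (hf : DifferentiableAt ℝ f y) (c : ℝ) (i : Fin n) :
    partialDeriv i (fun z => c * f z) y = c * partialDeriv i f y := by
  simp [partialDeriv, fderiv_const_mul hf]

theorem partialDeriv_sum {ι : Type*} (s : Finset ι) {F : ι → EuclideanSpace ℝ (Fin n) → ℝ}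
    (hF : ∀ a ∈ s, DifferentiableAt ℝ (F a) y) (i : Fin n) :
    partialDeriv i (fun z => ∑ a ∈ s, F a z) y = ∑ a ∈ s, partialDeriv i (F a) y := by
  simp [partialDeriv, fderiv_fun_sum hF]

theorem partialDeriv_comp {φ : ℝ → ℝ} {φ' : ℝ} (hφ : HasDerivAt φ φ' (f y))
    (hf : DifferentiableAt ℝ f y) (i : Fin n) :
    partialDeriv i (fun z => φ (f z)) y = φ' * partialDeriv i f y := by
  have h := (hφ.comp_hasFDerivAt y hf.hasFDerivAt).fderiv
  simp only [partialDeriv]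
  rw [show (fun z => φ (f z)) = φ ∘ f from rfl, h]
  simp

theorem fderiv_eq_sum_partialDeriv (v : EuclideanSpace ℝ (Fin n)) :
    fderiv ℝ f y v = ∑ i, v i * partialDeriv i f y := by
  conv_lhs => rw [← (EuclideanSpace.basisFun (Fin n) ℝ).sum_repr v]
  simp [partialDeriv]

theorem partialDeriv_comm (hf : ContDiffAt ℝ ∞ f y) (i j : Fin n) :
    partialDeriv i (partialDeriv j f) y = partialDeriv j (partialDeriv i f) y := by
  have hd : DifferentiableAt ℝ (fderiv ℝ f) y :=
    (hf.fderiv_right (m := ∞) (by simp)).differentiableAt (by simp)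
  have key : ∀ a b : Fin n, partialDeriv a (partialDeriv b f) y
      = fderiv ℝ (fderiv ℝ f) y (EuclideanSpace.single a 1) (EuclideanSpace.single b 1) := by
    intro a b
    have h2 := (hd.hasFDerivAt.clm_apply
      (hasFDerivAt_const (EuclideanSpace.single b (1 : ℝ)) y)).fderiv
    have h3 : partialDeriv b f = fun z => fderiv ℝ f z (EuclideanSpace.single b 1) := rfl
    rw [h3, partialDeriv, h2]
    simp
  rw [key, key]
  exact (hf.isSymmSndFDerivAt (by simpa using ENat.LEInfty.out)) _ _

end PartialDeriv

/-! ### Metrics on open subsets of `ℝⁿ` -/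

/-- `γ` is a smooth field of positive definite matrices on the open set `V`. -/
structure IsCoordMetric {n : ℕ} (γ : EuclideanSpace ℝ (Fin n) → Matrix (Fin n) (Fin n) ℝ)
    (V : Set (EuclideanSpace ℝ (Fin n))) : Prop where
  isOpen : IsOpen V
  smooth : ∀ i j, ContDiffOn ℝ ∞ (fun y => γ y i j) V
  posDef : ∀ y ∈ V, (γ y).PosDef

section MatrixFields

variable {n : ℕ} {V : Set (EuclideanSpace ℝ (Fin n))}

theorem contDiffOn_det {A : EuclideanSpace ℝ (Fin n) → Matrix (Fin n) (Fin n) ℝ}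
    (hA : ∀ i j, ContDiffOn ℝ ∞ (fun y => A y i j) V) :
    ContDiffOn ℝ ∞ (fun y => (A y).det) V := by
  simp only [Matrix.det_apply']
  exact ContDiffOn.sum fun σ _ => contDiffOn_const.mul (contDiffOn_prod fun i _ => hA _ _)

theorem contDiffOn_adjugate {A : EuclideanSpace ℝ (Fin n) → Matrix (Fin n) (Fin n) ℝ}
    (hA : ∀ i j, ContDiffOn ℝ ∞ (fun y => A y i j) V) (i j : Fin n) :
    ContDiffOn ℝ ∞ (fun y => (A y).adjugate i j) V := by
  simp only [Matrix.adjugate_apply]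
  refine contDiffOn_det fun a b => ?_
  by_cases h : a = j
  · subst h
    simpa using contDiffOn_const
  · simpa [Matrix.updateRow_ne h] using hA a b

/-- Jacobi's formula for the derivative of a determinant. -/
theorem partialDeriv_det {A : EuclideanSpace ℝ (Fin n) → Matrix (Fin n) (Fin n) ℝ}
    {y : EuclideanSpace ℝ (Fin n)} (hA : ∀ i j, DifferentiableAt ℝ (fun z => A z i j) y)
    (m : Fin n) :
    partialDeriv m (fun z => (A z).det) y
      = ∑ i, ∑ j, (A y).adjugate j i * partialDeriv m (fun z => A z i j) y := by
  have hrow : ∀ i, HasFDerivAt (fun z => A z i)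
      (ContinuousLinearMap.pi fun j => fderiv ℝ (fun z => A z i j) y) y := fun i =>
    hasFDerivAt_pi.2 fun j => (hA i j).hasFDerivAt
  -- The determinant is multilinear in the rows, so its derivative is the sum over i of the
  -- determinants in which row i is replaced by its derivative.
  let Dt : ContinuousMultilinearMap ℝ (fun _ : Fin n => Fin n → ℝ) ℝ :=
    ⟨Matrix.detRowAlternating.toMultilinearMap, by
      change Continuous fun M : Matrix (Fin n) (Fin n) ℝ => M.det
      exact Continuous.matrix_det continuous_id⟩
  have h := (HasFDerivAt.multilinear_comp Dt (g := fun i z => A z i) hrow).fderiv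
  have h0 : (fun z => (A z).det) = fun z => Dt fun i => A z i := rfl
  rw [partialDeriv, h0, h]
  simp only [sum_apply]
  refine Finset.sum_congr rfl fun i _ => ?_
  have h1 : ∀ b : Fin n → ℝ, Dt.toContinuousLinearMap (fun j => A y j) i b
      = ((A y).updateRow i b).det := fun b => rfl
  rw [ContinuousLinearMap.comp_apply, h1]
  -- Expansion along the replaced row: its cofactors do not involve that row, hence are those of `A
  -- y`.
  rw [Matrix.det_eq_sum_mul_adjugate_row _ i]
  refine Finset.sum_congr rfl fun j _ => ?_
  simp only [Matrix.updateRow_self, Matrix.adjugate_apply, ContinuousLinearMap.pi_apply,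
    partialDeriv]
  rw [mul_comm]
  congr 2
  ext a b
  by_cases ha : a = i
  · subst ha; simp
  · simp [Matrix.updateRow_ne ha]

end MatrixFields

namespace IsCoordMetric

variable {n : ℕ} {γ : EuclideanSpace ℝ (Fin n) → Matrix (Fin n) (Fin n) ℝ}
  {V : Set (EuclideanSpace ℝ (Fin n))} {y : EuclideanSpace ℝ (Fin n)}

theorem symm (h : IsCoordMetric γ V) (hy : y ∈ V) (i j : Fin n) : γ y i j = γ y j i := by
  simpa using ((h.posDef y hy).isHermitian.apply i j).symm

theorem det_pos (h : IsCoordMetric γ V) (hy : y ∈ V) : 0 < (γ y).det := (h.posDef y hy).det_pos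

theorem isUnit_det (h : IsCoordMetric γ V) (hy : y ∈ V) : IsUnit (γ y).det :=
  (h.det_pos hy).ne'.isUnit

theorem inv_symm (h : IsCoordMetric γ V) (hy : y ∈ V) (i j : Fin n) :
    (γ y)⁻¹ i j = (γ y)⁻¹ j i := by
  simpa using ((h.posDef y hy).inv.isHermitian.apply i j).symm

theorem mem_nhds (h : IsCoordMetric γ V) (hy : y ∈ V) : V ∈ nhds y := h.isOpen.mem_nhds hy

theorem differentiableAt (h : IsCoordMetric γ V) (hy : y ∈ V) (i j : Fin n) :
    DifferentiableAt ℝ (fun z => γ z i j) y :=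
  differentiableAt_of_contDiffOn h.isOpen (h.smooth i j) hy

/-- By Cramer's rule the inverse is the adjugate divided by the determinant; both are polynomial in
the entries, and the determinant is positive on V. -/
theorem contDiffOn_inv (h : IsCoordMetric γ V) (i j : Fin n) :
    ContDiffOn ℝ ∞ (fun y => (γ y)⁻¹ i j) V := by
  have h1 : ContDiffOn ℝ ∞ (fun y => ((γ y).det)⁻¹ * (γ y).adjugate i j) V :=
    ((contDiffOn_det h.smooth).inv fun y hy => (h.det_pos hy).ne').mul
      (contDiffOn_adjugate h.smooth i j)
  refine h1.congr fun y hy => ?_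
  simp [Matrix.inv_def]

theorem differentiableAt_inv (h : IsCoordMetric γ V) (hy : y ∈ V) (i j : Fin n) :
    DifferentiableAt ℝ (fun z => (γ z)⁻¹ i j) y :=
  differentiableAt_of_contDiffOn h.isOpen (h.contDiffOn_inv i j) hy

theorem contDiffOn_christoffel (h : IsCoordMetric γ V) (k i j : Fin n) :
    ContDiffOn ℝ ∞ (christoffel γ k i j) V := by
  unfold christoffel
  have hp := fun a b c => contDiffOn_partialDeriv h.isOpen (h.smooth a b) c
  exact contDiffOn_const.mul (ContDiffOn.sum fun l _ =>
    (h.contDiffOn_inv k l).mul (((hp _ _ _).add (hp _ _ _)).sub (hp _ _ _)))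

theorem differentiableAt_christoffel (h : IsCoordMetric γ V) (hy : y ∈ V) (k i j : Fin n) :
    DifferentiableAt ℝ (christoffel γ k i j) y :=
  differentiableAt_of_contDiffOn h.isOpen (h.contDiffOn_christoffel k i j) hy

theorem contDiffOn_scalarCoord (h : IsCoordMetric γ V) :
    ContDiffOn ℝ ∞ (scalarCoord γ) V := by
  unfold scalarCoord ricciCoord
  have hc := h.contDiffOn_christoffel
  have hp := fun a k i j => contDiffOn_partialDeriv h.isOpen (hc k i j) a
  exact ContDiffOn.sum fun i _ => ContDiffOn.sum fun j _ => (h.contDiffOn_inv i j).mul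
    (ContDiffOn.sum fun k _ => ((hp _ _ _ _).sub (hp _ _ _ _)).add
      (ContDiffOn.sum fun l _ => ((hc _ _ _).mul (hc _ _ _)).sub ((hc _ _ _).mul (hc _ _ _))))

theorem inv_mul_sum (h : IsCoordMetric γ V) (hy : y ∈ V) (i j : Fin n) :
    ∑ k, (γ y)⁻¹ i k * γ y k j = if i = j then 1 else 0 := by
  rw [← Matrix.mul_apply, Matrix.nonsing_inv_mul _ (h.isUnit_det hy), Matrix.one_apply]

theorem mul_inv_sum (h : IsCoordMetric γ V) (hy : y ∈ V) (i j : Fin n) :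
    ∑ k, γ y i k * (γ y)⁻¹ k j = if i = j then 1 else 0 := by
  rw [← Matrix.mul_apply, Matrix.mul_nonsing_inv _ (h.isUnit_det hy), Matrix.one_apply]

theorem partialDeriv_symm (h : IsCoordMetric γ V) (hy : y ∈ V) (m i j : Fin n) :
    partialDeriv m (fun z => γ z i j) y = partialDeriv m (fun z => γ z j i) y :=
  partialDeriv_congr (Filter.eventually_of_mem (h.mem_nhds hy) fun _ hz => h.symm hz i j) m

theorem christoffel_symm (h : IsCoordMetric γ V) (hy : y ∈ V) (k i j : Fin n) :
    christoffel γ k i j y = christoffel γ k j i y := by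
  unfold christoffel
  congr 1
  refine Finset.sum_congr rfl fun l _ => ?_
  rw [h.partialDeriv_symm hy l i j]
  ring

/-- Lowering the upper index of the Christoffel symbol. -/
theorem sum_mul_christoffel (h : IsCoordMetric γ V) (hy : y ∈ V) (m i j : Fin n) :
    ∑ k, γ y m k * christoffel γ k i j y
      = (1 / 2) * (partialDeriv i (fun z => γ z j m) y + partialDeriv j (fun z => γ z i m) y
        - partialDeriv m (fun z => γ z i j) y) := by
  unfold christoffel
  simp only [Finset.mul_sum]
  rw [Finset.sum_comm]
  have : ∀ l, ∑ k, γ y m k * (1 / 2 * ((γ y)⁻¹ k l *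
      (partialDeriv i (fun z => γ z j l) y + partialDeriv j (fun z => γ z i l) y
        - partialDeriv l (fun z => γ z i j) y)))
      = (if m = l then 1 else 0) * (1 / 2 *
      (partialDeriv i (fun z => γ z j l) y + partialDeriv j (fun z => γ z i l) y
        - partialDeriv l (fun z => γ z i j) y)) := by
    intro l
    rw [← h.mul_inv_sum hy m l, Finset.sum_mul]
    exact Finset.sum_congr rfl fun k _ => by ring
  simp only [this]
  simp

/-- The Levi-Civita connection is compatible with the metric. -/
theorem partialDeriv_eq_sum_christoffel (h : IsCoordMetric γ V) (hy : y ∈ V) (l i j : Fin n) :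
    partialDeriv l (fun z => γ z i j) y
      = ∑ k, γ y i k * christoffel γ k j l y + ∑ k, γ y j k * christoffel γ k i l y := by
  rw [h.sum_mul_christoffel hy, h.sum_mul_christoffel hy, h.partialDeriv_symm hy j l i,
    h.partialDeriv_symm hy i l j, h.partialDeriv_symm hy l j i]
  ring

/-- Differentiate γ⁻¹γ = 1 and multiply by γ⁻¹ on the right. -/
theorem partialDeriv_inv (h : IsCoordMetric γ V) (hy : y ∈ V) (m i j : Fin n) :
    partialDeriv m (fun z => (γ z)⁻¹ i j) y
      = -∑ a, ∑ b, (γ y)⁻¹ i a * partialDeriv m (fun z => γ z a b) y * (γ y)⁻¹ b j := by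
  have hc : ∀ b, ∑ a, (partialDeriv m (fun z => (γ z)⁻¹ i a) y * γ y a b
      + (γ y)⁻¹ i a * partialDeriv m (fun z => γ z a b) y) = 0 := by
    intro b
    have h1 : partialDeriv m (fun z => ∑ a, (γ z)⁻¹ i a * γ z a b) y = 0 := by
      rw [partialDeriv_congr (g := fun _ => if i = b then 1 else 0), partialDeriv_const]
      exact Filter.eventually_of_mem (h.mem_nhds hy) fun z hz => h.inv_mul_sum hz i b
    rw [partialDeriv_sum _ fun a _ =>
      (h.differentiableAt_inv hy i a).fun_mul (h.differentiableAt hy a b)] at h1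
    rw [← h1]
    exact Finset.sum_congr rfl fun a _ =>
      (partialDeriv_mul (h.differentiableAt_inv hy i a) (h.differentiableAt hy a b) m).symm
  have h2 : ∑ b, (∑ a, (partialDeriv m (fun z => (γ z)⁻¹ i a) y * γ y a b
      + (γ y)⁻¹ i a * partialDeriv m (fun z => γ z a b) y)) * (γ y)⁻¹ b j = 0 := by
    simp [hc]
  have h3 : ∑ b, ∑ a, partialDeriv m (fun z => (γ z)⁻¹ i a) y * γ y a b * (γ y)⁻¹ b j
      = partialDeriv m (fun z => (γ z)⁻¹ i j) y := by
    rw [Finset.sum_comm]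
    have : ∀ a, ∑ b, partialDeriv m (fun z => (γ z)⁻¹ i a) y * γ y a b * (γ y)⁻¹ b j
        = partialDeriv m (fun z => (γ z)⁻¹ i a) y * (if a = j then 1 else 0) := by
      intro a
      rw [← h.mul_inv_sum hy a j, Finset.mul_sum]
      exact Finset.sum_congr rfl fun k _ => by ring
    simp [this]
  simp only [Finset.sum_mul, add_mul, Finset.sum_add_distrib] at h2
  rw [h3] at h2
  rw [Finset.sum_comm]
  linarith

/-- The contracted Christoffel symbol is half the trace of the derivative of the metric. -/
theorem sum_christoffel_self (h : IsCoordMetric γ V) (hy : y ∈ V) (l : Fin n) :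
    ∑ k, christoffel γ k k l y
      = (1 / 2) * ∑ i, ∑ j, (γ y)⁻¹ i j * partialDeriv l (fun z => γ z i j) y := by
  unfold christoffel
  rw [← Finset.mul_sum]
  congr 1
  -- Two of the three derivative terms cancel after exchanging the summation indices, since the
  -- inverse metric is symmetric.
  have h1 : ∑ k, ∑ m, (γ y)⁻¹ k m * partialDeriv k (fun z => γ z l m) y
      = ∑ k, ∑ m, (γ y)⁻¹ k m * partialDeriv m (fun z => γ z k l) y := by
    rw [Finset.sum_comm]
    refine Finset.sum_congr rfl fun a _ => Finset.sum_congr rfl fun b _ => ?_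
    rw [h.inv_symm hy b a, h.partialDeriv_symm hy b a l]
  have h2 : ∀ k m, (γ y)⁻¹ k m * (partialDeriv k (fun z => γ z l m) y
      + partialDeriv l (fun z => γ z k m) y - partialDeriv m (fun z => γ z k l) y)
      = (γ y)⁻¹ k m * partialDeriv k (fun z => γ z l m) y
        + (γ y)⁻¹ k m * partialDeriv l (fun z => γ z k m) y
        - (γ y)⁻¹ k m * partialDeriv m (fun z => γ z k l) y := fun _ _ => by ring
  simp only [h2, Finset.sum_add_distrib, Finset.sum_sub_distrib, h1]
  ring

/-- The logarithmic derivative of the volume density is the contracted Christoffel symbol. -/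
theorem partialDeriv_sqrt_det (h : IsCoordMetric γ V) (hy : y ∈ V) (l : Fin n) :
    partialDeriv l (fun z => Real.sqrt (γ z).det) y
      = Real.sqrt (γ y).det * ∑ k, christoffel γ k k l y := by
  have hd : DifferentiableAt ℝ (fun z => (γ z).det) y :=
    differentiableAt_of_contDiffOn h.isOpen (contDiffOn_det h.smooth) hy
  have hpos := h.det_pos hy
  rw [partialDeriv_comp (Real.hasDerivAt_sqrt hpos.ne') hd,
    partialDeriv_det (h.differentiableAt hy), h.sum_christoffel_self hy]
  have hadj : ∀ i j, (γ y).adjugate j i = (γ y).det * (γ y)⁻¹ i j := by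
    intro i j
    rw [h.inv_symm hy, Matrix.inv_def]
    simp only [Ring.inverse_eq_inv', Matrix.smul_apply, smul_eq_mul]
    field_simp
  simp only [hadj, mul_assoc, ← Finset.mul_sum]
  have hs : Real.sqrt (γ y).det ≠ 0 := (Real.sqrt_pos.2 hpos).ne'
  field_simp
  rw [Real.sq_sqrt hpos.le]

theorem contDiffOn_sqrt_det (h : IsCoordMetric γ V) :
    ContDiffOn ℝ ∞ (fun y => Real.sqrt (γ y).det) V :=
  (contDiffOn_det h.smooth).sqrt fun _ hy => (h.det_pos hy).ne'

end IsCoordMetric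

/-! ### Transformation of connections and curvature under a change of coordinates -/

section Transformation

variable {E : Type*} [NormedAddCommGroup E] [NormedSpace ℝ E]

/-- The curvature `R(u,v)w` at `y` of the connection with Christoffel map `Γ`. -/
noncomputable def curvatureMap (Γ : E → E →L[ℝ] E →L[ℝ] E) (y u v w : E) : E :=
  fderiv ℝ Γ y u v w - fderiv ℝ Γ y v u w + Γ y u (Γ y v w) - Γ y v (Γ y u w)

/-- The Koszul formula at `y` relating a field of bilinear forms and a Christoffel map. -/
def IsKoszulAt (B : E → E →L[ℝ] E →L[ℝ] ℝ) (Γ : E → E →L[ℝ] E →L[ℝ] E) (y : E) : Prop :=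
  ∀ v w z, B y (Γ y v w) z
    = (1 / 2) * (fderiv ℝ B y v w z + fderiv ℝ B y w v z - fderiv ℝ B y z v w)

theorem fderiv_apply_apply {F₁ F₂ F₃ : Type*} [NormedAddCommGroup F₁] [NormedSpace ℝ F₁]
    [NormedAddCommGroup F₂] [NormedSpace ℝ F₂] [NormedAddCommGroup F₃] [NormedSpace ℝ F₃]
    {A : E → F₁ →L[ℝ] F₂ →L[ℝ] F₃} {a : E → F₁} {b : E → F₂} {y : E}
    (hA : DifferentiableAt ℝ A y) (ha : DifferentiableAt ℝ a y) (hb : DifferentiableAt ℝ b y)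
    (u : E) :
    fderiv ℝ (fun z => A z (a z) (b z)) y u
      = fderiv ℝ A y u (a y) (b y) + A y (fderiv ℝ a y u) (b y) + A y (a y) (fderiv ℝ b y u) := by
  have h := ((hA.hasFDerivAt.clm_apply ha.hasFDerivAt).clm_apply hb.hasFDerivAt).fderiv
  rw [h]
  simp
  abel

variable {φ : E → E} {V : Set E} {y : E}

theorem differentiableAt_fun_comp {F : Type*} [NormedAddCommGroup F] [NormedSpace ℝ F]
    {A : E → F} (hA : DifferentiableAt ℝ A (φ y)) (hφ : DifferentiableAt ℝ φ y) :
    DifferentiableAt ℝ (fun z => A (φ z)) y :=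
  hA.comp y hφ

theorem fderiv_fun_comp_apply {F : Type*} [NormedAddCommGroup F] [NormedSpace ℝ F]
    {A : E → F} (hA : DifferentiableAt ℝ A (φ y)) (hφ : DifferentiableAt ℝ φ y) (u : E) :
    fderiv ℝ (fun z => A (φ z)) y u = fderiv ℝ A (φ y) (fderiv ℝ φ y u) := by
  rw [show (fun z => A (φ z)) = A ∘ φ from rfl, fderiv_comp y hA hφ]
  rfl

/-- Differentiating the pullback relation expresses the derivative of B' by that of B plus terms
with D²φ. In the Koszul combination the latter cancel in pairs by symmetry, except for 2B(D²φ(v,w),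
Dφ z), which is the inhomogeneous term of the transformation law. -/
theorem christoffel_transform (hV : IsOpen V) (hy : y ∈ V) (hφ : ContDiffOn ℝ ∞ φ V)
    {B B' : E → E →L[ℝ] E →L[ℝ] ℝ} {Γ Γ' : E → E →L[ℝ] E →L[ℝ] E}
    (hB : DifferentiableAt ℝ B (φ y)) (hB' : DifferentiableAt ℝ B' y)
    (htrans : ∀ z ∈ V, ∀ v w, B' z v w = B (φ z) (fderiv ℝ φ z v) (fderiv ℝ φ z w))
    (hsymm : ∀ v w, B (φ y) v w = B (φ y) w v)
    (hnd : ∀ v, (∀ w, B (φ y) v w = 0) → v = 0)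
    (hJ : Function.Surjective (fderiv ℝ φ y))
    (hK : IsKoszulAt B Γ (φ y)) (hK' : IsKoszulAt B' Γ' y) (v w : E) :
    fderiv ℝ φ y (Γ' y v w)
      = Γ (φ y) (fderiv ℝ φ y v) (fderiv ℝ φ y w) + fderiv ℝ (fderiv ℝ φ) y v w := by
  have hφy : ContDiffAt ℝ ∞ φ y := hφ.contDiffAt (hV.mem_nhds hy)
  have hφd : DifferentiableAt ℝ φ y := hφy.differentiableAt (by simp)
  have hJd : DifferentiableAt ℝ (fderiv ℝ φ) y :=
    (hφy.fderiv_right (m := ∞) (by simp)).differentiableAt (by simp)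
  have hsym2 : ∀ a b, fderiv ℝ (fderiv ℝ φ) y a b = fderiv ℝ (fderiv ℝ φ) y b a :=
    hφy.isSymmSndFDerivAt (by simpa using ENat.LEInfty.out)
  have hJc : ∀ a u, fderiv ℝ (fun z => fderiv ℝ φ z a) y u = fderiv ℝ (fderiv ℝ φ) y u a := by
    intro a u
    rw [(hJd.hasFDerivAt.clm_apply (hasFDerivAt_const a y)).fderiv]
    simp
  have hJcd : ∀ a, DifferentiableAt ℝ (fun z => fderiv ℝ φ z a) y := fun a =>
    hJd.clm_apply (differentiableAt_const a)
  have hBφ : DifferentiableAt ℝ (fun z => B (φ z)) y := differentiableAt_fun_comp (A := B) hB hφd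
  have hBφ' := fderiv_fun_comp_apply (A := B) hB hφd
  have hderiv : ∀ u a b, fderiv ℝ B' y u a b
      = fderiv ℝ B (φ y) (fderiv ℝ φ y u) (fderiv ℝ φ y a) (fderiv ℝ φ y b)
        + B (φ y) (fderiv ℝ (fderiv ℝ φ) y u a) (fderiv ℝ φ y b)
        + B (φ y) (fderiv ℝ φ y a) (fderiv ℝ (fderiv ℝ φ) y u b) := by
    intro u a b
    have h1 := fderiv_apply_apply hB' (differentiableAt_const a) (differentiableAt_const b) u
    have h2 := fderiv_apply_apply hBφ (hJcd a) (hJcd b) u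
    have h3 : fderiv ℝ (fun z => B' z a b) y
        = fderiv ℝ (fun z => B (φ z) (fderiv ℝ φ z a) (fderiv ℝ φ z b)) y :=
      Filter.EventuallyEq.fderiv_eq
        (Filter.eventually_of_mem (hV.mem_nhds hy) fun z hz => htrans z hz a b)
    rw [h3, h2, hJc, hJc, hBφ'] at h1
    simpa using h1.symm
  rw [← sub_eq_zero]
  -- By nondegeneracy it is enough to pair with every c; surjectivity of Dφ makes c the image of
  -- some z, to which the Koszul formula for B' applies.
  refine hnd _ fun c => ?_
  obtain ⟨z, rfl⟩ := hJ c
  have e1 := hK' v w z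
  rw [htrans y hy] at e1
  have e2 := hK (fderiv ℝ φ y v) (fderiv ℝ φ y w) (fderiv ℝ φ y z)
  rw [hderiv, hderiv, hderiv, hsym2 w v, hsym2 z v, hsym2 z w] at e1
  simp only [map_sub, map_add, sub_apply, add_apply]
  rw [e1, e2, hsymm (fderiv ℝ φ y w) (fderiv ℝ (fderiv ℝ φ) y v z)]
  ring

/-- Differentiate the transformation law of the Christoffel map. After antisymmetrising in u and v
the third derivatives of φ cancel, and the remaining D²φ terms cancel against those produced by the
quadratic terms in Γ. -/
theorem curvature_transform (hV : IsOpen V) (hy : y ∈ V) (hφ : ContDiffOn ℝ ∞ φ V)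
    {Γ Γ' : E → E →L[ℝ] E →L[ℝ] E}
    (hΓ : DifferentiableAt ℝ Γ (φ y)) (hΓ' : DifferentiableAt ℝ Γ' y)
    (htrans : ∀ z ∈ V, ∀ v w, fderiv ℝ φ z (Γ' z v w)
      = Γ (φ z) (fderiv ℝ φ z v) (fderiv ℝ φ z w) + fderiv ℝ (fderiv ℝ φ) z v w) (u v w : E) :
    fderiv ℝ φ y (curvatureMap Γ' y u v w)
      = curvatureMap Γ (φ y) (fderiv ℝ φ y u) (fderiv ℝ φ y v) (fderiv ℝ φ y w) := by
  have hφy : ContDiffAt ℝ ∞ φ y := hφ.contDiffAt (hV.mem_nhds hy)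
  have hφd : DifferentiableAt ℝ φ y := hφy.differentiableAt (by simp)
  have hJs : ContDiffAt ℝ ∞ (fderiv ℝ φ) y := hφy.fderiv_right (m := ∞) (by simp)
  have hJd : DifferentiableAt ℝ (fderiv ℝ φ) y := hJs.differentiableAt (by simp)
  have hHd : DifferentiableAt ℝ (fderiv ℝ (fderiv ℝ φ)) y :=
    (hJs.fderiv_right (m := ∞) (by simp)).differentiableAt (by simp)
  have hsym2 : ∀ a b, fderiv ℝ (fderiv ℝ φ) y a b = fderiv ℝ (fderiv ℝ φ) y b a :=
    hφy.isSymmSndFDerivAt (by simpa using ENat.LEInfty.out)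
  have hsym3 : ∀ a b, fderiv ℝ (fderiv ℝ (fderiv ℝ φ)) y a b
      = fderiv ℝ (fderiv ℝ (fderiv ℝ φ)) y b a :=
    hJs.isSymmSndFDerivAt (by simpa using ENat.LEInfty.out)
  have hJc : ∀ a u, fderiv ℝ (fun z => fderiv ℝ φ z a) y u = fderiv ℝ (fderiv ℝ φ) y u a := by
    intro a u
    rw [(hJd.hasFDerivAt.clm_apply (hasFDerivAt_const a y)).fderiv]
    simp
  have hJcd : ∀ a, DifferentiableAt ℝ (fun z => fderiv ℝ φ z a) y := fun a =>
    hJd.clm_apply (differentiableAt_const a)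
  have hΓφ : DifferentiableAt ℝ (fun z => Γ (φ z)) y := differentiableAt_fun_comp (A := Γ) hΓ hφd
  have hΓφ' := fderiv_fun_comp_apply (A := Γ) hΓ hφd
  have hderiv : ∀ a b c, fderiv ℝ (fderiv ℝ φ) y a (Γ' y b c)
      + fderiv ℝ φ y (fderiv ℝ Γ' y a b c)
      = fderiv ℝ Γ (φ y) (fderiv ℝ φ y a) (fderiv ℝ φ y b) (fderiv ℝ φ y c)
        + Γ (φ y) (fderiv ℝ (fderiv ℝ φ) y a b) (fderiv ℝ φ y c)
        + Γ (φ y) (fderiv ℝ φ y b) (fderiv ℝ (fderiv ℝ φ) y a c)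
        + fderiv ℝ (fderiv ℝ (fderiv ℝ φ)) y a b c := by
    intro a b c
    have hΓ'd : DifferentiableAt ℝ (fun z => Γ' z b c) y :=
      (hΓ'.clm_apply (differentiableAt_const b)).clm_apply (differentiableAt_const c)
    have h0 := fderiv_apply_apply hΓ' (differentiableAt_const b) (differentiableAt_const c) a
    have h1 : fderiv ℝ (fun z => fderiv ℝ φ z (Γ' z b c)) y a
        = fderiv ℝ (fderiv ℝ φ) y a (Γ' y b c) + fderiv ℝ φ y (fderiv ℝ Γ' y a b c) := by
      rw [(hJd.hasFDerivAt.clm_apply hΓ'd.hasFDerivAt).fderiv]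
      simp only [add_apply, ContinuousLinearMap.comp_apply, ContinuousLinearMap.flip_apply, h0]
      simp [add_comm]
    have h2 := fderiv_apply_apply hΓφ (hJcd b) (hJcd c) a
    have h3 := fderiv_apply_apply hHd (differentiableAt_const b) (differentiableAt_const c) a
    have h4 : fderiv ℝ (fun z => fderiv ℝ φ z (Γ' z b c)) y
        = fderiv ℝ (fun z => Γ (φ z) (fderiv ℝ φ z b) (fderiv ℝ φ z c)
          + fderiv ℝ (fderiv ℝ φ) z b c) y :=
      Filter.EventuallyEq.fderiv_eq
        (Filter.eventually_of_mem (hV.mem_nhds hy) fun z hz => htrans z hz b c)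
    have hd1 : DifferentiableAt ℝ (fun z => Γ (φ z) (fderiv ℝ φ z b) (fderiv ℝ φ z c)) y :=
      (hΓφ.clm_apply (hJcd b)).clm_apply (hJcd c)
    have hd2 : DifferentiableAt ℝ (fun z => fderiv ℝ (fderiv ℝ φ) z b c) y :=
      (hHd.clm_apply (differentiableAt_const b)).clm_apply (differentiableAt_const c)
    rw [← h1, h4, fderiv_fun_add hd1 hd2, add_apply, h2, h3, hJc, hJc, hΓφ']
    simp
  have e1 := hderiv u v w
  have e2 := hderiv v u w
  rw [← eq_sub_iff_add_eq'] at e1 e2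
  simp only [curvatureMap, map_sub, map_add]
  rw [e1, e2, htrans y hy, htrans y hy, htrans y hy, htrans y hy, hsym2 v u, hsym3 v u]
  simp only [map_add]
  abel

end Transformation

/-! ### Christoffel symbols as bilinear maps -/

section BilinearForm

variable {n : ℕ}

/-- The bilinear map with given coefficients with respect to the standard basis. -/
noncomputable def coeffMap {F : Type*} [NormedAddCommGroup F] [NormedSpace ℝ F] (a : Fin n → Fin n → F) :
    EuclideanSpace ℝ (Fin n) →L[ℝ] EuclideanSpace ℝ (Fin n) →L[ℝ] F :=
  ∑ i, ∑ j, (EuclideanSpace.proj (𝕜 := ℝ) i).smulRight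
    ((EuclideanSpace.proj (𝕜 := ℝ) j).smulRight (a i j))

variable {F : Type*} [NormedAddCommGroup F] [NormedSpace ℝ F]

theorem coeffMap_apply (a : Fin n → Fin n → F) (v w : EuclideanSpace ℝ (Fin n)) :
    coeffMap a v w = ∑ i, ∑ j, (v i * w j) • a i j := by
  simp [coeffMap, mul_smul]

theorem coeffMap_single (a : Fin n → Fin n → F) (i j : Fin n) :
    coeffMap a (EuclideanSpace.single i 1) (EuclideanSpace.single j 1) = a i j := by
  rw [coeffMap_apply]
  simp

theorem coeffMap_coeff (A : EuclideanSpace ℝ (Fin n) →L[ℝ] EuclideanSpace ℝ (Fin n) →L[ℝ] F) :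
    coeffMap (fun i j => A (EuclideanSpace.single i 1) (EuclideanSpace.single j 1)) = A := by
  refine ContinuousLinearMap.coe_injective
    ((EuclideanSpace.basisFun (Fin n) ℝ).toBasis.ext fun i => ?_)
  refine ContinuousLinearMap.coe_injective
    ((EuclideanSpace.basisFun (Fin n) ℝ).toBasis.ext fun j => ?_)
  simp [coeffMap_single]

theorem contDiffOn_coeffMap {V : Set (EuclideanSpace ℝ (Fin n))}
    {a : EuclideanSpace ℝ (Fin n) → Fin n → Fin n → F}
    (ha : ∀ i j, ContDiffOn ℝ ∞ (fun y => a y i j) V) :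
    ContDiffOn ℝ ∞ (fun y => coeffMap (a y)) V := by
  unfold coeffMap
  refine ContDiffOn.sum fun i _ => ContDiffOn.sum fun j _ => ?_
  exact contDiffOn_const.smulRight (contDiffOn_const.smulRight (ha i j))

theorem fderiv_coeffMap_single {V : Set (EuclideanSpace ℝ (Fin n))}
    {a : EuclideanSpace ℝ (Fin n) → Fin n → Fin n → F} (hV : IsOpen V)
    (ha : ∀ i j, ContDiffOn ℝ ∞ (fun y => a y i j) V) {y : EuclideanSpace ℝ (Fin n)}
    (hy : y ∈ V) (u : EuclideanSpace ℝ (Fin n)) (i j : Fin n) :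
    fderiv ℝ (fun z => coeffMap (a z)) y u (EuclideanSpace.single i 1) (EuclideanSpace.single j 1)
      = fderiv ℝ (fun z => a z i j) y u := by
  have h := fderiv_apply_apply
    (differentiableAt_of_contDiffOn hV (contDiffOn_coeffMap ha) hy)
    (differentiableAt_const (EuclideanSpace.single i (1 : ℝ)))
    (differentiableAt_const (EuclideanSpace.single j (1 : ℝ))) u
  simp only [coeffMap_single] at h
  rw [h]
  simp

/-- The Christoffel symbols as a bilinear map. -/
noncomputable def christoffelMap (γ : EuclideanSpace ℝ (Fin n) → Matrix (Fin n) (Fin n) ℝ)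
    (y : EuclideanSpace ℝ (Fin n)) :
    EuclideanSpace ℝ (Fin n) →L[ℝ] EuclideanSpace ℝ (Fin n) →L[ℝ] EuclideanSpace ℝ (Fin n) :=
  coeffMap fun i j => WithLp.toLp 2 fun k => christoffel γ k i j y

/-- A matrix of coefficients as a field of bilinear forms. -/
noncomputable def formMap (γ : EuclideanSpace ℝ (Fin n) → Matrix (Fin n) (Fin n) ℝ)
    (y : EuclideanSpace ℝ (Fin n)) :
    EuclideanSpace ℝ (Fin n) →L[ℝ] EuclideanSpace ℝ (Fin n) →L[ℝ] ℝ :=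
  coeffMap fun i j => γ y i j

theorem formMap_apply (γ : EuclideanSpace ℝ (Fin n) → Matrix (Fin n) (Fin n) ℝ)
    (y v w : EuclideanSpace ℝ (Fin n)) :
    formMap γ y v w = ∑ i, ∑ j, v i * w j * γ y i j := by
  simp [formMap, coeffMap_apply]

/-- The curvature of the connection of `γ`, as a linear map in its first argument. -/
noncomputable def curvatureEnd (γ : EuclideanSpace ℝ (Fin n) → Matrix (Fin n) (Fin n) ℝ)
    (y v w : EuclideanSpace ℝ (Fin n)) :
    EuclideanSpace ℝ (Fin n) →ₗ[ℝ] EuclideanSpace ℝ (Fin n) where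
  toFun u := curvatureMap (christoffelMap γ) y u v w
  map_add' a b := by simp [curvatureMap]; abel
  map_smul' c a := by simp [curvatureMap, smul_sub, smul_add]

variable {γ : EuclideanSpace ℝ (Fin n) → Matrix (Fin n) (Fin n) ℝ}
  {V : Set (EuclideanSpace ℝ (Fin n))} {y : EuclideanSpace ℝ (Fin n)}

theorem IsCoordMetric.contDiffOn_christoffelMap (h : IsCoordMetric γ V) :
    ContDiffOn ℝ ∞ (christoffelMap γ) V :=
  contDiffOn_coeffMap fun i j => contDiffOn_euclidean.2 fun k => h.contDiffOn_christoffel k i j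

theorem IsCoordMetric.contDiffOn_formMap (h : IsCoordMetric γ V) :
    ContDiffOn ℝ ∞ (formMap γ) V :=
  contDiffOn_coeffMap fun i j => h.smooth i j

theorem IsCoordMetric.formMap_symm (h : IsCoordMetric γ V) (hy : y ∈ V)
    (v w : EuclideanSpace ℝ (Fin n)) : formMap γ y v w = formMap γ y w v := by
  simp only [formMap_apply]
  rw [Finset.sum_comm]
  refine Finset.sum_congr rfl fun i _ => Finset.sum_congr rfl fun j _ => ?_
  rw [h.symm hy j i, mul_comm (v j)]

theorem IsCoordMetric.formMap_pos (h : IsCoordMetric γ V) (hy : y ∈ V)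
    {v : EuclideanSpace ℝ (Fin n)} (hv : v ≠ 0) : 0 < formMap γ y v v := by
  have hv' : v.ofLp ≠ 0 := fun h0 => hv (by ext i; simp [h0])
  have := (h.posDef y hy).dotProduct_mulVec_pos hv'
  rw [formMap_apply]
  convert! this using 1
  simp only [dotProduct, Matrix.mulVec, Finset.mul_sum, Pi.star_apply, star_trivial]
  exact Finset.sum_congr rfl fun i _ => Finset.sum_congr rfl fun j _ => by ring

theorem trilinear_expand
    (A : EuclideanSpace ℝ (Fin n) →L[ℝ] EuclideanSpace ℝ (Fin n) →L[ℝ]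
      EuclideanSpace ℝ (Fin n) →L[ℝ] ℝ) (v w z : EuclideanSpace ℝ (Fin n)) :
    A v w z = ∑ i, ∑ j, ∑ k, v i * w j * z k * A (EuclideanSpace.single i 1)
      (EuclideanSpace.single j 1) (EuclideanSpace.single k 1) := by
  conv_lhs => rw [← coeffMap_coeff A, coeffMap_apply]
  simp only [sum_apply, smul_apply]
  refine Finset.sum_congr rfl fun i _ => Finset.sum_congr rfl fun j _ => ?_
  conv_lhs => rw [← (EuclideanSpace.basisFun (Fin n) ℝ).sum_repr z]
  simp [Finset.mul_sum, mul_assoc]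

/-- Both sides are trilinear, so basis vectors suffice, and there the formula is
`sum_mul_christoffel`. This is the only property of the Christoffel symbols that the transformation
law needs. -/
theorem IsCoordMetric.isKoszulAt (h : IsCoordMetric γ V) (hy : y ∈ V) :
    IsKoszulAt (formMap γ) (christoffelMap γ) y := by
  have hd := fun u i j =>
    fderiv_coeffMap_single (a := fun z i j => γ z i j) h.isOpen h.smooth hy u i j
  change ∀ u i j, fderiv ℝ (formMap γ) y u _ _ = _ at hd
  set B' := fderiv ℝ (formMap γ) y with hB'
  -- `T` is the left side of the Koszul formula as a trilinear map. `S` is the derivative of the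
  -- form with its arguments permuted, so that the direction of differentiation comes last and all
  -- terms expand in the same index order.
  let T : EuclideanSpace ℝ (Fin n) →L[ℝ] EuclideanSpace ℝ (Fin n) →L[ℝ]
      EuclideanSpace ℝ (Fin n) →L[ℝ] ℝ :=
    (ContinuousLinearMap.compL ℝ (EuclideanSpace ℝ (Fin n)) (EuclideanSpace ℝ (Fin n))
      (EuclideanSpace ℝ (Fin n) →L[ℝ] ℝ) (formMap γ y)) ∘L christoffelMap γ y
  let S : EuclideanSpace ℝ (Fin n) →L[ℝ] EuclideanSpace ℝ (Fin n) →L[ℝ]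
      EuclideanSpace ℝ (Fin n) →L[ℝ] ℝ :=
    (ContinuousLinearMap.flipₗᵢ ℝ (EuclideanSpace ℝ (Fin n)) (EuclideanSpace ℝ (Fin n))
      ℝ).toContinuousLinearEquiv.toContinuousLinearMap ∘L B'.flip
  have hT : ∀ v w z, T v w z = formMap γ y (christoffelMap γ y v w) z := fun _ _ _ => rfl
  have hS : ∀ v w z, S v w z = B' z v w := fun _ _ _ => rfl
  intro v w z
  rw [← hT, ← hB', ← hS v w z, ← ContinuousLinearMap.flip_apply B' w v, trilinear_expand T,
    trilinear_expand S, trilinear_expand B', trilinear_expand B'.flip]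
  simp only [← Finset.sum_add_distrib, ← Finset.sum_sub_distrib, Finset.mul_sum]
  refine Finset.sum_congr rfl fun i _ => Finset.sum_congr rfl fun j _ =>
    Finset.sum_congr rfl fun k _ => ?_
  have h1 : christoffelMap γ y (EuclideanSpace.single i 1) (EuclideanSpace.single j 1)
    = WithLp.toLp 2 fun k => christoffel γ k i j y := coeffMap_single _ _ _
  have h2 := h.sum_mul_christoffel hy k i j
  simp only [partialDeriv] at h2
  simp only [hT, h1, hS, ContinuousLinearMap.flip_apply, hd]
  have h3 : formMap γ y (WithLp.toLp 2 fun k => christoffel γ k i j y)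
      (EuclideanSpace.single k 1) = ∑ l, γ y k l * christoffel γ l i j y := by
    simp [formMap_apply, mul_comm, h.symm hy k]
  rw [h3, h2]
  ring

/-- A basis-free form of the Ricci curvature: the trace of u ↦ R(u,v)w is visibly unchanged under
conjugation, whereas the index formula is not. -/
theorem ricciCoord_eq_trace (h : IsCoordMetric γ V) (hy : y ∈ V) (i j : Fin n) :
    ricciCoord γ i j y = LinearMap.trace ℝ _
      (curvatureEnd γ y (EuclideanSpace.single j 1) (EuclideanSpace.single i 1)) := by
  have hd : ∀ a b c k, (fderiv ℝ (christoffelMap γ) y (EuclideanSpace.single a 1)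
      (EuclideanSpace.single b 1) (EuclideanSpace.single c 1)) k
      = partialDeriv a (christoffel γ k b c) y := by
    intro a b c k
    have hs : ∀ i j, ContDiffOn ℝ ∞ (fun z => WithLp.toLp 2 fun k => christoffel γ k i j z) V :=
      fun i j => contDiffOn_euclidean.2 fun k => h.contDiffOn_christoffel k i j
    have h1 := fderiv_coeffMap_single
      (a := fun z i j => WithLp.toLp 2 fun k => christoffel γ k i j z) h.isOpen hs hy
      (EuclideanSpace.single a 1) b c
    have h2 : christoffelMap γ = fun z => coeffMap fun i j =>
      WithLp.toLp 2 fun k => christoffel γ k i j z := rfl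
    rw [h2, h1]
    have h3 := ((EuclideanSpace.proj (𝕜 := ℝ) k).hasFDerivAt.comp y
      (differentiableAt_of_contDiffOn h.isOpen (hs b c) hy).hasFDerivAt).fderiv
    have h4 := congrArg (fun L => L (EuclideanSpace.single a (1 : ℝ))) h3
    simpa [partialDeriv, Function.comp_def] using h4.symm
  have hc : ∀ b c, christoffelMap γ y (EuclideanSpace.single b 1) (EuclideanSpace.single c 1)
      = WithLp.toLp 2 fun k => christoffel γ k b c y := fun b c => coeffMap_single _ _ _
  have hc2 : ∀ a b c k, (christoffelMap γ y (EuclideanSpace.single a 1)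
      (christoffelMap γ y (EuclideanSpace.single b 1) (EuclideanSpace.single c 1))) k
      = ∑ l, christoffel γ k a l y * christoffel γ l b c y := by
    intro a b c k
    rw [hc, christoffelMap, coeffMap_apply]
    simp [mul_comm]
  rw [LinearMap.trace_eq_matrix_trace ℝ (EuclideanSpace.basisFun (Fin n) ℝ).toBasis]
  simp only [Matrix.trace, Matrix.diag, LinearMap.toMatrix_apply, ricciCoord]
  refine Finset.sum_congr rfl fun k _ => ?_
  simp only [curvatureEnd, curvatureMap, LinearMap.coe_mk, AddHom.coe_mk,
    OrthonormalBasis.coe_toBasis, OrthonormalBasis.coe_toBasis_repr_apply,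
    EuclideanSpace.basisFun_apply, EuclideanSpace.basisFun_repr]
  simp only [PiLp.add_apply, PiLp.sub_apply, hd, hc2, Finset.sum_sub_distrib]
  -- The index formula and the trace list the lower Christoffel indices in different orders. The
  -- symmetry is needed near y, not only at y, because the symbols are differentiated.
  rw [partialDeriv_congr (Filter.eventually_of_mem (h.mem_nhds hy) fun _ hz =>
    h.christoffel_symm hz k j i), partialDeriv_congr (Filter.eventually_of_mem (h.mem_nhds hy)
    fun _ hz => h.christoffel_symm hz k k i)]
  simp only [h.christoffel_symm hy _ j i, h.christoffel_symm hy _ k i]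
  ring

/-- The Ricci curvature as a bilinear form. -/
noncomputable def ricciForm (γ : EuclideanSpace ℝ (Fin n) → Matrix (Fin n) (Fin n) ℝ)
    (y : EuclideanSpace ℝ (Fin n)) :
    EuclideanSpace ℝ (Fin n) →ₗ[ℝ] EuclideanSpace ℝ (Fin n) →ₗ[ℝ] ℝ :=
  LinearMap.mk₂ ℝ (fun w v => LinearMap.trace ℝ _ (curvatureEnd γ y v w))
    (fun a b v => by
      rw [← map_add]; congr 1; ext1 u; simp [curvatureEnd, curvatureMap]; abel)
    (fun c a v => by
      rw [← map_smul]; congr 1; ext1 u; simp [curvatureEnd, curvatureMap, smul_sub, smul_add])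
    (fun w a b => by
      rw [← map_add]; congr 1; ext1 u; simp [curvatureEnd, curvatureMap]; abel)
    (fun c w a => by
      rw [← map_smul]; congr 1; ext1 u; simp [curvatureEnd, curvatureMap, smul_sub, smul_add])

theorem bilinear_expand
    (A : EuclideanSpace ℝ (Fin n) →ₗ[ℝ] EuclideanSpace ℝ (Fin n) →ₗ[ℝ] ℝ)
    (v w : EuclideanSpace ℝ (Fin n)) :
    A v w = ∑ i, ∑ j, v i * w j * A (EuclideanSpace.single i 1) (EuclideanSpace.single j 1) := by
  conv_lhs => rw [← (EuclideanSpace.basisFun (Fin n) ℝ).sum_repr v,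
    ← (EuclideanSpace.basisFun (Fin n) ℝ).sum_repr w]
  simp only [EuclideanSpace.basisFun_repr, EuclideanSpace.basisFun_apply, map_sum, map_smul,
    LinearMap.sum_apply, LinearMap.smul_apply, smul_eq_mul, Finset.mul_sum]
  rw [Finset.sum_comm]
  exact Finset.sum_congr rfl fun i _ => Finset.sum_congr rfl fun j _ => by ring

/-- The contraction of a bilinear form with the inverse metric is invariant under a change of
basis. -/
theorem contraction_transform {A A' S S' M : Matrix (Fin n) (Fin n) ℝ} (hM : IsUnit M.det)
    (hA : A' = M.transpose * A * M) (hS : S' = M.transpose * S * M) :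
    ∑ i, ∑ j, A'⁻¹ i j * S' i j = ∑ i, ∑ j, A⁻¹ i j * S i j := by
  -- Written as a trace of a product, the contraction loses the factor M by cyclicity.
  have key : ∀ P Q : Matrix (Fin n) (Fin n) ℝ,
      ∑ i, ∑ j, P i j * Q i j = (P.transpose * Q).trace := by
    intro P Q
    rw [Finset.sum_comm]
    simp [Matrix.trace, Matrix.mul_apply]
  have hMt : IsUnit M.transpose.det := by rwa [Matrix.det_transpose]
  have hinv : (A'⁻¹).transpose = M⁻¹ * (A⁻¹).transpose * (M.transpose)⁻¹ := by
    rw [hA, Matrix.mul_inv_rev, Matrix.mul_inv_rev, Matrix.transpose_mul, Matrix.transpose_mul,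
      ← Matrix.transpose_nonsing_inv M, Matrix.transpose_transpose]
  have hprod : (A'⁻¹).transpose * S' = M⁻¹ * ((A⁻¹).transpose * S * M) := by
    rw [hinv, hS]
    calc M⁻¹ * (A⁻¹).transpose * (M.transpose)⁻¹ * (M.transpose * S * M)
        = M⁻¹ * (A⁻¹).transpose * ((M.transpose)⁻¹ * M.transpose) * (S * M) := by
          simp only [Matrix.mul_assoc]
      _ = _ := by rw [Matrix.nonsing_inv_mul _ hMt, Matrix.mul_one]; simp only [Matrix.mul_assoc]
  rw [key, key, hprod, Matrix.trace_mul_comm, Matrix.mul_assoc, Matrix.mul_nonsing_inv _ hM,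
    Matrix.mul_one]

/-- The Jacobian matrix of a map. -/
noncomputable def jacobian (φ : EuclideanSpace ℝ (Fin n) → EuclideanSpace ℝ (Fin n))
    (y : EuclideanSpace ℝ (Fin n)) : Matrix (Fin n) (Fin n) ℝ :=
  Matrix.of fun a i => fderiv ℝ φ y (EuclideanSpace.single i 1) a

/-! ### Pullback metrics and invariance of the scalar curvature -/

variable {γ' : EuclideanSpace ℝ (Fin n) → Matrix (Fin n) (Fin n) ℝ}
  {V' : Set (EuclideanSpace ℝ (Fin n))} {φ : EuclideanSpace ℝ (Fin n) → EuclideanSpace ℝ (Fin n)}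

theorem mul_jacobian_apply (A : EuclideanSpace ℝ (Fin n) →ₗ[ℝ] EuclideanSpace ℝ (Fin n) →ₗ[ℝ] ℝ)
    (i j : Fin n) :
    A (fderiv ℝ φ y (EuclideanSpace.single i 1)) (fderiv ℝ φ y (EuclideanSpace.single j 1))
      = ((jacobian φ y).transpose * (Matrix.of fun a b =>
        A (EuclideanSpace.single a 1) (EuclideanSpace.single b 1)) * jacobian φ y) i j := by
  rw [bilinear_expand]
  simp only [Matrix.mul_apply, Matrix.transpose_apply, jacobian, Matrix.of_apply, Finset.sum_mul]
  rw [Finset.sum_comm]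
  exact Finset.sum_congr rfl fun a _ => Finset.sum_congr rfl fun b _ => by ring

/-- `γ'` is the pullback of `γ` under `φ` on `V'`. -/
structure IsPullbackOn (γ' γ : EuclideanSpace ℝ (Fin n) → Matrix (Fin n) (Fin n) ℝ)
    (φ : EuclideanSpace ℝ (Fin n) → EuclideanSpace ℝ (Fin n))
    (V' V : Set (EuclideanSpace ℝ (Fin n))) : Prop where
  source : IsCoordMetric γ' V'
  target : IsCoordMetric γ V
  mapsTo : MapsTo φ V' V
  smooth : ContDiffOn ℝ ∞ φ V'
  eq : ∀ z ∈ V', γ' z = (jacobian φ z).transpose * γ (φ z) * jacobian φ z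

namespace IsPullbackOn

/-- The determinant of γ' has that of the Jacobian as a factor and is positive. -/
theorem isUnit_det (h : IsPullbackOn γ' γ φ V' V) (hy : y ∈ V') :
    IsUnit (jacobian φ y).det := by
  have h1 := h.source.det_pos hy
  rw [h.eq y hy, Matrix.det_mul] at h1
  exact (right_ne_zero_of_mul h1.ne').isUnit

theorem surjective (h : IsPullbackOn γ' γ φ V' V) (hy : y ∈ V') :
    Function.Surjective (fderiv ℝ φ y) := by
  intro v
  refine ⟨WithLp.toLp 2 ((jacobian φ y)⁻¹.mulVec v.ofLp), ?_⟩
  have h1 : ∀ w : EuclideanSpace ℝ (Fin n),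
      fderiv ℝ φ y w = WithLp.toLp 2 ((jacobian φ y).mulVec w.ofLp) := by
    intro w
    conv_lhs => rw [← (EuclideanSpace.basisFun (Fin n) ℝ).sum_repr w]
    ext a
    simp [Matrix.mulVec, dotProduct, jacobian, mul_comm]
  rw [h1]
  ext a
  simp [Matrix.mulVec_mulVec, Matrix.mul_nonsing_inv _ (h.isUnit_det hy)]

theorem formMap_eq (h : IsPullbackOn γ' γ φ V' V) (hy : y ∈ V') (v w : EuclideanSpace ℝ (Fin n)) :
    formMap γ' y v w = formMap γ (φ y) (fderiv ℝ φ y v) (fderiv ℝ φ y w) := by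
  have hb := mul_jacobian_apply (y := y) (φ := φ)
    (LinearMap.mk₂ ℝ (fun a b => formMap γ (φ y) a b) (by simp) (by simp) (by simp) (by simp))
  have he := bilinear_expand (LinearMap.mk₂ ℝ
    (fun a b => formMap γ (φ y) (fderiv ℝ φ y a) (fderiv ℝ φ y b))
    (by simp) (by simp) (by simp) (by simp)) v w
  simp only [LinearMap.mk₂_apply] at hb he
  rw [he, formMap_apply]
  refine Finset.sum_congr rfl fun i _ => Finset.sum_congr rfl fun j _ => ?_
  have hM : (Matrix.of fun a b => formMap γ (φ y) (EuclideanSpace.single a 1)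
      (EuclideanSpace.single b 1)) = γ (φ y) := by
    ext a b
    exact coeffMap_single _ _ _
  rw [hb, h.eq y hy, hM]

theorem christoffelMap_eq (h : IsPullbackOn γ' γ φ V' V) (hy : y ∈ V')
    (v w : EuclideanSpace ℝ (Fin n)) :
    fderiv ℝ φ y (christoffelMap γ' y v w)
      = christoffelMap γ (φ y) (fderiv ℝ φ y v) (fderiv ℝ φ y w)
        + fderiv ℝ (fderiv ℝ φ) y v w := by
  have hφy := h.mapsTo hy
  refine christoffel_transform h.source.isOpen hy h.smooth
    (differentiableAt_of_contDiffOn h.target.isOpen h.target.contDiffOn_formMap hφy)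
    (differentiableAt_of_contDiffOn h.source.isOpen h.source.contDiffOn_formMap hy)
    (fun z hz v w => h.formMap_eq hz v w) (h.target.formMap_symm hφy) ?_ (h.surjective hy)
    (h.target.isKoszulAt hφy) (h.source.isKoszulAt hy) v w
  intro v hv
  by_contra hne
  exact (h.target.formMap_pos hφy hne).ne' (hv v)

/-- The differential of φ conjugates the endomorphism u ↦ R(u,v)w of γ' into that of γ, and
conjugate endomorphisms have equal trace. -/
theorem ricciForm_eq (h : IsPullbackOn γ' γ φ V' V) (hy : y ∈ V')
    (v w : EuclideanSpace ℝ (Fin n)) :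
    ricciForm γ' y v w = ricciForm γ (φ y) (fderiv ℝ φ y v) (fderiv ℝ φ y w) := by
  have hφy := h.mapsTo hy
  have hinj : Function.Injective (fderiv ℝ φ y).toLinearMap :=
    LinearMap.injective_iff_surjective.2 (h.surjective hy)
  let e := LinearEquiv.ofBijective (fderiv ℝ φ y).toLinearMap ⟨hinj, h.surjective hy⟩
  have he : ∀ a, e a = fderiv ℝ φ y a := fun _ => rfl
  change LinearMap.trace ℝ _ (curvatureEnd γ' y w v) = LinearMap.trace ℝ _ (curvatureEnd γ (φ y) _ _)
  rw [← LinearMap.trace_conj' (curvatureEnd γ' y w v) e]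
  congr 1
  ext1 u
  rw [LinearEquiv.conj_apply_apply, he]
  have := curvature_transform h.source.isOpen hy h.smooth
    (differentiableAt_of_contDiffOn h.target.isOpen h.target.contDiffOn_christoffelMap hφy)
    (differentiableAt_of_contDiffOn h.source.isOpen h.source.contDiffOn_christoffelMap hy)
    (fun z hz v w => h.christoffelMap_eq hz v w) (e.symm u) w v
  rw [← he (e.symm u), LinearEquiv.apply_symm_apply] at this
  exact this

/-- The scalar curvature does not depend on the choice of coordinates. -/
theorem scalarCoord_eq (h : IsPullbackOn γ' γ φ V' V) (hy : y ∈ V') :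
    scalarCoord γ' y = scalarCoord γ (φ y) := by
  unfold scalarCoord
  refine contraction_transform (S := Matrix.of fun i j => ricciCoord γ i j (φ y))
    (S' := Matrix.of fun i j => ricciCoord γ' i j y) (h.isUnit_det hy) (h.eq y hy) ?_
  ext i j
  have h1 : ∀ a b, ricciCoord γ a b (φ y)
      = ricciForm γ (φ y) (EuclideanSpace.single a 1) (EuclideanSpace.single b 1) :=
    ricciCoord_eq_trace h.target (h.mapsTo hy)
  have h2 : ricciCoord γ' i j y
      = ricciForm γ' y (EuclideanSpace.single i 1) (EuclideanSpace.single j 1) :=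
    ricciCoord_eq_trace h.source hy i j
  simp only [Matrix.of_apply, h1, h2]
  rw [h.ricciForm_eq hy, mul_jacobian_apply]

end IsPullbackOn

end BilinearForm

/-! ### Gradients in coordinates and conformal changes of the metric -/

section Gradient

variable {n : ℕ}

/-- The components `∑ₗ g^{kl} ∂ₗ f` of the gradient of `f`. -/
noncomputable def gradUp (γ : EuclideanSpace ℝ (Fin n) → Matrix (Fin n) (Fin n) ℝ)
    (f : EuclideanSpace ℝ (Fin n) → ℝ) (k : Fin n) (y : EuclideanSpace ℝ (Fin n)) : ℝ :=
  ∑ l, (γ y)⁻¹ k l * partialDeriv l f y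

/-- The inner product `∑ᵢⱼ g^{ij} ∂ᵢ p ∂ⱼ q` of the differentials of `p` and `q`. -/
noncomputable def gradCoord (γ : EuclideanSpace ℝ (Fin n) → Matrix (Fin n) (Fin n) ℝ)
    (p q : EuclideanSpace ℝ (Fin n) → ℝ) (y : EuclideanSpace ℝ (Fin n)) : ℝ :=
  ∑ i, ∑ j, (γ y)⁻¹ i j * (partialDeriv i p y * partialDeriv j q y)

/-- The Laplacian, written as the divergence of the gradient. -/
noncomputable def laplaceCoord (γ : EuclideanSpace ℝ (Fin n) → Matrix (Fin n) (Fin n) ℝ)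
    (f : EuclideanSpace ℝ (Fin n) → ℝ) (y : EuclideanSpace ℝ (Fin n)) : ℝ :=
  ∑ k, partialDeriv k (gradUp γ f k) y + ∑ l, (∑ k, christoffel γ k k l y) * gradUp γ f l y

variable {γ γ' : EuclideanSpace ℝ (Fin n) → Matrix (Fin n) (Fin n) ℝ}
  {V V' : Set (EuclideanSpace ℝ (Fin n))} {y : EuclideanSpace ℝ (Fin n)}
  {φ : EuclideanSpace ℝ (Fin n) → EuclideanSpace ℝ (Fin n)}
  {f p q : EuclideanSpace ℝ (Fin n) → ℝ}

theorem gradCoord_eq_sum_gradUp : gradCoord γ p q y = ∑ i, partialDeriv i p y * gradUp γ q i y := by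
  simp only [gradCoord, gradUp, Finset.mul_sum]
  exact Finset.sum_congr rfl fun i _ => Finset.sum_congr rfl fun j _ => by ring

/-- The inner product of differentials does not depend on the choice of coordinates. -/
theorem IsPullbackOn.gradCoord_eq (h : IsPullbackOn γ' γ φ V' V) (hy : y ∈ V')
    (hp : DifferentiableAt ℝ p (φ y)) (hq : DifferentiableAt ℝ q (φ y)) :
    gradCoord γ' (fun z => p (φ z)) (fun z => q (φ z)) y = gradCoord γ p q (φ y) := by
  have hφ : DifferentiableAt ℝ φ y := differentiableAt_of_contDiffOn h.source.isOpen h.smooth hy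
  have hd : ∀ {r : EuclideanSpace ℝ (Fin n) → ℝ}, DifferentiableAt ℝ r (φ y) → ∀ i,
      partialDeriv i (fun z => r (φ z)) y = ∑ a, jacobian φ y a i * partialDeriv a r (φ y) := by
    intro r hr i
    rw [partialDeriv, fderiv_fun_comp_apply hr hφ, fderiv_eq_sum_partialDeriv]
    rfl
  unfold gradCoord
  refine contraction_transform
    (S := Matrix.of fun i j => partialDeriv i p (φ y) * partialDeriv j q (φ y))
    (S' := Matrix.of fun i j => partialDeriv i (fun z => p (φ z)) y
      * partialDeriv j (fun z => q (φ z)) y) (h.isUnit_det hy) (h.eq y hy) ?_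
  ext i j
  simp only [Matrix.of_apply, hd hp, hd hq, Matrix.mul_apply, Matrix.transpose_apply,
    Finset.sum_mul, Finset.mul_sum]
  exact Finset.sum_congr rfl fun a _ => Finset.sum_congr rfl fun b _ => by ring

namespace IsCoordMetric

theorem contDiffOn_gradUp (h : IsCoordMetric γ V) (hf : ContDiffOn ℝ ∞ f V) (k : Fin n) :
    ContDiffOn ℝ ∞ (gradUp γ f k) V :=
  ContDiffOn.sum fun l _ => (h.contDiffOn_inv k l).mul (contDiffOn_partialDeriv h.isOpen hf l)

theorem contDiffOn_gradCoord (h : IsCoordMetric γ V) (hp : ContDiffOn ℝ ∞ p V)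
    (hq : ContDiffOn ℝ ∞ q V) : ContDiffOn ℝ ∞ (gradCoord γ p q) V :=
  ContDiffOn.sum fun i _ => ContDiffOn.sum fun j _ => (h.contDiffOn_inv i j).mul
    ((contDiffOn_partialDeriv h.isOpen hp i).mul (contDiffOn_partialDeriv h.isOpen hq j))

theorem sum_mul_gradUp (h : IsCoordMetric γ V) (hy : y ∈ V) (f : EuclideanSpace ℝ (Fin n) → ℝ)
    (i : Fin n) : ∑ k, γ y i k * gradUp γ f k y = partialDeriv i f y := by
  simp only [gradUp, Finset.mul_sum]
  rw [Finset.sum_comm]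
  simp only [← mul_assoc, ← Finset.sum_mul, h.mul_inv_sum hy]
  simp

/-- The divergence of the gradient in terms of the volume density. -/
theorem sqrt_det_mul_laplaceCoord (h : IsCoordMetric γ V) (hf : ContDiffOn ℝ ∞ f V) (hy : y ∈ V) :
    Real.sqrt (γ y).det * laplaceCoord γ f y
      = ∑ k, partialDeriv k (fun z => Real.sqrt (γ z).det * gradUp γ f k z) y := by
  have h1 : ∀ k, partialDeriv k (fun z => Real.sqrt (γ z).det * gradUp γ f k z) y
      = Real.sqrt (γ y).det * (∑ m, christoffel γ m m k y) * gradUp γ f k y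
        + Real.sqrt (γ y).det * partialDeriv k (gradUp γ f k) y := by
    intro k
    rw [partialDeriv_mul (differentiableAt_of_contDiffOn h.isOpen h.contDiffOn_sqrt_det hy)
      (differentiableAt_of_contDiffOn h.isOpen (h.contDiffOn_gradUp hf k) hy),
      h.partialDeriv_sqrt_det hy]
  simp only [h1, Finset.sum_add_distrib, mul_assoc, ← Finset.mul_sum, laplaceCoord]
  ring

/-- The Laplacian is the trace of the covariant Hessian. -/
theorem laplaceCoord_eq_trace (h : IsCoordMetric γ V) (hf : ContDiffOn ℝ ∞ f V) (hy : y ∈ V) :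
    ∑ i, ∑ j, (γ y)⁻¹ i j * (partialDeriv i (partialDeriv j f) y
      - ∑ l, christoffel γ l i j y * partialDeriv l f y) = laplaceCoord γ f y := by
  have hpd : ∀ l, DifferentiableAt ℝ (partialDeriv l f) y := fun l =>
    differentiableAt_of_contDiffOn h.isOpen (contDiffOn_partialDeriv h.isOpen hf l) hy
  have hU : ∀ b, ∑ l, (γ y)⁻¹ b l * partialDeriv l f y = gradUp γ f b y := fun b => rfl
  have h1 : ∀ k, partialDeriv k (gradUp γ f k) y
      = ∑ l, (γ y)⁻¹ k l * partialDeriv k (partialDeriv l f) y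
        - ∑ a, ∑ b, (γ y)⁻¹ k a * partialDeriv k (fun z => γ z a b) y * gradUp γ f b y := by
    intro k
    unfold gradUp
    rw [partialDeriv_sum _ fun l _ => (h.differentiableAt_inv hy k l).fun_mul (hpd l)]
    simp only [partialDeriv_mul (h.differentiableAt_inv hy k _) (hpd _), h.partialDeriv_inv hy,
      Finset.sum_add_distrib, neg_mul, Finset.sum_neg_distrib, Finset.sum_mul, Finset.mul_sum]
    rw [add_comm, ← sub_eq_add_neg]
    congr 1
    rw [Finset.sum_comm]
    refine Finset.sum_congr rfl fun a _ => ?_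
    rw [Finset.sum_comm]
    exact Finset.sum_congr rfl fun b _ => Finset.sum_congr rfl fun l _ => by ring
  -- Metric compatibility splits the derivative of γ into two halves: one gives the contracted
  -- Christoffel term of the divergence, the other the Christoffel term of the Hessian.
  have h2 : ∑ k, ∑ a, ∑ b, (γ y)⁻¹ k a * partialDeriv k (fun z => γ z a b) y * gradUp γ f b y
      = ∑ l, (∑ k, christoffel γ k k l y) * gradUp γ f l y
        + ∑ k, ∑ a, (γ y)⁻¹ k a * ∑ c, christoffel γ c k a y * partialDeriv c f y := by
    have e1 : ∀ k b, ∑ a, (γ y)⁻¹ k a * ∑ c, γ y a c * christoffel γ c b k y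
        = christoffel γ k k b y := by
      intro k b
      simp only [Finset.mul_sum]
      rw [Finset.sum_comm]
      simp only [← mul_assoc, ← Finset.sum_mul, h.inv_mul_sum hy]
      simp [h.christoffel_symm hy k b k]
    have e2 : ∀ a k, ∑ b, (∑ c, γ y b c * christoffel γ c a k y) * gradUp γ f b y
        = ∑ c, christoffel γ c k a y * partialDeriv c f y := by
      intro a k
      simp only [Finset.sum_mul]
      rw [Finset.sum_comm]
      refine Finset.sum_congr rfl fun c _ => ?_
      rw [← h.sum_mul_gradUp hy f c, Finset.mul_sum]
      refine Finset.sum_congr rfl fun b _ => ?_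
      rw [h.christoffel_symm hy c k a, h.symm hy b c]
      ring
    have e3 : ∀ k, ∑ a, ∑ b, (γ y)⁻¹ k a * partialDeriv k (fun z => γ z a b) y * gradUp γ f b y
        = ∑ b, christoffel γ k k b y * gradUp γ f b y
          + ∑ a, (γ y)⁻¹ k a * ∑ c, christoffel γ c k a y * partialDeriv c f y := by
      intro k
      simp only [h.partialDeriv_eq_sum_christoffel hy, mul_add, add_mul, Finset.sum_add_distrib]
      congr 1
      · rw [Finset.sum_comm]
        simp only [← Finset.sum_mul, e1]
      · refine Finset.sum_congr rfl fun a _ => ?_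
        rw [← e2, Finset.mul_sum]
        exact Finset.sum_congr rfl fun b _ => by ring
    simp only [e3, Finset.sum_add_distrib, Finset.sum_mul]
    rw [Finset.sum_comm]
  unfold laplaceCoord
  simp only [h1, Finset.sum_sub_distrib, h2, mul_sub]
  ring

end IsCoordMetric

end Gradient

/-! ### The conformal change formula -/

section Conformal

variable {n : ℕ}

/-- The algebraic part of the conformal change of the Ricci curvature: `A` is the difference of
the Christoffel symbols, `F` the differential, `U` the gradient and `H` the matrix of second
derivatives of the conformal exponent. -/
theorem ricci_conformal_algebra (g H : Fin n → Fin n → ℝ) (Γ dg : Fin n → Fin n → Fin n → ℝ)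
    (F U : Fin n → ℝ) (dU : Fin n → Fin n → ℝ)
    (hg : ∀ i j, g i j = g j i) (hΓ : ∀ k i j, Γ k i j = Γ k j i) (hH : ∀ i j, H i j = H j i)
    (hU : ∀ i, ∑ k, g i k * U k = F i)
    (hdU : ∀ j i, ∑ k, (dg j i k * U k + g i k * dU j k) = H j i)
    (hdg : ∀ l i j, dg l i j = ∑ k, g i k * Γ k j l + ∑ k, g j k * Γ k i l)
    (A : Fin n → Fin n → Fin n → ℝ) (dA : Fin n → Fin n → Fin n → Fin n → ℝ)
    (hA : ∀ k i j, A k i j = (if k = i then F j else 0) + (if k = j then F i else 0) - g i j * U k)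
    (hdA : ∀ m k i j, dA m k i j = (if k = i then H m j else 0) + (if k = j then H m i else 0)
      - (dg m i j * U k + g i j * dU m k)) (i j : Fin n) :
    ∑ k, (dA k k i j - dA j k i k + ∑ l, ((Γ k k l + A k k l) * (Γ l i j + A l i j)
      - (Γ k j l + A k j l) * (Γ l i k + A l i k)))
    = ∑ k, ∑ l, (Γ k k l * Γ l i j - Γ k j l * Γ l i k)
      - ((n : ℝ) - 2) * (H i j - ∑ l, Γ l i j * F l)
      - g i j * (∑ k, dU k k + ∑ l, (∑ k, Γ k k l) * U l)
      + ((n : ℝ) - 2) * (F i * F j - g i j * ∑ k, F k * U k) := by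
  have hAtr : ∀ l, ∑ k, A k k l = n * F l := by
    intro l
    simp only [hA, Finset.sum_sub_distrib, Finset.sum_add_distrib]
    simp [hg _ l, hU]
  have hAsymm : ∀ k i j, A k i j = A k j i := fun k i j => by rw [hA, hA, hg i j]; ring
  have hFA : ∀ i j, ∑ l, F l * A l i j = 2 * (F i * F j) - g i j * ∑ k, F k * U k := by
    intro i j
    simp only [hA, mul_sub, mul_add, Finset.sum_sub_distrib, Finset.sum_add_distrib,
      Finset.mul_sum]
    simp only [mul_ite, mul_zero, Finset.sum_ite_eq', Finset.mem_univ, if_true]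
    have : ∀ k, F k * (g i j * U k) = g i j * (F k * U k) := fun k => by ring
    simp only [this]
    ring
  -- `t1` to `t8` evaluate the contractions that appear when Γ + A is inserted into the Ricci
  -- formula: `t1` and `t2` the derivatives of A, `t3` to `t8` the products containing A.
  have t1 : ∑ k, dA k k i j = 2 * H i j - ∑ k, dg k i j * U k - g i j * ∑ k, dU k k := by
    simp only [hdA, Finset.sum_sub_distrib, Finset.sum_add_distrib, Finset.mul_sum]
    simp [hH j i]
    ring
  have t2 : ∑ k, dA j k i k = n * H i j := by
    simp only [hdA, Finset.sum_sub_distrib, hdU, Finset.sum_add_distrib]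
    simp [hH j i]
  have t3 : ∑ k, ∑ l, Γ k k l * A l i j = (∑ k, Γ k k i) * F j + (∑ k, Γ k k j) * F i
      - g i j * ∑ l, (∑ k, Γ k k l) * U l := by
    rw [Finset.sum_comm]
    simp only [← Finset.sum_mul]
    simp only [hA, mul_sub, mul_add, Finset.sum_sub_distrib, Finset.sum_add_distrib,
      Finset.mul_sum]
    simp only [mul_ite, mul_zero, Finset.sum_ite_eq', Finset.mem_univ, if_true]
    congr 1
    exact Finset.sum_congr rfl fun k _ => by ring
  have t4 : ∑ k, ∑ l, A k k l * Γ l i j = n * ∑ l, Γ l i j * F l := by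
    rw [Finset.sum_comm]
    simp only [← Finset.sum_mul, hAtr, Finset.mul_sum]
    exact Finset.sum_congr rfl fun k _ => by ring
  have t5 : ∑ k, ∑ l, A k k l * A l i j = n * (2 * (F i * F j) - g i j * ∑ k, F k * U k) := by
    rw [Finset.sum_comm]
    simp only [← Finset.sum_mul, hAtr]
    rw [← hFA, Finset.mul_sum]
    exact Finset.sum_congr rfl fun k _ => by ring
  have t6 : ∀ i j, ∑ k, ∑ l, Γ k j l * A l i k
      = ∑ k, Γ k i j * F k + (∑ k, Γ k k j) * F i - ∑ l, (∑ k, g i k * Γ k j l) * U l := by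
    intro i j
    simp only [hA, mul_sub, mul_add, Finset.sum_sub_distrib, Finset.sum_add_distrib]
    simp only [mul_ite, mul_zero, Finset.sum_ite_eq', Finset.mem_univ, if_true]
    congr 1
    · rw [Finset.sum_mul]
      congr 1
      · exact Finset.sum_congr rfl fun k _ => by rw [hΓ]
      · exact Finset.sum_congr rfl fun k _ => by rw [hΓ]
    · simp only [Finset.sum_mul]
      rw [Finset.sum_comm]
      exact Finset.sum_congr rfl fun k _ => Finset.sum_congr rfl fun l _ => by ring
  have t7 : ∑ k, ∑ l, A k j l * Γ l i k
      = ∑ k, Γ k i j * F k + (∑ k, Γ k k i) * F j - ∑ l, (∑ k, g j k * Γ k i l) * U l := by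
    have := t6 j i
    rw [Finset.sum_comm] at this
    rw [show ∑ k, Γ k i j * F k = ∑ k, Γ k j i * F k from
      Finset.sum_congr rfl fun k _ => by rw [hΓ], ← this]
    exact Finset.sum_congr rfl fun k _ => Finset.sum_congr rfl fun l _ => by ring
  have t8 : ∑ k, ∑ l, A k j l * A l i k
      = (n + 2) * (F i * F j) - 2 * (g i j * ∑ k, F k * U k) := by
    have e : ∀ k l, A k j l * A l i k = (if k = j then F l * A l i k else 0)
        + (if k = l then F j * A l i k else 0) - U k * g j l * A l i k := by
      intro k l
      rw [hA k j l]
      split_ifs <;> ring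
    simp only [e, Finset.sum_sub_distrib, Finset.sum_add_distrib]
    have e1 : ∑ k, ∑ l, (if k = j then F l * A l i k else 0)
        = 2 * (F i * F j) - g i j * ∑ k, F k * U k := by
      rw [← hFA, Finset.sum_comm]
      simp
    have e2 : ∑ k, ∑ l, (if k = l then F j * A l i k else 0) = n * (F i * F j) := by
      simp only [Finset.sum_ite_eq, Finset.mem_univ, if_true, ← Finset.mul_sum]
      have : ∑ k, A k i k = n * F i := by
        rw [← hAtr]; exact Finset.sum_congr rfl fun k _ => hAsymm _ _ _
      rw [this]; ring
    have e3 : ∑ k, ∑ l, U k * g j l * A l i k = g i j * ∑ k, F k * U k := by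
      have e4 : ∀ k, ∑ l, g j l * A l i k = g i j * F k + g j k * F i - g i k * F j := by
        intro k
        simp only [hA, mul_sub, mul_add, Finset.sum_sub_distrib, Finset.sum_add_distrib]
        simp only [mul_ite, mul_zero, Finset.sum_ite_eq', Finset.mem_univ, if_true]
        have : ∑ x, g j x * (g i k * U x) = g i k * F j := by
          rw [← hU j, Finset.mul_sum]
          exact Finset.sum_congr rfl fun k _ => by ring
        rw [this, hg i j]
      simp only [mul_assoc, ← Finset.mul_sum, e4]
      have e5 : ∀ k, U k * (g i j * F k + g j k * F i - g i k * F j)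
          = g i j * (F k * U k) + (g j k * U k) * F i - (g i k * U k) * F j := fun k => by ring
      simp only [e5, Finset.sum_sub_distrib, Finset.sum_add_distrib, ← Finset.mul_sum,
        ← Finset.sum_mul, hU]
      ring
    rw [e1, e2, e3]
    ring
  -- By metric compatibility the derivative of g left over in `t1` cancels the last sums in `t6` and
  -- `t7`.
  have t9 : ∑ k, dg k i j * U k
      = ∑ l, (∑ k, g i k * Γ k j l) * U l + ∑ l, (∑ k, g j k * Γ k i l) * U l := by
    simp only [hdg, add_mul, Finset.sum_add_distrib]
  have e : ∀ k l, (Γ k k l + A k k l) * (Γ l i j + A l i j)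
      - (Γ k j l + A k j l) * (Γ l i k + A l i k)
      = (Γ k k l * Γ l i j - Γ k j l * Γ l i k) + Γ k k l * A l i j + A k k l * Γ l i j
        + A k k l * A l i j - Γ k j l * A l i k - A k j l * Γ l i k - A k j l * A l i k :=
    fun k l => by ring
  simp only [e]
  rw [Finset.sum_add_distrib, Finset.sum_sub_distrib, t1, t2]
  simp only [Finset.sum_add_distrib, Finset.sum_sub_distrib, t3, t4, t5, t6, t7, t8, t9]
  ring

variable {γ : EuclideanSpace ℝ (Fin n) → Matrix (Fin n) (Fin n) ℝ}
  {V : Set (EuclideanSpace ℝ (Fin n))} {y : EuclideanSpace ℝ (Fin n)}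
  {f : EuclideanSpace ℝ (Fin n) → ℝ}

theorem inv_exp_smul (M : Matrix (Fin n) (Fin n) ℝ) (c : ℝ) :
    (Real.exp c • M)⁻¹ = Real.exp (-c) • M⁻¹ := by
  by_cases h : IsUnit M.det
  · have := Matrix.inv_smul' (A := M) (Units.mk0 (Real.exp c) (Real.exp_pos c).ne') h
    rw [Real.exp_neg]
    simpa [Units.smul_def] using this
  -- For a singular matrix both sides are 0, the default value of the inverse, since scaling by a
  -- nonzero number keeps it singular.
  · rw [Matrix.nonsing_inv_apply_not_isUnit _ h, smul_zero, Matrix.nonsing_inv_apply_not_isUnit]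
    rw [Matrix.det_smul]
    intro h'
    exact h (isUnit_of_mul_isUnit_right h')

namespace IsCoordMetric

/-- The factors e^{2f} and e^{-2f} cancel; the derivatives of the exponential leave a tensor that is
linear in df. -/
theorem christoffel_exp_smul (h : IsCoordMetric γ V) (hf : ContDiffOn ℝ ∞ f V) (hy : y ∈ V)
    (k i j : Fin n) :
    christoffel (fun z => Real.exp (2 * f z) • γ z) k i j y
      = christoffel γ k i j y + ((if k = i then partialDeriv j f y else 0)
        + (if k = j then partialDeriv i f y else 0) - γ y i j * gradUp γ f k y) := by
  have hfd : DifferentiableAt ℝ f y := differentiableAt_of_contDiffOn h.isOpen hf hy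
  have hed : DifferentiableAt ℝ (fun z => Real.exp (2 * f z)) y := (hfd.const_mul 2).exp
  have hep : ∀ m, partialDeriv m (fun z => Real.exp (2 * f z)) y
      = Real.exp (2 * f y) * (2 * partialDeriv m f y) := by
    intro m
    rw [partialDeriv_comp (Real.hasDerivAt_exp _) (hfd.const_mul 2), partialDeriv_const_mul hfd]
  have hp : ∀ m a b, partialDeriv m (fun z => Real.exp (2 * f z) * γ z a b) y
      = Real.exp (2 * f y) * (2 * partialDeriv m f y * γ y a b
        + partialDeriv m (fun z => γ z a b) y) := by
    intro m a b
    rw [partialDeriv_mul hed (h.differentiableAt hy a b), hep]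
    ring
  simp only [christoffel, inv_exp_smul, Matrix.smul_apply, smul_eq_mul, hp]
  have hE : Real.exp (-(2 * f y)) * Real.exp (2 * f y) = 1 := by
    rw [← Real.exp_add]; simp
  have e : ∀ l, Real.exp (-(2 * f y)) * (γ y)⁻¹ k l *
      (Real.exp (2 * f y) * (2 * partialDeriv i f y * γ y j l + partialDeriv i (fun z => γ z j l) y)
        + Real.exp (2 * f y) * (2 * partialDeriv j f y * γ y i l
          + partialDeriv j (fun z => γ z i l) y)
        - Real.exp (2 * f y) * (2 * partialDeriv l f y * γ y i j
          + partialDeriv l (fun z => γ z i j) y))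
      = (γ y)⁻¹ k l * (partialDeriv i (fun z => γ z j l) y + partialDeriv j (fun z => γ z i l) y
        - partialDeriv l (fun z => γ z i j) y)
        + 2 * ((γ y)⁻¹ k l * γ y l j * partialDeriv i f y + (γ y)⁻¹ k l * γ y l i * partialDeriv j f y
          - γ y i j * ((γ y)⁻¹ k l * partialDeriv l f y)) := by
    intro l
    rw [h.symm hy l j, h.symm hy l i]
    linear_combination (γ y)⁻¹ k l * ((2 * partialDeriv i f y * γ y j l
      + partialDeriv i (fun z => γ z j l) y) + (2 * partialDeriv j f y * γ y i l
          + partialDeriv j (fun z => γ z i l) y) - (2 * partialDeriv l f y * γ y i j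
          + partialDeriv l (fun z => γ z i j) y)) * hE
  simp only [e, Finset.sum_add_distrib, ← Finset.mul_sum, Finset.sum_sub_distrib,
    ← Finset.sum_mul, h.inv_mul_sum hy, gradUp]
  simp only [ite_mul, one_mul, zero_mul]
  ring

/-- The scalar curvature of the conformal metric `e^{2f} g`. -/
theorem scalarCoord_exp_smul (h : IsCoordMetric γ V) (hf : ContDiffOn ℝ ∞ f V) (hy : y ∈ V) :
    scalarCoord (fun z => Real.exp (2 * f z) • γ z) y
      = Real.exp (-(2 * f y)) * (scalarCoord γ y - 2 * ((n : ℝ) - 1) * laplaceCoord γ f y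
        - ((n : ℝ) - 1) * ((n : ℝ) - 2) * gradCoord γ f f y) := by
  have hpd : ∀ l, DifferentiableAt ℝ (partialDeriv l f) y := fun l =>
    differentiableAt_of_contDiffOn h.isOpen (contDiffOn_partialDeriv h.isOpen hf l) hy
  have hUd : ∀ l, DifferentiableAt ℝ (gradUp γ f l) y := fun l =>
    differentiableAt_of_contDiffOn h.isOpen (h.contDiffOn_gradUp hf l) hy
  -- The difference of the two Levi-Civita connections, kept as a function so that its derivatives
  -- can enter the Ricci formula.
  set A : Fin n → Fin n → Fin n → EuclideanSpace ℝ (Fin n) → ℝ := fun k i j z =>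
    (if k = i then partialDeriv j f z else 0) + (if k = j then partialDeriv i f z else 0)
      - γ z i j * gradUp γ f k z with hAdef
  have hite : ∀ (c : Prop) [Decidable c] (l : Fin n),
      DifferentiableAt ℝ (fun z => if c then partialDeriv l f z else 0) y := by
    intro c _ l
    split_ifs
    exacts [hpd l, differentiableAt_const _]
  have hgU : ∀ i j k, DifferentiableAt ℝ (fun z => γ z i j * gradUp γ f k z) y := fun i j k =>
    (h.differentiableAt hy i j).fun_mul (hUd k)
  have hAd : ∀ k i j, DifferentiableAt ℝ (A k i j) y := fun k i j =>
    ((hite _ _).fun_add (hite _ _)).fun_sub (hgU i j k)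
  have hpite : ∀ (c : Prop) [Decidable c] (l m : Fin n),
      partialDeriv m (fun z => if c then partialDeriv l f z else 0) y
        = if c then partialDeriv m (partialDeriv l f) y else 0 := by
    intro c _ l m
    split_ifs
    exacts [rfl, partialDeriv_const _ _]
  have hdA : ∀ m k i j, partialDeriv m (A k i j) y
      = (if k = i then partialDeriv m (partialDeriv j f) y else 0)
        + (if k = j then partialDeriv m (partialDeriv i f) y else 0)
        - (partialDeriv m (fun z => γ z i j) y * gradUp γ f k y
          + γ y i j * partialDeriv m (gradUp γ f k) y) := by
    intro m k i j
    rw [hAdef]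
    simp only
    rw [partialDeriv_sub ((hite _ _).fun_add (hite _ _)) (hgU i j k),
      partialDeriv_add (hite _ _) (hite _ _), partialDeriv_mul (h.differentiableAt hy i j) (hUd k),
      hpite, hpite]
  have hchr : ∀ k i j, ∀ z ∈ V, christoffel (fun z => Real.exp (2 * f z) • γ z) k i j z
      = christoffel γ k i j z + A k i j z := fun k i j z hz => h.christoffel_exp_smul hf hz k i j
  have hdchr : ∀ m k i j, partialDeriv m (christoffel (fun z => Real.exp (2 * f z) • γ z) k i j) y
      = partialDeriv m (christoffel γ k i j) y + partialDeriv m (A k i j) y := by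
    intro m k i j
    rw [partialDeriv_congr (Filter.eventually_of_mem (h.mem_nhds hy) (hchr k i j)),
      partialDeriv_add (h.differentiableAt_christoffel hy k i j) (hAd k i j)]
  have hric : ∀ i j, ricciCoord (fun z => Real.exp (2 * f z) • γ z) i j y = ricciCoord γ i j y
      - ((n : ℝ) - 2) * (partialDeriv i (partialDeriv j f) y
        - ∑ l, christoffel γ l i j y * partialDeriv l f y)
      - γ y i j * laplaceCoord γ f y
      + ((n : ℝ) - 2) * (partialDeriv i f y * partialDeriv j f y
        - γ y i j * gradCoord γ f f y) := by
    intro i j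
    have alg := ricci_conformal_algebra (fun i j => γ y i j)
      (fun i j => partialDeriv i (partialDeriv j f) y) (fun k i j => christoffel γ k i j y)
      (fun m i j => partialDeriv m (fun z => γ z i j) y) (fun i => partialDeriv i f y)
      (fun k => gradUp γ f k y) (fun m k => partialDeriv m (gradUp γ f k) y)
      (h.symm hy) (h.christoffel_symm hy)
      (fun i j => partialDeriv_comm (hf.contDiffAt (h.mem_nhds hy)) i j)
      (h.sum_mul_gradUp hy f) ?_ (h.partialDeriv_eq_sum_christoffel hy)
      (fun k i j => A k i j y) (fun m k i j => partialDeriv m (A k i j) y) (fun _ _ _ => rfl) hdA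
      i j
    · unfold ricciCoord
      simp only [hdchr, hchr _ _ _ y hy]
      rw [gradCoord_eq_sum_gradUp, laplaceCoord]
      simp only [Finset.sum_add_distrib, Finset.sum_sub_distrib] at alg ⊢
      linarith
    · intro j i
      rw [← partialDeriv_congr (Filter.eventually_of_mem (h.mem_nhds hy)
        fun z hz => h.sum_mul_gradUp hz f i) j, partialDeriv_sum _ fun k _ => hgU i k k]
      exact Finset.sum_congr rfl fun k _ =>
        (partialDeriv_mul (h.differentiableAt hy i k) (hUd k) j).symm
  -- Tracing γ gives n, so the two Laplacian contributions add up to -(n-2) - n = -2(n-1), and the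
  -- two gradient ones to (n-2)(1-n).
  have htr : ∑ i, ∑ j, (γ y)⁻¹ i j * γ y i j = n := by
    have : ∀ i, ∑ j, (γ y)⁻¹ i j * γ y i j = 1 := by
      intro i
      have := h.inv_mul_sum hy i i
      simp only [if_true] at this
      rw [← this]
      exact Finset.sum_congr rfl fun j _ => by rw [h.symm hy i j]
    simp [this]
  have hlap := h.laplaceCoord_eq_trace hf hy
  unfold scalarCoord
  simp only [inv_exp_smul, Matrix.smul_apply, smul_eq_mul, mul_assoc, ← Finset.mul_sum, hric]
  congr 1
  have e : ∀ i j, (γ y)⁻¹ i j * (ricciCoord γ i j y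
      - ((n : ℝ) - 2) * (partialDeriv i (partialDeriv j f) y
        - ∑ l, christoffel γ l i j y * partialDeriv l f y)
      - γ y i j * laplaceCoord γ f y
      + ((n : ℝ) - 2) * (partialDeriv i f y * partialDeriv j f y
        - γ y i j * gradCoord γ f f y))
      = (γ y)⁻¹ i j * ricciCoord γ i j y
        - ((n : ℝ) - 2) * ((γ y)⁻¹ i j * (partialDeriv i (partialDeriv j f) y
          - ∑ l, christoffel γ l i j y * partialDeriv l f y))
        - ((γ y)⁻¹ i j * γ y i j) * laplaceCoord γ f y
        + ((n : ℝ) - 2) * ((γ y)⁻¹ i j * (partialDeriv i f y * partialDeriv j f y))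
        - (γ y)⁻¹ i j * γ y i j * (((n : ℝ) - 2) * gradCoord γ f f y) := fun i j => by ring
  simp only [e, Finset.sum_add_distrib, Finset.sum_sub_distrib, ← Finset.mul_sum, ← Finset.sum_mul,
    htr, hlap]
  rw [← gradCoord]
  ring

end IsCoordMetric

end Conformal

/-! ### Metrics in charts -/

section Charts

variable {n : ℕ} {X : Type*} [TopologicalSpace X]
  [ChartedSpace (EuclideanSpace ℝ (Fin n)) X] [IsManifold (𝓡 n) ∞ X]

instance isManifold_one : IsManifold (𝓡 n) 1 X := IsManifold.of_le (n := ∞) ENat.LEInfty.out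

/-- The coordinate change from the chart at `x₁` to the chart at `x₀`. -/
noncomputable def transition (x₁ x₀ : X) (y : EuclideanSpace ℝ (Fin n)) : EuclideanSpace ℝ (Fin n) :=
  extChartAt (𝓡 n) x₀ ((extChartAt (𝓡 n) x₁).symm y)

/-- The domain of the coordinate change from the chart at `x₁` to the chart at `x₀`. -/
def overlap (x₁ x₀ : X) : Set (EuclideanSpace ℝ (Fin n)) :=
  (extChartAt (𝓡 n) x₁).target ∩ (extChartAt (𝓡 n) x₁).symm ⁻¹' (extChartAt (𝓡 n) x₀).source

theorem isOpen_overlap (x₁ x₀ : X) : IsOpen (overlap (n := n) x₁ x₀) :=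
  (continuousOn_extChartAt_symm x₁).isOpen_inter_preimage (isOpen_extChartAt_target x₁)
    (isOpen_extChartAt_source x₀)

theorem mapsTo_transition (x₁ x₀ : X) :
    MapsTo (transition (n := n) x₁ x₀) (overlap x₁ x₀) (extChartAt (𝓡 n) x₀).target :=
  fun _ hy => (extChartAt (𝓡 n) x₀).map_source hy.2

theorem contDiffOn_transition (x₁ x₀ : X) :
    ContDiffOn ℝ ∞ (transition (n := n) x₁ x₀) (overlap x₁ x₀) := by
  rw [← contMDiffOn_iff_contDiffOn]
  refine (contMDiffOn_extChartAt (n := ∞)).comp ((contMDiffOn_extChartAt_symm x₁).mono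
    inter_subset_left) fun y hy => ?_
  simpa using hy.2

theorem symm_transition {x₁ x₀ : X} {y : EuclideanSpace ℝ (Fin n)} (hy : y ∈ overlap x₁ x₀) :
    (extChartAt (𝓡 n) x₀).symm (transition x₁ x₀ y) = (extChartAt (𝓡 n) x₁).symm y :=
  (extChartAt (𝓡 n) x₀).left_inv hy.2

theorem mdifferentiableAt_symm {x₀ : X} {y : EuclideanSpace ℝ (Fin n)}
    (hy : y ∈ (extChartAt (𝓡 n) x₀).target) :
    MDifferentiableAt 𝓘(ℝ, EuclideanSpace ℝ (Fin n)) (𝓡 n) (extChartAt (𝓡 n) x₀).symm y :=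
  ((contMDiffOn_extChartAt_symm (n := ∞) x₀).contMDiffAt
    ((isOpen_extChartAt_target x₀).mem_nhds hy)).mdifferentiableAt (by simp)

/-- The inner product of a metric on a tangent space, on the model space. -/
noncomputable def metricAt (g : SmoothMetric n X) (x : X) :
    EuclideanSpace ℝ (Fin n) →L[ℝ] EuclideanSpace ℝ (Fin n) →L[ℝ] ℝ := g.inner x

/-- The derivative of the inverse chart, with values in the model space. -/
noncomputable def chartDeriv (x₀ : X) (y : EuclideanSpace ℝ (Fin n)) :
    EuclideanSpace ℝ (Fin n) →L[ℝ] EuclideanSpace ℝ (Fin n) :=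
  mfderiv 𝓘(ℝ, EuclideanSpace ℝ (Fin n)) (𝓡 n) (extChartAt (𝓡 n) x₀).symm y

theorem chartDeriv_transition {x₁ x₀ : X} {y : EuclideanSpace ℝ (Fin n)} (hy : y ∈ overlap x₁ x₀)
    (v : EuclideanSpace ℝ (Fin n)) :
    chartDeriv x₁ y v = chartDeriv x₀ (transition x₁ x₀ y) (fderiv ℝ (transition x₁ x₀) y v) := by
  have hd : DifferentiableAt ℝ (transition x₁ x₀) y :=
    differentiableAt_of_contDiffOn (isOpen_overlap x₁ x₀) (contDiffOn_transition x₁ x₀) hy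
  have h1 := mfderiv_comp y (mdifferentiableAt_symm (mapsTo_transition x₁ x₀ hy))
    hd.mdifferentiableAt
  have h2 : (extChartAt (𝓡 n) x₁).symm =ᶠ[nhds y]
      (extChartAt (𝓡 n) x₀).symm ∘ transition x₁ x₀ :=
    Filter.eventually_of_mem ((isOpen_overlap x₁ x₀).mem_nhds hy) fun z hz =>
      (symm_transition hz).symm
  have h3 := h2.mfderiv_eq (I := 𝓘(ℝ, EuclideanSpace ℝ (Fin n))) (I' := 𝓡 n)
  rw [mfderiv_eq_fderiv] at h1
  have h4 : chartDeriv x₁ y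
      = (chartDeriv x₀ (transition x₁ x₀ y)).comp (fderiv ℝ (transition x₁ x₀) y) :=
    h3.trans h1
  rw [h4]
  rfl

theorem metricCoeff_eq (g : SmoothMetric n X) (x₀ : X) (y : EuclideanSpace ℝ (Fin n))
    (i j : Fin n) : metricCoeff g x₀ y i j
      = metricAt g ((extChartAt (𝓡 n) x₀).symm y)
        (chartDeriv x₀ y (EuclideanSpace.single i 1))
        (chartDeriv x₀ y (EuclideanSpace.single j 1)) := rfl

theorem metricCoeff_transition (g : SmoothMetric n X) {x₁ x₀ : X} {y : EuclideanSpace ℝ (Fin n)}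
    (hy : y ∈ overlap x₁ x₀) :
    metricCoeff g x₁ y = (jacobian (transition x₁ x₀) y).transpose
      * metricCoeff g x₀ (transition x₁ x₀ y) * jacobian (transition x₁ x₀) y := by
  ext i j
  rw [metricCoeff_eq, chartDeriv_transition hy, chartDeriv_transition hy, ← symm_transition hy]
  exact mul_jacobian_apply (LinearMap.mk₂ ℝ (fun a b =>
    metricAt g ((extChartAt (𝓡 n) x₀).symm (transition x₁ x₀ y))
        (chartDeriv x₀ (transition x₁ x₀ y) a) (chartDeriv x₀ (transition x₁ x₀ y) b))
    (by simp) (by simp) (by simp) (by simp)) i j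

theorem chartDeriv_bijective {x₀ : X} {y : EuclideanSpace ℝ (Fin n)}
    (hy : y ∈ (extChartAt (𝓡 n) x₀).target) : Function.Bijective (chartDeriv x₀ y) := by
  have h := isInvertible_mfderivWithin_extChartAt_symm (I := 𝓡 n) hy
  rw [ModelWithCorners.range_eq_univ, mfderivWithin_univ] at h
  exact h.bijective

theorem metricCoeff_quadForm (g : SmoothMetric n X) (x₀ : X) (y : EuclideanSpace ℝ (Fin n))
    (v w : EuclideanSpace ℝ (Fin n)) :
    ∑ i, ∑ j, v i * w j * metricCoeff g x₀ y i j = metricAt g ((extChartAt (𝓡 n) x₀).symm y)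
        (chartDeriv x₀ y v) (chartDeriv x₀ y w) :=
  (bilinear_expand (LinearMap.mk₂ ℝ (fun a b =>
    metricAt g ((extChartAt (𝓡 n) x₀).symm y)
        (chartDeriv x₀ y a) (chartDeriv x₀ y b))
    (by simp) (by simp) (by simp) (by simp)) v w).symm

theorem metricCoeff_posDef (g : SmoothMetric n X) {x₀ : X} {y : EuclideanSpace ℝ (Fin n)}
    (hy : y ∈ (extChartAt (𝓡 n) x₀).target) : (metricCoeff g x₀ y).PosDef := by
  refine Matrix.PosDef.of_dotProduct_mulVec_pos ?_ ?_
  · ext i j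
    exact g.symm _ _ _
  · intro v hv
    have h1 := metricCoeff_quadForm g x₀ y (WithLp.toLp 2 v) (WithLp.toLp 2 v)
    have h2 : (WithLp.toLp 2 v : EuclideanSpace ℝ (Fin n)) ≠ 0 := fun h => hv (by
      ext i; simpa using congrArg (fun u : EuclideanSpace ℝ (Fin n) => u i) h)
    have h3 : chartDeriv x₀ y (WithLp.toLp 2 v) ≠ 0 := fun h =>
      h2 ((chartDeriv_bijective hy).1 (h.trans (map_zero _).symm))
    have h4 := g.pos ((extChartAt (𝓡 n) x₀).symm y) (chartDeriv x₀ y (WithLp.toLp 2 v)) h3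
    have h5 : star v ⬝ᵥ (metricCoeff g x₀ y).mulVec v
        = ∑ i, ∑ j, v i * v j * metricCoeff g x₀ y i j := by
      simp only [dotProduct, Matrix.mulVec, Finset.mul_sum, Pi.star_apply, star_trivial]
      exact Finset.sum_congr rfl fun i _ => Finset.sum_congr rfl fun j _ => by ring
    rw [h5]
    exact lt_of_lt_of_eq h4 h1.symm

/-- A coordinate field is the tangent map of the inverse chart applied to a constant field, hence
smooth as a map into the tangent bundle. -/
theorem contMDiffOn_coordVector (x₀ : X) (i : Fin n) :
    ContMDiffOn 𝓘(ℝ, EuclideanSpace ℝ (Fin n)) (𝓡 n).tangent ∞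
      (fun y => (⟨(extChartAt (𝓡 n) x₀).symm y, coordVector x₀ i y⟩ : TangentBundle (𝓡 n) X))
      (extChartAt (𝓡 n) x₀).target := by
  have h1 := (contMDiffOn_extChartAt_symm (I := 𝓡 n) (n := ∞) x₀).contMDiffOn_tangentMapWithin
    (m := ∞) (by simp) (isOpen_extChartAt_target x₀).uniqueMDiffOn
  have h2 : ContMDiff 𝓘(ℝ, EuclideanSpace ℝ (Fin n)) 𝓘(ℝ, EuclideanSpace ℝ (Fin n)).tangent ∞
      (fun y => (⟨y, EuclideanSpace.single i (1 : ℝ)⟩ :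
        TangentBundle 𝓘(ℝ, EuclideanSpace ℝ (Fin n)) (EuclideanSpace ℝ (Fin n)))) :=
    contMDiff_vectorSpace_iff_contDiff.2 contDiff_const
  have h3 := h1.comp (h2.contMDiffOn (s := (extChartAt (𝓡 n) x₀).target)) fun y hy => hy
  refine h3.congr fun y hy => ?_
  simp only [Function.comp_apply, tangentMapWithin, coordVector]
  rw [mfderivWithin_of_isOpen (isOpen_extChartAt_target x₀) hy]

theorem contDiffOn_metricCoeff (g : SmoothMetric n X) (x₀ : X) (i j : Fin n) :
    ContDiffOn ℝ ∞ (fun y => metricCoeff g x₀ y i j) (extChartAt (𝓡 n) x₀).target := by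
  rw [← contMDiffOn_iff_contDiffOn]
  have hb := contMDiffOn_extChartAt_symm (I := 𝓡 n) (n := ∞) x₀
  have h := ContMDiffOn.clm_bundle_apply₂ (F₁ := EuclideanSpace ℝ (Fin n))
    (F₂ := EuclideanSpace ℝ (Fin n)) (E₃ := Bundle.Trivial X ℝ) (F₃ := ℝ)
    (ψ := fun y => g.inner ((extChartAt (𝓡 n) x₀).symm y))
    (g.contMDiff.comp_contMDiffOn hb)
    (contMDiffOn_coordVector x₀ i) (contMDiffOn_coordVector x₀ j)
  intro y hy
  have := h y hy
  simp only [Bundle.contMDiffWithinAt_totalSpace] at this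
  exact this.2

theorem isCoordMetric_metricCoeff (g : SmoothMetric n X) (x₀ : X) :
    IsCoordMetric (metricCoeff g x₀) (extChartAt (𝓡 n) x₀).target where
  isOpen := isOpen_extChartAt_target x₀
  smooth := contDiffOn_metricCoeff g x₀
  posDef _ hy := metricCoeff_posDef g hy

theorem IsCoordMetric.mono {γ : EuclideanSpace ℝ (Fin n) → Matrix (Fin n) (Fin n) ℝ}
    {V W : Set (EuclideanSpace ℝ (Fin n))} (h : IsCoordMetric γ V) (hW : IsOpen W) (hWV : W ⊆ V) :
    IsCoordMetric γ W where
  isOpen := hW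
  smooth i j := (h.smooth i j).mono hWV
  posDef y hy := h.posDef y (hWV hy)

theorem isPullbackOn_metricCoeff (g : SmoothMetric n X) (x₁ x₀ : X) :
    IsPullbackOn (metricCoeff g x₁) (metricCoeff g x₀) (transition x₁ x₀) (overlap x₁ x₀)
      (extChartAt (𝓡 n) x₀).target where
  source := (isCoordMetric_metricCoeff g x₁).mono (isOpen_overlap x₁ x₀) inter_subset_left
  target := isCoordMetric_metricCoeff g x₀
  mapsTo := mapsTo_transition x₁ x₀
  smooth := contDiffOn_transition x₁ x₀
  eq _ hy := metricCoeff_transition g hy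

/-! ### Scalar curvature and gradients on the manifold -/

theorem mem_overlap {x₀ x : X} (hx : x ∈ (extChartAt (𝓡 n) x₀).source) :
    extChartAt (𝓡 n) x x ∈ overlap x x₀ := by
  refine ⟨mem_extChartAt_target x, ?_⟩
  simpa using hx

theorem transition_self {x₀ x : X} :
    transition x x₀ (extChartAt (𝓡 n) x x) = extChartAt (𝓡 n) x₀ x := by
  simp [transition]

/-- The scalar curvature can be computed in any chart. -/
theorem scalarCurvature_eq (g : SmoothMetric n X) {x₀ x : X}
    (hx : x ∈ (extChartAt (𝓡 n) x₀).source) :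
    scalarCurvature g x = scalarCoord (metricCoeff g x₀) (extChartAt (𝓡 n) x₀ x) := by
  rw [scalarCurvature, (isPullbackOn_metricCoeff g x x₀).scalarCoord_eq (mem_overlap hx),
    transition_self]

/-- Quantities computed at each x in the preferred chart at x are not obviously continuous, as that
chart may jump with x. They are continuous once one fixed chart computes them at all nearby points.
-/
theorem continuous_of_eq_in_charts {F : X → ℝ} (c : X → EuclideanSpace ℝ (Fin n) → ℝ)
    (hc : ∀ x₀, ContinuousOn (c x₀) (extChartAt (𝓡 n) x₀).target)
    (h : ∀ x₀, ∀ x ∈ (extChartAt (𝓡 n) x₀).source, F x = c x₀ (extChartAt (𝓡 n) x₀ x)) :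
    Continuous F := by
  refine continuous_iff_continuousAt.2 fun x₀ => ?_
  have h1 : ContinuousAt (fun x => c x₀ (extChartAt (𝓡 n) x₀ x)) x₀ :=
    ContinuousAt.comp (f := extChartAt (𝓡 n) x₀) ((hc x₀).continuousAt
      ((isOpen_extChartAt_target x₀).mem_nhds (mem_extChartAt_target x₀)))
      (continuousAt_extChartAt x₀)
  exact h1.congr (Filter.eventually_of_mem (extChartAt_source_mem_nhds (I := 𝓡 n) x₀)
    fun x hx => (h x₀ x hx).symm)

theorem continuous_scalarCurvature (g : SmoothMetric n X) : Continuous (scalarCurvature g) :=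
  continuous_of_eq_in_charts (fun x₀ => scalarCoord (metricCoeff g x₀))
    (fun x₀ => (isCoordMetric_metricCoeff g x₀).contDiffOn_scalarCoord.continuousOn)
    fun _ _ hx => scalarCurvature_eq g hx

/-- A function on the manifold read in the chart at `x₀`. -/
noncomputable def inChart (a : X → ℝ) (x₀ : X) (y : EuclideanSpace ℝ (Fin n)) : ℝ :=
  a ((extChartAt (𝓡 n) x₀).symm y)

theorem contDiffOn_inChart {a : X → ℝ} (ha : ContMDiff (𝓡 n) 𝓘(ℝ) ∞ a) (x₀ : X) :
    ContDiffOn ℝ ∞ (inChart a x₀) (extChartAt (𝓡 n) x₀).target := by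
  rw [← contMDiffOn_iff_contDiffOn]
  exact ha.comp_contMDiffOn (contMDiffOn_extChartAt_symm x₀)

theorem inChart_extChartAt {a : X → ℝ} {x₀ x : X} (hx : x ∈ (extChartAt (𝓡 n) x₀).source) :
    inChart a x₀ (extChartAt (𝓡 n) x₀ x) = a x := by
  rw [inChart, (extChartAt (𝓡 n) x₀).left_inv hx]

/-- The inner product of the differentials of two functions with respect to `g`. -/
noncomputable def gradInner (g : SmoothMetric n X) (a b : X → ℝ) (x : X) : ℝ :=
  gradCoord (metricCoeff g x) (inChart a x) (inChart b x) (extChartAt (𝓡 n) x x)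

theorem gradCoord_congr {γ : EuclideanSpace ℝ (Fin n) → Matrix (Fin n) (Fin n) ℝ}
    {p p' q q' : EuclideanSpace ℝ (Fin n) → ℝ} {y : EuclideanSpace ℝ (Fin n)}
    (hp : p =ᶠ[nhds y] p') (hq : q =ᶠ[nhds y] q') :
    gradCoord γ p q y = gradCoord γ p' q' y := by
  simp only [gradCoord, partialDeriv_congr hp, partialDeriv_congr hq]

theorem gradInner_eq (g : SmoothMetric n X) {a b : X → ℝ} (ha : ContMDiff (𝓡 n) 𝓘(ℝ) ∞ a)
    (hb : ContMDiff (𝓡 n) 𝓘(ℝ) ∞ b) {x₀ x : X} (hx : x ∈ (extChartAt (𝓡 n) x₀).source) :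
    gradInner g a b x
      = gradCoord (metricCoeff g x₀) (inChart a x₀) (inChart b x₀) (extChartAt (𝓡 n) x₀ x) := by
  have hc : ∀ c : X → ℝ, inChart c x =ᶠ[nhds (extChartAt (𝓡 n) x x)]
      fun z => inChart c x₀ (transition x x₀ z) := fun c =>
    Filter.eventually_of_mem ((isOpen_overlap x x₀).mem_nhds (mem_overlap hx)) fun z hz => by
      simp only [inChart, symm_transition hz]
  have hd : ∀ {c : X → ℝ}, ContMDiff (𝓡 n) 𝓘(ℝ) ∞ c → DifferentiableAt ℝ (inChart c x₀)
      (transition x x₀ (extChartAt (𝓡 n) x x)) := fun hc =>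
    differentiableAt_of_contDiffOn (isOpen_extChartAt_target x₀) (contDiffOn_inChart hc x₀)
      (mapsTo_transition x x₀ (mem_overlap hx))
  rw [gradInner, gradCoord_congr (hc a) (hc b),
    (isPullbackOn_metricCoeff g x x₀).gradCoord_eq (mem_overlap hx) (hd ha) (hd hb),
    transition_self]

theorem gradInner_eq_zero_of_notMem_tsupport (g : SmoothMetric n X) {a : X → ℝ} (b : X → ℝ) {x : X}
    (hx : x ∉ tsupport a) : gradInner g a b x = 0 := by
  have hz : inChart a x =ᶠ[nhds (extChartAt (𝓡 n) x x)] fun _ => 0 := by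
    have hm : (tsupport a)ᶜ ∈ nhds ((extChartAt (𝓡 n) x).symm (extChartAt (𝓡 n) x x)) := by
      rw [(extChartAt (𝓡 n) x).left_inv (mem_extChartAt_source x)]
      exact (isClosed_tsupport a).isOpen_compl.mem_nhds hx
    filter_upwards [continuousAt_extChartAt_symm (I := 𝓡 n) x hm] with z hz
    exact image_eq_zero_of_notMem_tsupport (f := a) hz
  rw [gradInner, gradCoord_congr hz (Filter.EventuallyEq.refl _ _)]
  simp only [gradCoord, partialDeriv_const, zero_mul, mul_zero, Finset.sum_const_zero]

theorem continuous_gradInner (g : SmoothMetric n X) {a b : X → ℝ}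
    (ha : ContMDiff (𝓡 n) 𝓘(ℝ) ∞ a) (hb : ContMDiff (𝓡 n) 𝓘(ℝ) ∞ b) :
    Continuous (gradInner g a b) :=
  continuous_of_eq_in_charts
    (fun x₀ => gradCoord (metricCoeff g x₀) (inChart a x₀) (inChart b x₀))
    (fun x₀ => ((isCoordMetric_metricCoeff g x₀).contDiffOn_gradCoord (contDiffOn_inChart ha x₀)
      (contDiffOn_inChart hb x₀)).continuousOn)
    fun _ _ hx => gradInner_eq g ha hb hx

end Charts

/-! ### The Riemannian volume measure -/

section Volume

variable {n : ℕ} {X : Type*} [TopologicalSpace X]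
  [ChartedSpace (EuclideanSpace ℝ (Fin n)) X] [IsManifold (𝓡 n) ∞ X]
  [MeasurableSpace X] [BorelSpace X]

/-- The volume density of `g` in the chart at `x₀`. -/
noncomputable def density (g : SmoothMetric n X) (x₀ : X) (y : EuclideanSpace ℝ (Fin n)) : ℝ :=
  Real.sqrt (metricCoeff g x₀ y).det

theorem density_nonneg (g : SmoothMetric n X) (x₀ : X) (y : EuclideanSpace ℝ (Fin n)) :
    0 ≤ density g x₀ y := Real.sqrt_nonneg _

theorem density_pos (g : SmoothMetric n X) {x₀ : X} {y : EuclideanSpace ℝ (Fin n)}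
    (hy : y ∈ (extChartAt (𝓡 n) x₀).target) : 0 < density g x₀ y :=
  Real.sqrt_pos.2 (metricCoeff_posDef g hy).det_pos

theorem contDiffOn_density (g : SmoothMetric n X) (x₀ : X) :
    ContDiffOn ℝ ∞ (density g x₀) (extChartAt (𝓡 n) x₀).target :=
  (isCoordMetric_metricCoeff g x₀).contDiffOn_sqrt_det

theorem measurableSet_target (x₀ : X) : MeasurableSet (extChartAt (𝓡 n) x₀).target :=
  (isOpen_extChartAt_target x₀).measurableSet

theorem measurableSet_source (x₀ : X) : MeasurableSet (extChartAt (𝓡 n) x₀).source :=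
  (isOpen_extChartAt_source x₀).measurableSet

theorem aemeasurable_symm (x₀ : X) :
    AEMeasurable (extChartAt (𝓡 n) x₀).symm (volume.restrict (extChartAt (𝓡 n) x₀).target) :=
  (continuousOn_extChartAt_symm x₀).aemeasurable (measurableSet_target x₀)

theorem aemeasurable_density (g : SmoothMetric n X) (x₀ : X) :
    AEMeasurable (fun y => ENNReal.ofReal (density g x₀ y))
      (volume.restrict (extChartAt (𝓡 n) x₀).target) :=
  ((contDiffOn_density g x₀).continuousOn.aemeasurable (measurableSet_target x₀)).ennreal_ofReal

/-- The part of the chart target that corresponds to the set `A`. -/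
def chartPreimage (x₀ : X) (A : Set X) : Set (EuclideanSpace ℝ (Fin n)) :=
  (extChartAt (𝓡 n) x₀).target ∩ (extChartAt (𝓡 n) x₀).symm ⁻¹' A

/-- The inverse chart is controlled only on the target, so measurability is proved on that subtype
and then pushed forward. -/
theorem measurableSet_chartPreimage (x₀ : X) {A : Set X} (hA : MeasurableSet A) :
    MeasurableSet (chartPreimage (n := n) x₀ A) := by
  have h : Measurable ((extChartAt (𝓡 n) x₀).target.domRestrict (extChartAt (𝓡 n) x₀).symm) :=
    (continuousOn_iff_continuous_domRestrict.1 (continuousOn_extChartAt_symm x₀)).measurable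
  have h1 := (measurableSet_target x₀).subtype_image (h hA)
  convert! h1 using 1
  ext y
  simp only [chartPreimage, mem_inter_iff, mem_preimage, mem_image, Subtype.exists,
    domRestrict_apply]
  constructor
  · rintro ⟨h1, h2⟩
    exact ⟨y, h1, h2, rfl⟩
  · rintro ⟨z, h1, h2, rfl⟩
    exact ⟨h1, h2⟩

theorem chartVolume_apply (g : SmoothMetric n X) (x₀ : X) {A : Set X} (hA : MeasurableSet A) :
    chartVolume g x₀ A = ∫⁻ y in chartPreimage x₀ A, ENNReal.ofReal (density g x₀ y) := by
  have h1 : AEMeasurable (extChartAt (𝓡 n) x₀).symm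
      ((volume.restrict (extChartAt (𝓡 n) x₀).target).withDensity
        (fun y => ENNReal.ofReal (density g x₀ y))) :=
    (aemeasurable_symm x₀).mono_ac (withDensity_absolutelyContinuous _ _)
  have h2 : NullMeasurableSet ((extChartAt (𝓡 n) x₀).symm ⁻¹' A)
      (volume.restrict (extChartAt (𝓡 n) x₀).target) :=
    (aemeasurable_symm x₀).nullMeasurableSet_preimage hA
  refine (Measure.map_apply_of_aemeasurable h1 hA).trans ?_
  rw [withDensity_apply₀ _ h2, Measure.restrict_restrict₀ h2, inter_comm]
  rfl

theorem chartVolume_compl_source (g : SmoothMetric n X) (x₀ : X) :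
    chartVolume g x₀ (extChartAt (𝓡 n) x₀).sourceᶜ = 0 := by
  rw [chartVolume_apply g x₀ (measurableSet_source x₀).compl]
  have : chartPreimage (n := n) x₀ (extChartAt (𝓡 n) x₀).sourceᶜ = ∅ := by
    ext y
    simp only [chartPreimage, mem_inter_iff, mem_preimage, mem_compl_iff, mem_empty_iff_false,
      iff_false, not_and, not_not]
    exact (extChartAt (𝓡 n) x₀).map_target
  rw [this, Measure.restrict_empty, lintegral_zero_measure]

theorem density_transition (g : SmoothMetric n X) {x₁ x₀ : X} {y : EuclideanSpace ℝ (Fin n)}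
    (hy : y ∈ overlap x₁ x₀) :
    density g x₁ y
      = |(fderiv ℝ (transition x₁ x₀) y).det| * density g x₀ (transition x₁ x₀ y) := by
  have hdet : (fderiv ℝ (transition x₁ x₀) y).det = (jacobian (transition x₁ x₀) y).det := by
    rw [ContinuousLinearMap.det, ← LinearMap.det_toMatrix (EuclideanSpace.basisFun (Fin n) ℝ).toBasis]
    congr 1
  rw [density, metricCoeff_transition g hy, Matrix.det_mul, Matrix.det_mul, Matrix.det_transpose,
    hdet, density, ← Real.sqrt_sq_eq_abs, ← Real.sqrt_mul (sq_nonneg _)]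
  congr 1
  ring

/-- The change of variables formula for the transition map: its Jacobian is exactly the factor
relating the two densities. -/
theorem chartVolume_eq_of_subset (g : SmoothMetric n X) (x₁ x₀ : X) {A : Set X}
    (hA : MeasurableSet A) (h₁ : A ⊆ (extChartAt (𝓡 n) x₁).source)
    (h₀ : A ⊆ (extChartAt (𝓡 n) x₀).source) : chartVolume g x₁ A = chartVolume g x₀ A := by
  rw [chartVolume_apply g x₁ hA, chartVolume_apply g x₀ hA]
  have hsub : chartPreimage x₁ A ⊆ overlap (n := n) x₁ x₀ := fun y hy => ⟨hy.1, h₀ hy.2⟩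
  have himg : transition (n := n) x₁ x₀ '' chartPreimage x₁ A = chartPreimage x₀ A := by
    ext z
    constructor
    · rintro ⟨y, hy, rfl⟩
      refine ⟨mapsTo_transition x₁ x₀ (hsub hy), ?_⟩
      rw [mem_preimage, symm_transition (hsub hy)]
      exact hy.2
    · intro hz
      refine ⟨extChartAt (𝓡 n) x₁ ((extChartAt (𝓡 n) x₀).symm z),
        ⟨(extChartAt (𝓡 n) x₁).map_source (h₁ hz.2), ?_⟩, ?_⟩
      · rw [mem_preimage, (extChartAt (𝓡 n) x₁).left_inv (h₁ hz.2)]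
        exact hz.2
      · rw [transition, (extChartAt (𝓡 n) x₁).left_inv (h₁ hz.2),
          (extChartAt (𝓡 n) x₀).right_inv hz.1]
  have hinj : InjOn (transition (n := n) x₁ x₀) (chartPreimage x₁ A) := by
    intro y hy z hz hyz
    have h := congrArg (extChartAt (𝓡 n) x₀).symm hyz
    rw [symm_transition (hsub hy), symm_transition (hsub hz)] at h
    exact (extChartAt (𝓡 n) x₁).symm.injOn hy.1 hz.1 h
  have hder : ∀ y ∈ chartPreimage x₁ A, HasFDerivWithinAt (transition (n := n) x₁ x₀)
      (fderiv ℝ (transition x₁ x₀) y) (chartPreimage x₁ A) y := fun y hy =>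
    (differentiableAt_of_contDiffOn (isOpen_overlap x₁ x₀) (contDiffOn_transition x₁ x₀)
      (hsub hy)).hasFDerivAt.hasFDerivWithinAt
  rw [← himg, lintegral_image_eq_lintegral_abs_det_fderiv_mul volume
    (measurableSet_chartPreimage x₁ hA) hder hinj]
  refine setLIntegral_congr_fun (measurableSet_chartPreimage x₁ hA) fun y hy => ?_
  rw [density_transition g (hsub hy), ENNReal.ofReal_mul (abs_nonneg _)]

theorem chartVolume_le (g : SmoothMetric n X) (x₀ : X) : chartVolume g x₀ ≤ riemannianVolume g :=
  le_iSup (fun x₀ => chartVolume g x₀) x₀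

/-- To bound the Riemannian volume of subsets of `S` by a measure it suffices to do so in charts. -/
theorem riemannianVolume_le_of_chart (g : SmoothMetric n X) {S : Set X} (hS : MeasurableSet S)
    (ν : Measure X) (h : ∀ x₀, ∀ A, MeasurableSet A → A ⊆ S → chartVolume g x₀ A ≤ ν A)
    {A : Set X} (hA : MeasurableSet A) (hAS : A ⊆ S) : riemannianVolume g A ≤ ν A := by
  -- The right side dominates every chart measure: by hypothesis inside S, trivially outside. Hence
  -- it dominates their supremum.
  have key : riemannianVolume g ≤ ν.restrict S + (riemannianVolume g).restrict Sᶜ := by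
    refine iSup_le fun x₀ => Measure.le_iff.2 fun B hB => ?_
    rw [Measure.add_apply, Measure.restrict_apply hB, Measure.restrict_apply hB,
      ← measure_inter_add_sdiff B hS]
    exact add_le_add (h x₀ _ (hB.inter hS) inter_subset_right)
      (chartVolume_le g x₀ (B \ S))
  refine (key A).trans ?_
  rw [Measure.add_apply, Measure.restrict_apply hA, Measure.restrict_apply hA]
  have : A ∩ Sᶜ = ∅ := by rw [← sdiff_eq, sdiff_eq_empty]; exact hAS
  rw [this, measure_empty, add_zero]
  exact measure_mono inter_subset_left

/-- On the domain of a chart the Riemannian volume is given by the density in that chart. -/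
theorem riemannianVolume_restrict_source (g : SmoothMetric n X) (x₀ : X) :
    (riemannianVolume g).restrict (extChartAt (𝓡 n) x₀).source = chartVolume g x₀ := by
  ext A hA
  rw [Measure.restrict_apply hA]
  have hAs := hA.inter (measurableSet_source (n := n) x₀)
  have h1 : chartVolume g x₀ A = chartVolume g x₀ (A ∩ (extChartAt (𝓡 n) x₀).source) := by
    rw [← measure_inter_add_sdiff A (measurableSet_source (n := n) x₀)]
    have : chartVolume g x₀ (A \ (extChartAt (𝓡 n) x₀).source) = 0 :=
      measure_mono_null (fun x hx => hx.2) (chartVolume_compl_source g x₀)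
    rw [this, add_zero]
  rw [h1]
  refine le_antisymm ?_ (chartVolume_le g x₀ _)
  -- Every other chart measure is carried by its own domain, and on the overlap it agrees with the
  -- measure of the chart at x₀.
  refine riemannianVolume_le_of_chart g (measurableSet_source x₀) _ (fun x₁ B hB hBS => ?_) hAs
    inter_subset_right
  have h2 : chartVolume g x₁ B = chartVolume g x₁ (B ∩ (extChartAt (𝓡 n) x₁).source) := by
    rw [← measure_inter_add_sdiff B (measurableSet_source (n := n) x₁)]
    have : chartVolume g x₁ (B \ (extChartAt (𝓡 n) x₁).source) = 0 :=
      measure_mono_null (fun x hx => hx.2) (chartVolume_compl_source g x₁)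
    rw [this, add_zero]
  rw [h2, chartVolume_eq_of_subset g x₁ x₀ (hB.inter (measurableSet_source x₁))
    inter_subset_right (inter_subset_left.trans hBS)]
  exact measure_mono inter_subset_left

theorem riemannianVolume_of_subset (g : SmoothMetric n X) {x₀ : X} {A : Set X}
    (hA : MeasurableSet A) (h : A ⊆ (extChartAt (𝓡 n) x₀).source) :
    riemannianVolume g A = ∫⁻ y in chartPreimage x₀ A, ENNReal.ofReal (density g x₀ y) := by
  rw [← chartVolume_apply g x₀ hA, ← riemannianVolume_restrict_source, Measure.restrict_apply hA,
    inter_eq_left.2 h]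

/-- The density is continuous, hence integrable, on a closed ball inside the chart target. -/
instance isLocallyFiniteMeasure_riemannianVolume (g : SmoothMetric n X) :
    IsLocallyFiniteMeasure (riemannianVolume g) where
  finiteAtNhds x := by
    obtain ⟨r, hr, hball⟩ := Metric.nhds_basis_closedBall.mem_iff.1
      ((isOpen_extChartAt_target (I := 𝓡 n) x).mem_nhds (mem_extChartAt_target x))
    set N := (extChartAt (𝓡 n) x).source ∩
      extChartAt (𝓡 n) x ⁻¹' Metric.ball (extChartAt (𝓡 n) x x) r with hN
    have hNo : IsOpen N := (continuousOn_extChartAt x).isOpen_inter_preimage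
      (isOpen_extChartAt_source x) Metric.isOpen_ball
    refine ⟨N, hNo.mem_nhds ⟨mem_extChartAt_source x, by simpa using hr⟩, ?_⟩
    rw [riemannianVolume_of_subset g hNo.measurableSet inter_subset_left]
    have hsub : chartPreimage x N ⊆ Metric.closedBall (extChartAt (𝓡 n) x x) r := by
      rintro y ⟨hy, -, hy2⟩
      rw [mem_preimage, (extChartAt (𝓡 n) x).right_inv hy] at hy2
      exact Metric.ball_subset_closedBall hy2
    have hdens : IntegrableOn (density g x) (Metric.closedBall (extChartAt (𝓡 n) x x) r) :=
      ((contDiffOn_density g x).continuousOn.mono hball).integrableOn_compact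
        (isCompact_closedBall _ _)
    exact lt_of_le_of_lt (lintegral_mono_set hsub)
      (lt_of_le_of_lt (lintegral_mono fun y => Real.ofReal_le_enorm _) hdens.2)

/-- In a chart the density is positive and Lebesgue measure charges nonempty open sets. -/
theorem riemannianVolume_pos (g : SmoothMetric n X) {A : Set X} (hA : IsOpen A)
    (hne : A.Nonempty) : 0 < riemannianVolume g A := by
  obtain ⟨x, hx⟩ := hne
  have hB : IsOpen (A ∩ (extChartAt (𝓡 n) x).source) := hA.inter (isOpen_extChartAt_source x)
  refine lt_of_lt_of_le ?_ (measure_mono (inter_subset_left (t := (extChartAt (𝓡 n) x).source)))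
  rw [riemannianVolume_of_subset g hB.measurableSet inter_subset_right, pos_iff_ne_zero]
  set P := chartPreimage (n := n) x (A ∩ (extChartAt (𝓡 n) x).source) with hP
  have hPo : IsOpen P := (continuousOn_extChartAt_symm x).isOpen_inter_preimage
    (isOpen_extChartAt_target x) hB
  have hPx : extChartAt (𝓡 n) x x ∈ P := by
    refine ⟨mem_extChartAt_target x, ?_⟩
    rw [mem_preimage, (extChartAt (𝓡 n) x).left_inv (mem_extChartAt_source x)]
    exact ⟨hx, mem_extChartAt_source x⟩
  intro h0
  have hPm : AEMeasurable (fun y => ENNReal.ofReal (density g x y)) (volume.restrict P) :=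
    (aemeasurable_density g x).mono_measure (Measure.restrict_mono inter_subset_left le_rfl)
  rw [lintegral_eq_zero_iff' hPm, Filter.EventuallyEq,
    ae_restrict_iff' hPo.measurableSet] at h0
  have h1 : ∀ᵐ y : EuclideanSpace ℝ (Fin n), y ∉ P := by
    filter_upwards [h0] with y hy hyP
    have := hy hyP
    simp only [Pi.zero_apply, ENNReal.ofReal_eq_zero] at this
    exact absurd (density_pos g hyP.1) (not_lt.2 this)
  have h2 : volume P = 0 := by
    rw [ae_iff] at h1
    simpa using h1
  exact (hPo.measure_pos volume ⟨_, hPx⟩).ne' h2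

/-- Integration in a chart. -/
theorem integral_riemannianVolume_eq (g : SmoothMetric n X) (x₀ : X) {F : X → ℝ}
    (hF : Continuous F) (hsupp : ∀ x ∉ (extChartAt (𝓡 n) x₀).source, F x = 0) :
    ∫ x, F x ∂(riemannianVolume g)
      = ∫ y in (extChartAt (𝓡 n) x₀).target, inChart F x₀ y * density g x₀ y := by
  have h1 : AEMeasurable (extChartAt (𝓡 n) x₀).symm
      ((volume.restrict (extChartAt (𝓡 n) x₀).target).withDensity
        (fun y => ENNReal.ofReal (density g x₀ y))) :=
    (aemeasurable_symm x₀).mono_ac (withDensity_absolutelyContinuous _ _)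
  rw [← setIntegral_eq_integral_of_forall_compl_eq_zero hsupp, riemannianVolume_restrict_source]
  change ∫ x, F x ∂(Measure.map _ ((volume.restrict (extChartAt (𝓡 n) x₀).target).withDensity
        (fun y => ENNReal.ofReal (density g x₀ y)))) = _
  rw [integral_map h1 hF.aestronglyMeasurable,
    integral_withDensity_eq_integral_toReal_smul₀ (aemeasurable_density g x₀)
      (Filter.Eventually.of_forall fun _ => ENNReal.ofReal_lt_top)]
  refine integral_congr_ae (Filter.Eventually.of_forall fun y => ?_)
  simp only [ENNReal.toReal_ofReal (density_nonneg g x₀ y), smul_eq_mul, inChart]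
  ring

theorem integrable_of_continuous [T2Space X] [CompactSpace X] (g : SmoothMetric n X) {F : X → ℝ}
    (hF : Continuous F) : Integrable F (riemannianVolume g) := by
  rw [← integrableOn_univ]
  exact hF.continuousOn.integrableOn_compact isCompact_univ

end Volume

/-! ### Integration by parts in coordinates -/

section IntegrationByParts

variable {n : ℕ} {V K : Set (EuclideanSpace ℝ (Fin n))} {a b : EuclideanSpace ℝ (Fin n) → ℝ}

theorem integrableOn_of_vanishing {F : EuclideanSpace ℝ (Fin n) → ℝ} (hV : IsOpen V)
    (hK : IsCompact K) (hKV : K ⊆ V) (hF : ContinuousOn F V) (h0 : ∀ y ∈ V, y ∉ K → F y = 0) :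
    IntegrableOn F V :=
  ((hF.mono hKV).integrableOn_compact hK).of_forall_sdiff_eq_zero hV.measurableSet
    fun y hy => h0 y hy.1 hy.2

theorem partialDeriv_eq_zero_of_vanishing (hV : IsOpen V) (hK : IsCompact K)
    (h0 : ∀ y ∈ V, y ∉ K → a y = 0) (k : Fin n) {y : EuclideanSpace ℝ (Fin n)} (hy : y ∈ V)
    (hyK : y ∉ K) : partialDeriv k a y = 0 := by
  rw [partialDeriv_congr (g := fun _ => 0), partialDeriv_const]
  filter_upwards [hV.mem_nhds hy, hK.isClosed.isOpen_compl.mem_nhds hyK] with z hz hzK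
  exact h0 z hz hzK

/-- Integration by parts on an open set, for a factor vanishing outside a compact subset. -/
theorem setIntegral_mul_partialDeriv (hV : IsOpen V) (hK : IsCompact K) (hKV : K ⊆ V)
    (ha : ContDiffOn ℝ ∞ a V) (hb : ContDiffOn ℝ ∞ b V) (h0 : ∀ y ∈ V, y ∉ K → a y = 0)
    (k : Fin n) :
    ∫ y in V, a y * partialDeriv k b y = -∫ y in V, partialDeriv k a y * b y := by
  -- Extended by zero outside V, the factor `a` becomes differentiable on the whole space, because
  -- it already vanishes on V off the compact set K.
  have hoff : ∀ y, y ∉ K → V.indicator a =ᶠ[nhds y] fun _ => 0 := by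
    intro y hy
    filter_upwards [hK.isClosed.isOpen_compl.mem_nhds hy] with z hz
    by_cases hzV : z ∈ V
    · rw [indicator_of_mem hzV, h0 z hzV hz]
    · rw [indicator_of_notMem hzV]
  have hon : ∀ y ∈ V, V.indicator a =ᶠ[nhds y] a := fun y hy =>
    Filter.eventually_of_mem (hV.mem_nhds hy) fun z hz => indicator_of_mem hz a
  have hdiff : ∀ y, DifferentiableAt ℝ (V.indicator a) y := by
    intro y
    by_cases hy : y ∈ V
    · exact (hon y hy).differentiableAt_iff.2 (differentiableAt_of_contDiffOn hV ha hy)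
    · exact (hoff y fun h => hy (hKV h)).differentiableAt_iff.2 (differentiableAt_const _)
  have hts : tsupport (V.indicator a) ⊆ K := by
    refine closure_minimal (fun y hy => ?_) hK.isClosed
    by_contra hyK
    exact hy ((hoff y hyK).eq_of_nhds)
  have hd : ∀ y, fderiv ℝ (V.indicator a) y (EuclideanSpace.single k 1)
      = V.indicator (partialDeriv k a) y := by
    intro y
    by_cases hy : y ∈ V
    · rw [indicator_of_mem hy, (hon y hy).fderiv_eq]; rfl
    · rw [indicator_of_notMem hy, (hoff y fun h => hy (hKV h)).fderiv_eq]; simp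
  have e1 : (fun y => V.indicator a y * fderiv ℝ b y (EuclideanSpace.single k 1))
      = V.indicator fun y => a y * partialDeriv k b y := by
    funext y
    by_cases hy : y ∈ V <;> simp [hy, partialDeriv]
  have e2 : (fun y => fderiv ℝ (V.indicator a) y (EuclideanSpace.single k 1) * b y)
      = V.indicator fun y => partialDeriv k a y * b y := by
    funext y
    rw [hd]
    by_cases hy : y ∈ V <;> simp [hy]
  have e3 : (fun y => V.indicator a y * b y) = V.indicator fun y => a y * b y := by
    funext y
    by_cases hy : y ∈ V <;> simp [hy]
  have hpa := (contDiffOn_partialDeriv hV ha k).continuousOn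
  have hpb := (contDiffOn_partialDeriv hV hb k).continuousOn
  -- No extension of `b` is needed: its differentiability is required only on the support of the
  -- extended `a`.
  have h := integral_mul_fderiv_eq_neg_fderiv_mul_of_integrable
    (μ := (volume : Measure (EuclideanSpace ℝ (Fin n))))
    (f := V.indicator a) (g := b) (v := EuclideanSpace.single k 1)
    (by
      rw [e2, integrable_indicator_iff hV.measurableSet]
      exact integrableOn_of_vanishing hV hK hKV (hpa.mul hb.continuousOn) fun y hy hyK => by
        rw [partialDeriv_eq_zero_of_vanishing hV hK h0 k hy hyK, zero_mul])
    (by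
      rw [e1, integrable_indicator_iff hV.measurableSet]
      exact integrableOn_of_vanishing hV hK hKV (ha.continuousOn.mul hpb) fun y hy hyK => by
        rw [h0 y hy hyK, zero_mul])
    (by
      rw [e3, integrable_indicator_iff hV.measurableSet]
      exact integrableOn_of_vanishing hV hK hKV (ha.continuousOn.mul hb.continuousOn)
        fun y hy hyK => by rw [h0 y hy hyK, zero_mul])
    (fun y _ => hdiff y)
    (fun y hy => differentiableAt_of_contDiffOn hV hb (hKV (hts hy)))
  rwa [e1, e2, integral_indicator hV.measurableSet, integral_indicator hV.measurableSet] at h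

/-- Green's formula in coordinates. -/
theorem setIntegral_mul_laplaceCoord {γ : EuclideanSpace ℝ (Fin n) → Matrix (Fin n) (Fin n) ℝ}
    (hγ : IsCoordMetric γ V) (hK : IsCompact K) (hKV : K ⊆ V) (ha : ContDiffOn ℝ ∞ a V)
    (hb : ContDiffOn ℝ ∞ b V) (h0 : ∀ y ∈ V, y ∉ K → a y = 0) :
    ∫ y in V, a y * (Real.sqrt (γ y).det * laplaceCoord γ b y)
      = -∫ y in V, Real.sqrt (γ y).det * gradCoord γ a b y := by
  have hV := hγ.isOpen
  have hs : ∀ k, ContDiffOn ℝ ∞ (fun z => Real.sqrt (γ z).det * gradUp γ b k z) V := fun k =>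
    hγ.contDiffOn_sqrt_det.mul (hγ.contDiffOn_gradUp hb k)
  have h1 : ∀ y ∈ V, a y * (Real.sqrt (γ y).det * laplaceCoord γ b y)
      = ∑ k, a y * partialDeriv k (fun z => Real.sqrt (γ z).det * gradUp γ b k z) y := by
    intro y hy
    rw [hγ.sqrt_det_mul_laplaceCoord hb hy, Finset.mul_sum]
  have h2 : ∀ y ∈ V, Real.sqrt (γ y).det * gradCoord γ a b y
      = ∑ k, partialDeriv k a y * (Real.sqrt (γ y).det * gradUp γ b k y) := by
    intro y hy
    rw [gradCoord_eq_sum_gradUp, Finset.mul_sum]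
    exact Finset.sum_congr rfl fun k _ => by ring
  rw [setIntegral_congr_fun hV.measurableSet h1, setIntegral_congr_fun hV.measurableSet h2,
    integral_finsetSum, integral_finsetSum, ← Finset.sum_neg_distrib]
  · exact Finset.sum_congr rfl fun k _ =>
      setIntegral_mul_partialDeriv hV hK hKV ha (hs k) h0 k
  · intro k _
    exact integrableOn_of_vanishing hV hK hKV
      ((contDiffOn_partialDeriv hV ha k).continuousOn.mul (hs k).continuousOn) fun y hy hyK => by
        rw [partialDeriv_eq_zero_of_vanishing hV hK h0 k hy hyK, zero_mul]
  · intro k _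
    exact integrableOn_of_vanishing hV hK hKV
      (ha.continuousOn.mul (contDiffOn_partialDeriv hV (hs k) k).continuousOn) fun y hy hyK => by
        rw [h0 y hy hyK, zero_mul]

end IntegrationByParts

/-! ### The total scalar curvature of a conformal metric -/

section Energy

variable {n : ℕ} {X : Type*} [TopologicalSpace X]
  [ChartedSpace (EuclideanSpace ℝ (Fin n)) X] [IsManifold (𝓡 n) ∞ X]
  [MeasurableSpace X] [BorelSpace X]

/-- `h = e^{2f} g`. -/
def IsConformalExp (h g : SmoothMetric n X) (f : X → ℝ) : Prop :=
  ∀ (x : X) (v w : TangentSpace (𝓡 n) x), h.inner x v w = Real.exp (2 * f x) * g.inner x v w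

variable {g h : SmoothMetric n X} {f : X → ℝ}

theorem IsConformalExp.metricCoeff_eq (hh : IsConformalExp h g f) (x₀ : X) :
    metricCoeff h x₀ = fun y => Real.exp (2 * inChart f x₀ y) • metricCoeff g x₀ y := by
  funext y
  ext i j
  exact hh _ _ _

theorem IsConformalExp.density_eq (hh : IsConformalExp h g f) (x₀ : X)
    (y : EuclideanSpace ℝ (Fin n)) :
    density h x₀ y = Real.exp (n * inChart f x₀ y) * density g x₀ y := by
  have h1 : Real.exp (2 * inChart f x₀ y) ^ n = Real.exp (n * inChart f x₀ y) ^ 2 := by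
    rw [← Real.exp_nat_mul, ← Real.exp_nat_mul]
    congr 1
    push_cast
    ring
  rw [density, hh.metricCoeff_eq, Matrix.det_smul, Fintype.card_fin, h1,
    Real.sqrt_mul (sq_nonneg _), Real.sqrt_sq (Real.exp_pos _).le, density]

/-- The contribution of one chart to the total scalar curvature of a conformal metric. -/
theorem IsConformalExp.integral_mul_scalarCurvature [CompactSpace X] (hh : IsConformalExp h g f)
    (hf : ContMDiff (𝓡 n) 𝓘(ℝ) ∞ f) {ρ : X → ℝ} (hρ : ContMDiff (𝓡 n) 𝓘(ℝ) ∞ ρ) {x₀ : X}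
    (hsupp : tsupport ρ ⊆ (extChartAt (𝓡 n) x₀).source) :
    ∫ x, ρ x * scalarCurvature h x ∂(riemannianVolume h)
      = ∫ x, (ρ x * (Real.exp (((n : ℝ) - 2) * f x) * (scalarCurvature g x
          + ((n : ℝ) - 1) * ((n : ℝ) - 2) * gradInner g f f x))
        + 2 * ((n : ℝ) - 1) * (Real.exp (((n : ℝ) - 2) * f x) * gradInner g ρ f x))
        ∂(riemannianVolume g) := by
  set V := (extChartAt (𝓡 n) x₀).target with hVdef
  have hV : IsOpen V := isOpen_extChartAt_target x₀
  set K := extChartAt (𝓡 n) x₀ '' tsupport ρ with hKdef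
  have hK : IsCompact K := ((isClosed_tsupport ρ).isCompact).image_of_continuousOn
    ((continuousOn_extChartAt x₀).mono hsupp)
  have hKV : K ⊆ V := by
    rintro _ ⟨x, hx, rfl⟩
    exact (extChartAt (𝓡 n) x₀).map_source (hsupp hx)
  have hγ := isCoordMetric_metricCoeff g x₀
  have hρ0 : ∀ x ∉ (extChartAt (𝓡 n) x₀).source, ρ x = 0 := fun x hx =>
    image_eq_zero_of_notMem_tsupport fun h' => hx (hsupp h')
  have hρK : ∀ y ∈ V, y ∉ K → inChart ρ x₀ y = 0 := by
    intro y hy hyK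
    refine image_eq_zero_of_notMem_tsupport (f := ρ) fun h' => hyK ⟨_, h', ?_⟩
    exact (extChartAt (𝓡 n) x₀).right_inv hy
  have hgρ0 : ∀ x ∉ (extChartAt (𝓡 n) x₀).source, gradInner g ρ f x = 0 := fun x hx =>
    gradInner_eq_zero_of_notMem_tsupport g f fun h' => hx (hsupp h')
  have hρc := contDiffOn_inChart hρ x₀
  have hfc := contDiffOn_inChart hf x₀
  have hWc : ContDiffOn ℝ ∞ (fun y => Real.exp (((n : ℝ) - 2) * inChart f x₀ y)) V :=
    (contDiffOn_const.mul hfc).exp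
  have hac : ContDiffOn ℝ ∞
      (fun y => inChart ρ x₀ y * Real.exp (((n : ℝ) - 2) * inChart f x₀ y)) V := hρc.mul hWc
  have ha0 : ∀ y ∈ V, y ∉ K →
      inChart ρ x₀ y * Real.exp (((n : ℝ) - 2) * inChart f x₀ y) = 0 := fun y hy hyK => by
    rw [hρK y hy hyK, zero_mul]
  rw [integral_riemannianVolume_eq h x₀ (F := fun x => ρ x * scalarCurvature h x) (hρ.continuous.mul (continuous_scalarCurvature h))
      fun x hx => by rw [hρ0 x hx, zero_mul],
    integral_riemannianVolume_eq g x₀ ?_ fun x hx => by rw [hρ0 x hx, hgρ0 x hx]; ring]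
  swap
  · have hW : Continuous fun x => Real.exp (((n : ℝ) - 2) * f x) :=
      (continuous_const.mul hf.continuous).rexp
    exact (hρ.continuous.mul (hW.mul ((continuous_scalarCurvature g).add
      (continuous_const.mul (continuous_gradInner g hf hf))))).add
      (continuous_const.mul (hW.mul (continuous_gradInner g hρ hf)))
  have hsc : ∀ (k : SmoothMetric n X), ∀ y ∈ V,
      scalarCurvature k ((extChartAt (𝓡 n) x₀).symm y) = scalarCoord (metricCoeff k x₀) y := by
    intro k y hy
    rw [scalarCurvature_eq k ((extChartAt (𝓡 n) x₀).map_target hy),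
      (extChartAt (𝓡 n) x₀).right_inv hy]
  have hgr : ∀ {p : X → ℝ}, ContMDiff (𝓡 n) 𝓘(ℝ) ∞ p → ∀ y ∈ V,
      gradInner g p f ((extChartAt (𝓡 n) x₀).symm y)
        = gradCoord (metricCoeff g x₀) (inChart p x₀) (inChart f x₀) y := by
    intro p hp y hy
    rw [gradInner_eq g hp hf ((extChartAt (𝓡 n) x₀).map_target hy),
      (extChartAt (𝓡 n) x₀).right_inv hy]
  set γ := metricCoeff g x₀ with hγdef
  set p := inChart (n := n) ρ x₀ with hpdef
  set q := inChart (n := n) f x₀ with hqdef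
  set W := fun y => Real.exp (((n : ℝ) - 2) * q y) with hWdef
  -- The curvature contributes e^{-2f} and the volume density e^{nf}, which together give the weight
  -- `W` = e^{(n-2)f}.
  have hL : ∀ y ∈ V, inChart (fun x => ρ x * scalarCurvature h x) x₀ y * density h x₀ y
      = p y * W y * (density g x₀ y * (scalarCoord γ y
          - ((n : ℝ) - 1) * ((n : ℝ) - 2) * gradCoord γ q q y))
        - 2 * ((n : ℝ) - 1) * (p y * W y * (density g x₀ y * laplaceCoord γ q y)) := by
    intro y hy
    have hE : Real.exp (-(2 * q y)) * Real.exp (n * q y) = W y := by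
      rw [hWdef, ← Real.exp_add]; congr 1; ring
    rw [inChart, hsc h y hy, hh.density_eq, hh.metricCoeff_eq, hγ.scalarCoord_exp_smul hfc hy,
      ← hE]
    change p y * _ * _ = _
    ring
  have hgrad : ∀ y ∈ V, gradCoord γ (fun y => p y * W y) q y
      = W y * gradCoord γ p q y + ((n : ℝ) - 2) * (p y * W y) * gradCoord γ q q y := by
    intro y hy
    have hpd := differentiableAt_of_contDiffOn hV hρc hy
    have hqd := differentiableAt_of_contDiffOn hV hfc hy
    have hWd := differentiableAt_of_contDiffOn hV hWc hy
    have hW' : ∀ i, partialDeriv i W y = W y * (((n : ℝ) - 2) * partialDeriv i q y) := by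
      intro i
      rw [hWdef, partialDeriv_comp (Real.hasDerivAt_exp _) (hqd.const_mul _),
        partialDeriv_const_mul hqd]
    simp only [gradCoord, partialDeriv_mul hpd hWd, hW', Finset.mul_sum]
    rw [← Finset.sum_add_distrib]
    refine Finset.sum_congr rfl fun i _ => ?_
    rw [← Finset.sum_add_distrib]
    exact Finset.sum_congr rfl fun j _ => by ring
  -- Green's formula with a = ρ e^{(n-2)f} turns -2(n-1) a Δf into 2(n-1)⟨da, df⟩. Differentiating
  -- the weight yields 2(n-1)(n-2)|df|², so (n-1)(n-2)|df|² survives; differentiating ρ yields the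
  -- extra term.
  have hgreen := setIntegral_mul_laplaceCoord hγ hK hKV hac hfc ha0
  have hdc := (contDiffOn_density g x₀).continuousOn
  have hi1 : IntegrableOn (fun y => p y * W y * (density g x₀ y * (scalarCoord γ y
      - ((n : ℝ) - 1) * ((n : ℝ) - 2) * gradCoord γ q q y))) V :=
    integrableOn_of_vanishing hV hK hKV (hac.continuousOn.mul (hdc.mul
      (hγ.contDiffOn_scalarCoord.continuousOn.sub (continuousOn_const.mul
        (hγ.contDiffOn_gradCoord hfc hfc).continuousOn)))) fun y hy hyK => by
          rw [ha0 y hy hyK, zero_mul]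
  have hlap : ContinuousOn (fun y => density g x₀ y * laplaceCoord γ q y) V := by
    have : ContinuousOn (fun y => ∑ k,
        partialDeriv k (fun z => Real.sqrt (γ z).det * gradUp γ q k z) y) V :=
      continuousOn_finsetSum _ fun k _ => (contDiffOn_partialDeriv hV
        (hγ.contDiffOn_sqrt_det.mul (hγ.contDiffOn_gradUp hfc k)) k).continuousOn
    exact this.congr fun y hy => hγ.sqrt_det_mul_laplaceCoord hfc hy
  have hi2 : IntegrableOn (fun y => p y * W y * (density g x₀ y * laplaceCoord γ q y)) V :=
    integrableOn_of_vanishing hV hK hKV (hac.continuousOn.mul hlap) fun y hy hyK => by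
      rw [ha0 y hy hyK, zero_mul]
  have hi3 : IntegrableOn (fun y => density g x₀ y * gradCoord γ (fun y => p y * W y) q y) V :=
    integrableOn_of_vanishing hV hK hKV
      (hdc.mul (hγ.contDiffOn_gradCoord hac hfc).continuousOn) fun y hy hyK => by
        have hz : ∀ i, partialDeriv i (fun y => p y * W y) y = 0 := fun i =>
          partialDeriv_eq_zero_of_vanishing hV hK ha0 i hy hyK
        simp only [gradCoord, hz, zero_mul, mul_zero, Finset.sum_const_zero]
  have hR : ∀ y ∈ V, inChart (fun x => ρ x * (Real.exp (((n : ℝ) - 2) * f x) *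
      (scalarCurvature g x + ((n : ℝ) - 1) * ((n : ℝ) - 2) * gradInner g f f x))
      + 2 * ((n : ℝ) - 1) * (Real.exp (((n : ℝ) - 2) * f x) * gradInner g ρ f x)) x₀ y
        * density g x₀ y
      = p y * W y * (density g x₀ y * (scalarCoord γ y
          - ((n : ℝ) - 1) * ((n : ℝ) - 2) * gradCoord γ q q y))
        + 2 * ((n : ℝ) - 1) * (density g x₀ y * gradCoord γ (fun y => p y * W y) q y) := by
    intro y hy
    rw [hgrad y hy, inChart, hsc g y hy, hgr hf y hy, hgr hρ y hy]
    change (p y * (W y * _) + 2 * ((n : ℝ) - 1) * (W y * _)) * _ = _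
    ring
  rw [setIntegral_congr_fun hV.measurableSet hL, setIntegral_congr_fun hV.measurableSet hR,
    integral_sub hi1 (hi2.const_mul _), integral_add hi1 (hi3.const_mul _),
    integral_const_mul, integral_const_mul]
  change ∫ y in V, p y * W y * (density g x₀ y * laplaceCoord γ q y)
    = -∫ y in V, density g x₀ y * gradCoord γ (fun y => p y * W y) q y at hgreen
  rw [hgreen]
  ring

/-- The total scalar curvature of the conformal metric `e^{2f} g`. -/
theorem IsConformalExp.integral_scalarCurvature [T2Space X] [CompactSpace X]
    (hh : IsConformalExp h g f) (hf : ContMDiff (𝓡 n) 𝓘(ℝ) ∞ f) :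
    ∫ x, scalarCurvature h x ∂(riemannianVolume h)
      = ∫ x, Real.exp (((n : ℝ) - 2) * f x) * (scalarCurvature g x
          + ((n : ℝ) - 1) * ((n : ℝ) - 2) * gradInner g f f x) ∂(riemannianVolume g) := by
  -- By compactness finitely many charts suffice, so the partition of unity is a finite family and
  -- sums commute with integrals.
  obtain ⟨t, ht⟩ := isCompact_univ.elim_nhds_subcover
    (fun x : X => (extChartAt (𝓡 n) x).source) fun x _ => extChartAt_source_mem_nhds x
  obtain ⟨ρ, hρ⟩ := SmoothPartitionOfUnity.exists_isSubordinate (𝓡 n) (isClosed_univ (X := X))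
    (fun x : t => (extChartAt (𝓡 n) (x : X)).source)
    (fun x => isOpen_extChartAt_source (x : X)) (by
      intro x hx
      simpa using ht.2 hx)
  have hsum : ∀ x, ∑ i, ρ i x = 1 := by
    intro x
    rw [← finsum_eq_sum_of_fintype]
    exact ρ.sum_eq_one (mem_univ x)
  have hρs : ∀ i, ContMDiff (𝓡 n) 𝓘(ℝ) ∞ (ρ i) := fun i => (ρ i).contMDiff
  -- The functions ρ i sum to 1, so their differentials sum to 0 and the extra terms of the local
  -- formula disappear.
  have hgrad0 : ∀ x, ∑ i, gradInner g (ρ i) f x = 0 := by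
    intro x
    have hd : ∀ i, DifferentiableAt ℝ (inChart (ρ i) x) (extChartAt (𝓡 n) x x) := fun i =>
      differentiableAt_of_contDiffOn (isOpen_extChartAt_target x) (contDiffOn_inChart (hρs i) x)
        (mem_extChartAt_target x)
    have hz : ∀ a, ∑ i, partialDeriv a (inChart (ρ i) x) (extChartAt (𝓡 n) x x) = 0 := by
      intro a
      rw [← partialDeriv_sum _ fun i _ => hd i]
      have : (fun z => ∑ i, inChart (ρ i) x z) = fun _ : EuclideanSpace ℝ (Fin n) => (1 : ℝ) :=
        funext fun z => hsum _
      rw [this, partialDeriv_const]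
    simp only [gradInner, gradCoord_eq_sum_gradUp]
    rw [Finset.sum_comm]
    simp only [← Finset.sum_mul, hz, zero_mul, Finset.sum_const_zero]
  have hW : Continuous fun x => Real.exp (((n : ℝ) - 2) * f x) :=
    (continuous_const.mul hf.continuous).rexp
  have hmain : Continuous fun x => Real.exp (((n : ℝ) - 2) * f x) * (scalarCurvature g x
      + ((n : ℝ) - 1) * ((n : ℝ) - 2) * gradInner g f f x) :=
    hW.mul ((continuous_scalarCurvature g).add
      (continuous_const.mul (continuous_gradInner g hf hf)))
  have h1 : ∀ x, scalarCurvature h x = ∑ i, ρ i x * scalarCurvature h x := fun x => by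
    rw [← Finset.sum_mul, hsum, one_mul]
  have h2 : ∀ x, Real.exp (((n : ℝ) - 2) * f x) * (scalarCurvature g x
      + ((n : ℝ) - 1) * ((n : ℝ) - 2) * gradInner g f f x)
      = ∑ i, (ρ i x * (Real.exp (((n : ℝ) - 2) * f x) * (scalarCurvature g x
          + ((n : ℝ) - 1) * ((n : ℝ) - 2) * gradInner g f f x))
        + 2 * ((n : ℝ) - 1) * (Real.exp (((n : ℝ) - 2) * f x) * gradInner g (ρ i) f x)) := by
    intro x
    rw [Finset.sum_add_distrib, ← Finset.sum_mul, hsum, ← Finset.mul_sum, ← Finset.mul_sum,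
      hgrad0]
    ring
  rw [integral_congr_ae (Filter.Eventually.of_forall h1),
    integral_congr_ae (Filter.Eventually.of_forall h2), integral_finsetSum, integral_finsetSum]
  · exact Finset.sum_congr rfl fun i _ => hh.integral_mul_scalarCurvature hf (hρs i) (hρ i)
  · intro i _
    exact integrable_of_continuous g (((hρs i).continuous.mul hmain).add
      (continuous_const.mul (hW.mul (continuous_gradInner g (hρs i) hf))))
  · intro i _
    exact integrable_of_continuous h ((hρs i).continuous.mul (continuous_scalarCurvature h))

end Energy

/-! ### Invariant functions by averaging -/

section Averaging

variable {d : ℕ} {G : Type*} [TopologicalSpace G] [ChartedSpace (EuclideanSpace ℝ (Fin d)) G]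
  [IsManifold (𝓡 d) ∞ G] [CompactSpace G] [T2Space G] [MeasurableSpace G] [BorelSpace G]
  {E : Type} [NormedAddCommGroup E] [NormedSpace ℝ E] [FiniteDimensional ℝ E]
  (μ : Measure G) [IsFiniteMeasure μ] {V : Set E}

/-- Joint smoothness passes to the partial derivative in the vector variable; between vector spaces
the tangent coordinates used for `mfderiv` are trivial. -/
theorem contMDiffAt_fderiv_snd {F' : Type} [NormedAddCommGroup F'] [NormedSpace ℝ F']
    {F : G → E → F'} {a : G} {y : E}
    (hF : ContMDiffAt ((𝓡 d).prod 𝓘(ℝ, E)) 𝓘(ℝ, F') ∞ (Function.uncurry F) (a, y)) :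
    ContMDiffAt ((𝓡 d).prod 𝓘(ℝ, E)) 𝓘(ℝ, E →L[ℝ] F') ∞
      (Function.uncurry fun a y => fderiv ℝ (F a) y) (a, y) := by
  have : IsManifold (𝓡 d) 1 G := IsManifold.of_le (n := ∞) ENat.LEInfty.out
  have h1 : ContMDiffAt (((𝓡 d).prod 𝓘(ℝ, E)).prod 𝓘(ℝ, E)) 𝓘(ℝ, F') ∞
      (Function.uncurry fun (p : G × E) (z : E) => F p.1 z) ((a, y), y) := by
    have h2 : ContMDiffAt (((𝓡 d).prod 𝓘(ℝ, E)).prod 𝓘(ℝ, E)) ((𝓡 d).prod 𝓘(ℝ, E)) ∞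
        (fun p : (G × E) × E => (p.1.1, p.2)) ((a, y), y) :=
      (contMDiffAt_fst.comp _ contMDiffAt_fst).prodMk contMDiffAt_snd
    exact ContMDiffAt.comp ((a, y), y) (g := Function.uncurry F) hF h2
  have h3 := ContMDiffAt.mfderiv (x₀ := (a, y)) (fun (p : G × E) (z : E) => F p.1 z) Prod.snd h1
    (contMDiffAt_snd (n := ∞)) (by simp)
  have h4 := inTangentCoordinates_model_space (I := 𝓘(ℝ, E)) (I' := 𝓘(ℝ, F')) Prod.snd
    (fun p : G × E => F p.1 p.2) (fun p => fderiv ℝ (F p.1) p.2) (a, y)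
  simp only [mfderiv_eq_fderiv] at h3
  exact h3.congr_of_eventuallyEq (Filter.Eventually.of_forall fun p => (congrFun h4 p).symm)

/-- Differentiation under the integral sign: compactness of G and of a closed ball around y bounds
the derivative by a constant, integrable for the finite measure μ. -/
theorem hasFDerivAt_integral_of_contMDiffAt {F' : Type} [NormedAddCommGroup F']
    [NormedSpace ℝ F'] (hV : IsOpen V) {F : G → E → F'}
    (hF : ∀ a, ∀ y ∈ V,
      ContMDiffAt ((𝓡 d).prod 𝓘(ℝ, E)) 𝓘(ℝ, F') ∞ (Function.uncurry F) (a, y))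
    {y : E} (hy : y ∈ V) :
    HasFDerivAt (fun y => ∫ a, F a y ∂μ) (∫ a, fderiv ℝ (F a) y ∂μ) y := by
  have : SecondCountableTopology G :=
    ChartedSpace.secondCountable_of_sigmaCompact (EuclideanSpace ℝ (Fin d)) G
  have hcont : ∀ z ∈ V, Continuous fun a => F a z := fun z hz =>
    continuous_iff_continuousAt.2 fun a => (hF a z hz).continuousAt.comp
      (f := fun a : G => (a, z)) (by fun_prop)
  have hdc : ∀ z ∈ V, ∀ a, ContinuousAt (Function.uncurry fun a y => fderiv ℝ (F a) y) (a, z) :=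
    fun z hz a => (contMDiffAt_fderiv_snd (hF a z hz)).continuousAt
  have hdcont : ∀ z ∈ V, Continuous fun a => fderiv ℝ (F a) z := fun z hz =>
    continuous_iff_continuousAt.2 fun a => (hdc z hz a).comp
      (f := fun a : G => (a, z)) (by fun_prop)
  obtain ⟨r, hr, hball⟩ := Metric.nhds_basis_closedBall.mem_iff.1 (hV.mem_nhds hy)
  have hKc : IsCompact ((univ : Set G) ×ˢ Metric.closedBall y r) :=
    isCompact_univ.prod (isCompact_closedBall y r)
  obtain ⟨C, hC⟩ := hKc.exists_bound_of_continuousOn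
    (f := Function.uncurry fun a y => fderiv ℝ (F a) y)
    (fun p hp => (hdc p.2 (hball hp.2) p.1).continuousWithinAt)
  refine hasFDerivAt_integral_of_dominated_of_fderiv_le (s := Metric.ball y r)
    (bound := fun _ => C) (F' := fun z a => fderiv ℝ (F a) z) (Metric.ball_mem_nhds y hr) ?_ ?_ ?_
    ?_ (integrable_const C) ?_
  · filter_upwards [hV.mem_nhds hy] with z hz
    exact (hcont z hz).aestronglyMeasurable
  · exact (hcont y hy).integrable_of_hasCompactSupport (HasCompactSupport.of_compactSpace _)
  · exact (hdcont y hy).aestronglyMeasurable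
  · refine Filter.Eventually.of_forall fun a z hz => ?_
    exact hC (a, z) ⟨mem_univ _, Metric.ball_subset_closedBall hz⟩
  · refine Filter.Eventually.of_forall fun a z hz => ?_
    have h1 : ContMDiffAt 𝓘(ℝ, E) 𝓘(ℝ, F') ∞ (F a) z :=
      ContMDiffAt.comp z (g := Function.uncurry F) (f := fun z => (a, z))
        (hF a z (hball (Metric.ball_subset_closedBall hz)))
        (contMDiffAt_const.prodMk contMDiffAt_id)
    exact (h1.contDiffAt.differentiableAt (by simp)).hasFDerivAt

/-- Induction on the order of differentiability. The target space is quantified inside the induction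
because the derivative takes values in a space of linear maps. -/
theorem contDiffOn_integral_of_contMDiffAt (hV : IsOpen V) (k : ℕ) :
    ∀ {F' : Type} [NormedAddCommGroup F'] [NormedSpace ℝ F'] {F : G → E → F'},
      (∀ a, ∀ y ∈ V,
        ContMDiffAt ((𝓡 d).prod 𝓘(ℝ, E)) 𝓘(ℝ, F') ∞ (Function.uncurry F) (a, y)) →
      ContDiffOn ℝ k (fun y => ∫ a, F a y ∂μ) V := by
  induction k with
  | zero =>
    intro F' _ _ F hF
    exact contDiffOn_zero.2 fun y hy =>
      (hasFDerivAt_integral_of_contMDiffAt μ hV hF hy).continuousAt.continuousWithinAt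
  | succ k ih =>
    intro F' _ _ F hF
    have h := fun y (hy : y ∈ V) => hasFDerivAt_integral_of_contMDiffAt μ hV hF hy
    push_cast
    rw [contDiffOn_succ_iff_fderiv_of_isOpen hV]
    refine ⟨fun y hy => (h y hy).differentiableAt.differentiableWithinAt, by simp, ?_⟩
    have h2 := ih (F := fun a y => fderiv ℝ (F a) y) fun a y hy =>
      contMDiffAt_fderiv_snd (hF a y hy)
    exact h2.congr fun y hy => (h y hy).fderiv

variable {n : ℕ} {X : Type*} [TopologicalSpace X]
  [ChartedSpace (EuclideanSpace ℝ (Fin n)) X] [IsManifold (𝓡 n) ∞ X]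

theorem contMDiff_integral {F : G → X → ℝ}
    (hF : ContMDiff ((𝓡 d).prod (𝓡 n)) 𝓘(ℝ) ∞ (Function.uncurry F)) :
    ContMDiff (𝓡 n) 𝓘(ℝ) ∞ fun x => ∫ a, F a x ∂μ := by
  intro x₀
  have h1 : ContDiffOn ℝ ∞ (fun y => ∫ a, F a ((extChartAt (𝓡 n) x₀).symm y) ∂μ)
      (extChartAt (𝓡 n) x₀).target := by
    refine contDiffOn_infty.2 fun k => ?_
    refine contDiffOn_integral_of_contMDiffAt (d := d) μ (isOpen_extChartAt_target x₀) k
      (F := fun a y => F a ((extChartAt (𝓡 n) x₀).symm y)) fun a y hy => ?_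
    have h2 : ContMDiffAt 𝓘(ℝ, EuclideanSpace ℝ (Fin n)) (𝓡 n) ∞ (extChartAt (𝓡 n) x₀).symm y :=
      (contMDiffOn_extChartAt_symm x₀).contMDiffAt ((isOpen_extChartAt_target x₀).mem_nhds hy)
    have h3 : ContMDiffAt ((𝓡 d).prod 𝓘(ℝ, EuclideanSpace ℝ (Fin n))) ((𝓡 d).prod (𝓡 n)) ∞
        (fun p : G × EuclideanSpace ℝ (Fin n) => (p.1, (extChartAt (𝓡 n) x₀).symm p.2)) (a, y) :=
      contMDiffAt_fst.prodMk (ContMDiffAt.comp (a, y) (g := (extChartAt (𝓡 n) x₀).symm)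
        (f := Prod.snd) h2 contMDiffAt_snd)
    exact ContMDiffAt.comp (a, y) (g := Function.uncurry F) (hF _) h3
  have h4 : ContMDiffAt (𝓡 n) 𝓘(ℝ) ∞
      (fun x => ∫ a, F a ((extChartAt (𝓡 n) x₀).symm (extChartAt (𝓡 n) x₀ x)) ∂μ) x₀ :=
    ContMDiffAt.comp x₀ (g := fun y => ∫ a, F a ((extChartAt (𝓡 n) x₀).symm y) ∂μ)
      (f := extChartAt (𝓡 n) x₀)
      (h1.contDiffAt ((isOpen_extChartAt_target x₀).mem_nhds (mem_extChartAt_target x₀))).contMDiffAt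
      contMDiffAt_extChartAt
  refine h4.congr_of_eventuallyEq ?_
  filter_upwards [extChartAt_source_mem_nhds (I := 𝓡 n) x₀] with x hx
  rw [(extChartAt (𝓡 n) x₀).left_inv hx]

end Averaging

/-- A nonzero smooth invariant function supported in a given invariant open set. -/
theorem exists_invariant_bump {n : ℕ} {X : Type*} [TopologicalSpace X]
    [ChartedSpace (EuclideanSpace ℝ (Fin n)) X] [IsManifold (𝓡 n) ∞ X] [T2Space X]
    {d : ℕ} {G : Type*} [Group G] [TopologicalSpace G]
    [ChartedSpace (EuclideanSpace ℝ (Fin d)) G] [LieGroup (𝓡 d) ∞ G] [T2Space G] [CompactSpace G]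
    [MulAction G X] [ContMDiffSMul (𝓡 d) (𝓡 n) ∞ G X]
    {U : Set X} (hU : IsOpen U) (hne : U.Nonempty) (hinv : ∀ (a : G), ∀ x ∈ U, a • x ∈ U) :
    ∃ φ : X → ℝ, ContMDiff (𝓡 n) 𝓘(ℝ) ∞ φ ∧ (∀ x, 0 ≤ φ x) ∧ (∀ (a : G) x, φ (a • x) = φ x) ∧
      tsupport φ ⊆ U ∧ ∃ x, 0 < φ x := by
  let _ : MeasurableSpace G := borel G
  have : BorelSpace G := ⟨rfl⟩
  have : IsTopologicalGroup G := topologicalGroup_of_lieGroup (𝓡 d) ∞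
  have : IsManifold (𝓡 d) ∞ G := ContMDiffMul.toIsManifold
  have : ContinuousSMul G X := ContMDiffSMul.continuousSMul (I := 𝓡 d) (I' := 𝓡 n) ∞
  obtain ⟨x₀, hx₀⟩ := hne
  obtain ⟨b, -, hb⟩ := (SmoothBumpFunction.nhds_basis_tsupport (I := 𝓡 n) x₀).mem_iff.1
    (hU.mem_nhds hx₀)
  have hbs : ContMDiff (𝓡 n) 𝓘(ℝ) ∞ b := b.contMDiff
  -- The invariant function is the Haar average of the translates of a bump at x₀.
  set F : G → X → ℝ := fun a x => b (a⁻¹ • x) with hFdef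
  have hF : ContMDiff ((𝓡 d).prod (𝓡 n)) 𝓘(ℝ) ∞ (Function.uncurry F) :=
    hbs.comp ((contMDiff_fst.inv).smul contMDiff_snd)
  have hFc : ∀ x, Continuous fun a => F a x := fun x =>
    hbs.continuous.comp (continuous_inv.smul continuous_const)
  have hF0 : ∀ a x, 0 ≤ F a x := fun a x => b.nonneg
  refine ⟨fun x => ∫ a, F a x ∂Measure.haar, contMDiff_integral (d := d) _ hF,
    fun x => integral_nonneg fun a => hF0 a x, fun c x => ?_, ?_, x₀, ?_⟩
  · have h1 : ∀ a, F a (c • x) = F (c⁻¹ * a) x := by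
      intro a
      simp only [hFdef, mul_inv_rev, inv_inv, mul_smul]
    simp only [h1]
    -- Moving the point amounts to a left translation of the group variable, which Haar measure
    -- ignores.
    exact integral_mul_left_eq_self (fun a => F a x) c⁻¹
  -- The average is supported in the orbit of the bump's support. That orbit is compact because G
  -- is, hence closed, and it lies in U by invariance.
  · set C := (fun p : G × X => p.1 • p.2) '' (univ ×ˢ tsupport b) with hCdef
    have hC : IsCompact C := (isCompact_univ.prod b.hasCompactSupport).image continuous_smul
    have hCU : C ⊆ U := by
      rintro _ ⟨⟨a, x⟩, ⟨-, hx⟩, rfl⟩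
      exact hinv a x (hb hx)
    refine (closure_minimal (fun x hx => ?_) hC.isClosed).trans hCU
    by_contra hxC
    refine hx ?_
    have h0 : ∀ a, F a x = 0 := by
      intro a
      refine image_eq_zero_of_notMem_tsupport (f := b) fun h => hxC ⟨(a, a⁻¹ • x), ⟨mem_univ _, h⟩, ?_⟩
      simp
    simp [h0]
  -- At x₀ the integrand is nonnegative, continuous and nonzero at the identity of G.
  · refine (hFc x₀).integral_pos_of_hasCompactSupport_nonneg_nonzero
      (HasCompactSupport.of_compactSpace _) (fun a => hF0 a x₀) (x := 1) ?_
    simp [hFdef]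

/-! ### Comparison of positive definite matrices -/

section MatrixComparison

open Matrix

variable {n : ℕ} {A B : Matrix (Fin n) (Fin n) ℝ}

/-- Diagonalise B orthogonally and rescale each eigenvector by the inverse square root of its
eigenvalue. -/
theorem exists_conjTranspose_mul_mul_eq_one (hB : B.PosDef) :
    ∃ K : Matrix (Fin n) (Fin n) ℝ, Kᴴ * B * K = 1 := by
  have hs := hB.1.conjStarAlgAut_star_eigenvectorUnitary
  rw [Unitary.conjStarAlgAut_star_apply] at hs
  set W : Matrix (Fin n) (Fin n) ℝ := (hB.1.eigenvectorUnitary).1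
  refine ⟨W * diagonal fun i => (Real.sqrt (hB.1.eigenvalues i))⁻¹, ?_⟩
  rw [conjTranspose_mul, diagonal_conjTranspose]
  have e : ∀ L : Matrix (Fin n) (Fin n) ℝ, L * Wᴴ * B * (W * L) = L * (star W * B * W) * L := by
    intro L
    simp only [star_eq_conjTranspose, Matrix.mul_assoc]
  rw [show (star fun i => (Real.sqrt (hB.1.eigenvalues i))⁻¹)
    = fun i => (Real.sqrt (hB.1.eigenvalues i))⁻¹ from star_trivial _, e, hs, diagonal_mul_diagonal,
    diagonal_mul_diagonal, ← diagonal_one]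
  congr 1
  funext i
  have h1 := hB.eigenvalues_pos i
  have h2 := Real.sqrt_pos.2 h1
  simp only [Function.comp, RCLike.ofReal_real_eq_id, id]
  nth_rw 2 [← Real.mul_self_sqrt h1.le]
  field_simp

/-- A change of basis turns B into the identity. The transformed A then has all eigenvalues in [0,
c], so its determinant is at most cⁿ. -/
theorem det_le_of_quadForm_le (hA : A.PosDef) (hB : B.PosDef) {c : ℝ}
    (h : ∀ v, v ⬝ᵥ A *ᵥ v ≤ c * (v ⬝ᵥ B *ᵥ v)) : A.det ≤ c ^ n * B.det := by
  obtain ⟨K, hK⟩ := exists_conjTranspose_mul_mul_eq_one hB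
  have hq : ∀ (C : Matrix (Fin n) (Fin n) ℝ) (u : Fin n → ℝ),
      u ⬝ᵥ (Kᴴ * C * K) *ᵥ u = (K *ᵥ u) ⬝ᵥ C *ᵥ (K *ᵥ u) := by
    intro C u
    rw [← mulVec_mulVec, ← mulVec_mulVec, dotProduct_mulVec, conjTranspose_eq_transpose_of_trivial,
      vecMul_transpose]
  have hM : (Kᴴ * A * K).PosSemidef := hA.posSemidef.conjTranspose_mul_mul_same K
  have hle : ∀ i, hM.1.eigenvalues i ≤ c := by
    intro i
    rw [hM.1.eigenvalues_eq, star_trivial, RCLike.re_to_real, hq]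
    refine (h _).trans ?_
    rw [← hq, hK, one_mulVec]
    have := hM.1.eigenvectorBasis.orthonormal.1 i
    have h2 : (hM.1.eigenvectorBasis i).ofLp ⬝ᵥ (hM.1.eigenvectorBasis i).ofLp = 1 := by
      have h3 := EuclideanSpace.inner_eq_star_dotProduct (𝕜 := ℝ) (hM.1.eigenvectorBasis i)
        (hM.1.eigenvectorBasis i)
      rw [real_inner_self_eq_norm_sq, this, star_trivial] at h3
      linarith
    rw [h2, mul_one]
  have hdet : (Kᴴ * A * K).det ≤ c ^ n := by
    rw [hM.1.det_eq_prod_eigenvalues]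
    calc (∏ i, (hM.1.eigenvalues i : ℝ)) ≤ ∏ _i : Fin n, c :=
          Finset.prod_le_prod (fun i _ => hM.eigenvalues_nonneg i) fun i _ => hle i
      _ = c ^ n := by simp
  have hKB := congrArg Matrix.det hK
  rw [det_mul, det_mul, det_one, conjTranspose_eq_transpose_of_trivial, det_transpose] at hKB
  rw [det_mul, det_mul, conjTranspose_eq_transpose_of_trivial, det_transpose] at hdet
  have hB0 := hB.det_pos
  calc A.det = K.det * A.det * K.det * B.det := by linear_combination -A.det * hKB
    _ ≤ c ^ n * B.det := mul_le_mul_of_nonneg_right hdet hB0.le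

/-- Inversion reverses the order of positive definite forms; this is what transfers an inequality on
tangent vectors to one on differentials. -/
theorem inv_quadForm_le (hA : A.PosDef) (hB : B.PosDef) {c : ℝ} (hc : 0 < c)
    (h : ∀ v, v ⬝ᵥ B *ᵥ v ≤ c * (v ⬝ᵥ A *ᵥ v)) (q : Fin n → ℝ) :
    q ⬝ᵥ A⁻¹ *ᵥ q ≤ c * (q ⬝ᵥ B⁻¹ *ᵥ q) := by
  have hAv : A *ᵥ (A⁻¹ *ᵥ q) = q := by
    rw [mulVec_mulVec, mul_nonsing_inv _ hA.det_pos.ne'.isUnit, one_mulVec]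
  have hBw : B *ᵥ (B⁻¹ *ᵥ q) = q := by
    rw [mulVec_mulVec, mul_nonsing_inv _ hB.det_pos.ne'.isUnit, one_mulVec]
  set v := A⁻¹ *ᵥ q
  set w := B⁻¹ *ᵥ q
  have hsymm : w ⬝ᵥ B *ᵥ v = v ⬝ᵥ q := by
    rw [dotProduct_mulVec, ← mulVec_transpose, ← conjTranspose_eq_transpose_of_trivial, hB.1.eq,
      hBw, dotProduct_comm]
  -- With v = A⁻¹q and w = B⁻¹q, expanding the B-square of c w - v gives c² w·q - 2c v·q + vᵀBv ≥ 0.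
  -- Since vᵀBv ≤ c v·q, it follows that v·q ≤ c w·q.
  have h1 := hB.posSemidef.dotProduct_mulVec_nonneg (c • w - v)
  have h2 := h v
  rw [hAv] at h2
  simp only [star_trivial, mulVec_sub, mulVec_smul, dotProduct_sub, sub_dotProduct, smul_dotProduct,
    dotProduct_smul, smul_eq_mul, hBw, hsymm] at h1
  rw [dotProduct_comm q v, dotProduct_comm q w]
  by_contra hlt
  push Not at hlt
  nlinarith

end MatrixComparison

/-! ### Comparison of Riemannian metrics -/

section MetricComparison

variable {n : ℕ} {X : Type*} [TopologicalSpace X]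
  [ChartedSpace (EuclideanSpace ℝ (Fin n)) X] [IsManifold (𝓡 n) ∞ X]
  {g h : SmoothMetric n X} {c : ℝ}

theorem dotProduct_metricCoeff_mulVec (g : SmoothMetric n X) (x₀ : X)
    (y : EuclideanSpace ℝ (Fin n)) (v : Fin n → ℝ) :
    v ⬝ᵥ (metricCoeff g x₀ y).mulVec v = metricAt g ((extChartAt (𝓡 n) x₀).symm y)
      (chartDeriv x₀ y (WithLp.toLp 2 v)) (chartDeriv x₀ y (WithLp.toLp 2 v)) := by
  rw [← metricCoeff_quadForm]
  simp only [dotProduct, Matrix.mulVec, Finset.mul_sum]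
  exact Finset.sum_congr rfl fun i _ => Finset.sum_congr rfl fun j _ => by ring

theorem gradInner_self_eq (g : SmoothMetric n X) (a : X → ℝ) (x : X) :
    gradInner g a a x = (fun i => partialDeriv i (inChart a x) (extChartAt (𝓡 n) x x)) ⬝ᵥ
      ((metricCoeff g x (extChartAt (𝓡 n) x x))⁻¹).mulVec
        fun i => partialDeriv i (inChart a x) (extChartAt (𝓡 n) x x) := by
  simp only [gradInner, gradCoord, dotProduct, Matrix.mulVec, Finset.mul_sum]
  exact Finset.sum_congr rfl fun i _ => Finset.sum_congr rfl fun j _ => by ring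

theorem gradInner_self_nonneg (g : SmoothMetric n X) (a : X → ℝ) (x : X) :
    0 ≤ gradInner g a a x := by
  rw [gradInner_self_eq]
  have := (metricCoeff_posDef g (mem_extChartAt_target (I := 𝓡 n) x)).inv.posSemidef
  simpa only [star_trivial] using this.dotProduct_mulVec_nonneg
    fun i => partialDeriv i (inChart a x) (extChartAt (𝓡 n) x x)

theorem gradInner_self_le (hc : 0 < c) {x : X}
    (hgh : ∀ v : TangentSpace (𝓡 n) x, h.inner x v v ≤ c * g.inner x v v) (a : X → ℝ) :
    gradInner g a a x ≤ c * gradInner h a a x := by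
  rw [gradInner_self_eq, gradInner_self_eq]
  refine inv_quadForm_le (metricCoeff_posDef g (mem_extChartAt_target (I := 𝓡 n) x))
    (metricCoeff_posDef h (mem_extChartAt_target (I := 𝓡 n) x)) hc (fun v => ?_) _
  rw [dotProduct_metricCoeff_mulVec, dotProduct_metricCoeff_mulVec]
  have hx := (extChartAt (𝓡 n) x).left_inv (mem_extChartAt_source (I := 𝓡 n) x)
  rw [hx]
  exact hgh _

theorem density_le (hc : 0 ≤ c) {x₀ : X} {y : EuclideanSpace ℝ (Fin n)}
    (hy : y ∈ (extChartAt (𝓡 n) x₀).target)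
    (hgh : ∀ v : TangentSpace (𝓡 n) ((extChartAt (𝓡 n) x₀).symm y),
      g.inner _ v v ≤ c * h.inner _ v v) :
    density g x₀ y ≤ Real.sqrt (c ^ n) * density h x₀ y := by
  rw [density, density, ← Real.sqrt_mul (pow_nonneg hc n)]
  refine Real.sqrt_le_sqrt (det_le_of_quadForm_le (metricCoeff_posDef g hy)
    (metricCoeff_posDef h hy) fun v => ?_)
  rw [dotProduct_metricCoeff_mulVec, dotProduct_metricCoeff_mulVec]
  exact hgh _

variable [MeasurableSpace X] [BorelSpace X]

theorem riemannianVolume_le_of_metric_le (hc : 0 ≤ c) {S : Set X} (hS : MeasurableSet S)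
    (hgh : ∀ x ∈ S, ∀ v : TangentSpace (𝓡 n) x, g.inner x v v ≤ c * h.inner x v v)
    {A : Set X} (hA : MeasurableSet A) (hAS : A ⊆ S) :
    riemannianVolume g A ≤ ENNReal.ofReal (Real.sqrt (c ^ n)) * riemannianVolume h A := by
  refine riemannianVolume_le_of_chart g hS
    (ENNReal.ofReal (Real.sqrt (c ^ n)) • riemannianVolume h) (fun x₀ B hB hBS => ?_) hA hAS
  rw [Measure.smul_apply, smul_eq_mul]
  refine le_trans ?_ (mul_le_mul_right (chartVolume_le h x₀ B) _)
  rw [chartVolume_apply g x₀ hB, chartVolume_apply h x₀ hB,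
    ← lintegral_const_mul' _ _ ENNReal.ofReal_ne_top]
  refine setLIntegral_mono' (measurableSet_chartPreimage x₀ hB) fun y hy => ?_
  rw [← ENNReal.ofReal_mul (Real.sqrt_nonneg _)]
  exact ENNReal.ofReal_le_ofReal (density_le hc hy.1 (hgh _ (hBS hy.2)))

theorem integral_le_of_metric_le [T2Space X] [CompactSpace X] (hc : 0 ≤ c) {S : Set X}
    (hS : MeasurableSet S)
    (hgh : ∀ x ∈ S, ∀ v : TangentSpace (𝓡 n) x, g.inner x v v ≤ c * h.inner x v v)
    {F : X → ℝ} (hF : Continuous F) (hF0 : ∀ x, 0 ≤ F x) (hFS : ∀ x ∉ S, F x = 0) :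
    ∫ x, F x ∂(riemannianVolume g) ≤ Real.sqrt (c ^ n) * ∫ x, F x ∂(riemannianVolume h) := by
  have hle : (riemannianVolume g).restrict S
      ≤ ENNReal.ofReal (Real.sqrt (c ^ n)) • (riemannianVolume h).restrict S := by
    refine Measure.le_iff.2 fun B hB => ?_
    rw [Measure.smul_apply, smul_eq_mul, Measure.restrict_apply hB, Measure.restrict_apply hB]
    exact riemannianVolume_le_of_metric_le hc hS hgh (hB.inter hS) inter_subset_right
  rw [← setIntegral_eq_integral_of_forall_compl_eq_zero (s := S) hFS,
    ← setIntegral_eq_integral_of_forall_compl_eq_zero (s := S) (μ := riemannianVolume h) hFS]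
  refine (integral_mono_measure hle (Filter.Eventually.of_forall hF0)
    ((integrable_of_continuous h hF).integrableOn.smul_measure ENNReal.ofReal_ne_top)).trans ?_
  rw [integral_smul_measure, ENNReal.toReal_ofReal (Real.sqrt_nonneg _), smul_eq_mul]

end MetricComparison

/-! ### Conformal changes of an invariant metric -/

section ConformalChange

variable {n : ℕ} {X : Type*} [TopologicalSpace X]
  [ChartedSpace (EuclideanSpace ℝ (Fin n)) X] [IsManifold (𝓡 n) ∞ X]

/-- The metric `e^{2f} g`. -/
noncomputable def conformalMetric (g : SmoothMetric n X) (f : X → ℝ)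
    (hf : ContMDiff (𝓡 n) 𝓘(ℝ) ∞ f) : SmoothMetric n X where
  inner x := Real.exp (2 * f x) • g.inner x
  symm x v w := by
    simp only [_root_.smul_apply, g.symm x v w]
  pos x v hv := by
    simp only [_root_.smul_apply, smul_eq_mul]
    exact mul_pos (Real.exp_pos _) (g.pos x v hv)
  isVonNBounded x := by
    -- The unit ball of e^{2f} g is contained in the image of that of g under scaling by e^{-f}.
    have h := (g.isVonNBounded x).image
      (Real.exp (-f x) • ContinuousLinearMap.id ℝ (TangentSpace (𝓡 n) x))
    refine Bornology.IsVonNBounded.subset ?_ h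
    intro v hv
    refine ⟨Real.exp (f x) • v, ?_, ?_⟩
    · simp only [mem_ofPred_eq, _root_.smul_apply, smul_eq_mul, map_smul] at hv ⊢
      rwa [← mul_assoc, ← Real.exp_add, ← two_mul]
    · simp only [_root_.smul_apply, ContinuousLinearMap.id_apply, smul_smul, ← Real.exp_add]
      simp
  contMDiff := by
    have he : ContMDiff (𝓡 n) 𝓘(ℝ) ∞ fun x => Real.exp (2 * f x) :=
      (Real.contDiff_exp.comp (contDiff_const.mul contDiff_id)).contMDiff.comp hf
    exact he.smul_section g.contMDiff

theorem isConformalExp_conformalMetric (g : SmoothMetric n X) {f : X → ℝ}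
    (hf : ContMDiff (𝓡 n) 𝓘(ℝ) ∞ f) : IsConformalExp (conformalMetric g f hf) g f := by
  intro x v w
  simp only [conformalMetric, _root_.smul_apply, smul_eq_mul]

theorem conformalMetric_mem_conformalClass {G : Type*} [SMul G X] {g : SmoothMetric n X}
    (hg : IsInvariantMetric G g) {f : X → ℝ} (hf : ContMDiff (𝓡 n) 𝓘(ℝ) ∞ f)
    (hinv : ∀ (a : G) x, f (a • x) = f x) : conformalMetric g f hf ∈ conformalClass G g := by
  have h := isConformalExp_conformalMetric g hf
  refine ⟨fun a x v w => ?_, fun x => Real.exp (2 * f x), fun x => Real.exp_pos _, h⟩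
  rw [h, h, hinv, hg]

end ConformalChange

/-! ### Logarithmic conformal exponents -/

section LogFactor

variable {n : ℕ} {X : Type*} [TopologicalSpace X]
  [ChartedSpace (EuclideanSpace ℝ (Fin n)) X] [IsManifold (𝓡 n) ∞ X]
  {φ : X → ℝ} {ε k : ℝ}

theorem contMDiff_mul_log (hφ : ContMDiff (𝓡 n) 𝓘(ℝ) ∞ φ) (hφ0 : ∀ x, 0 ≤ φ x) (hε : 0 < ε) :
    ContMDiff (𝓡 n) 𝓘(ℝ) ∞ fun x => k * Real.log (φ x + ε) := by
  intro x
  have hpos : φ x + ε ≠ 0 := (add_pos_of_nonneg_of_pos (hφ0 x) hε).ne'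
  have h1 : ContDiffAt ℝ ∞ (fun t : ℝ => k * Real.log (t + ε)) (φ x) :=
    contDiffAt_const.mul ((contDiffAt_id.add contDiffAt_const).log hpos)
  exact h1.contMDiffAt.comp x (hφ x)

theorem gradInner_mul_log (g : SmoothMetric n X) (hφ : ContMDiff (𝓡 n) 𝓘(ℝ) ∞ φ)
    (hφ0 : ∀ x, 0 ≤ φ x) (hε : 0 < ε) (x : X) :
    gradInner g (fun x => k * Real.log (φ x + ε)) (fun x => k * Real.log (φ x + ε)) x
      = k ^ 2 * ((φ x + ε) ^ 2)⁻¹ * gradInner g φ φ x := by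
  have hx := inChart_extChartAt (a := φ) (mem_extChartAt_source (I := 𝓡 n) x)
  have hpos : φ x + ε ≠ 0 := (add_pos_of_nonneg_of_pos (hφ0 x) hε).ne'
  have hd : HasDerivAt (fun t : ℝ => k * Real.log (t + ε)) (k * (φ x + ε)⁻¹)
      (inChart φ x (extChartAt (𝓡 n) x x)) := by
    rw [hx]
    simpa [div_eq_mul_inv] using (((hasDerivAt_id (φ x)).add_const ε).log hpos).const_mul k
  have hp := fun i : Fin n => partialDeriv_comp hd (differentiableAt_of_contDiffOn
    (isOpen_extChartAt_target x) (contDiffOn_inChart hφ x) (mem_extChartAt_target x)) i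
  have hp' : ∀ i : Fin n, partialDeriv i (inChart (fun x => k * Real.log (φ x + ε)) x)
      (extChartAt (𝓡 n) x x)
      = k * (φ x + ε)⁻¹ * partialDeriv i (inChart φ x) (extChartAt (𝓡 n) x x) := hp
  simp only [gradInner, gradCoord, hp', Finset.mul_sum]
  refine Finset.sum_congr rfl fun i _ => Finset.sum_congr rfl fun j _ => ?_
  rw [← inv_pow]
  ring

end LogFactor

/-! ### Test metrics with uniformly bounded energy -/

section TestMetric

variable {n : ℕ} {X : Type*} [TopologicalSpace X]
  [ChartedSpace (EuclideanSpace ℝ (Fin n)) X] [IsManifold (𝓡 n) ∞ X]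
  {φ : X → ℝ} {ε : ℝ}

/-- If `|g - h|_h ≤ C` then `g ≤ (1 + |C|) h`. -/
theorem DiffNormLE.inner_self_le {g h : SmoothMetric n X} {x : X} {C : ℝ}
    (hgh : DiffNormLE g h x C) (v : TangentSpace (𝓡 n) x) :
    g.inner x v v ≤ (1 + |C|) * h.inner x v v := by
  have h0 : 0 ≤ h.inner x v v := by
    by_cases hv : v = 0
    · subst hv
      simp
    · exact (h.pos x v hv).le
  have h1 := (le_abs_self _).trans (hgh v v)
  rw [Real.mul_self_sqrt h0] at h1
  nlinarith [le_abs_self C]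

/-- The metric `(φ + ε)^{4/(n-2)} g`. -/
noncomputable def testMetric (g : SmoothMetric n X) (hφ : ContMDiff (𝓡 n) 𝓘(ℝ) ∞ φ)
    (hφ0 : ∀ x, 0 ≤ φ x) (hε : 0 < ε) : SmoothMetric n X :=
  conformalMetric g (fun x => 2 / ((n : ℝ) - 2) * Real.log (φ x + ε))
    (contMDiff_mul_log hφ hφ0 hε)

variable [MeasurableSpace X] [BorelSpace X]

/-- For f = 2/(n-2) · log u the weight e^{(n-2)f} is u², and (n-1)(n-2)|df|² is 4(n-1)/(n-2) ·
|du|²/u². The powers of u cancel in the gradient term. -/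
theorem integral_scalarCurvature_testMetric [T2Space X] [CompactSpace X] (hn : 3 ≤ n)
    (g : SmoothMetric n X) (hφ : ContMDiff (𝓡 n) 𝓘(ℝ) ∞ φ) (hφ0 : ∀ x, 0 ≤ φ x) (hε : 0 < ε) :
    ∫ x, scalarCurvature (testMetric g hφ hφ0 hε) x ∂(riemannianVolume (testMetric g hφ hφ0 hε))
      = ∫ x, ((φ x + ε) ^ 2 * scalarCurvature g x
          + 4 * ((n : ℝ) - 1) / ((n : ℝ) - 2) * gradInner g φ φ x) ∂(riemannianVolume g) := by
  have hn2 : (n : ℝ) - 2 ≠ 0 := by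
    have : (3 : ℝ) ≤ n := by exact_mod_cast hn
    linarith
  rw [testMetric, (isConformalExp_conformalMetric g
    (contMDiff_mul_log hφ hφ0 hε)).integral_scalarCurvature (contMDiff_mul_log hφ hφ0 hε)]
  refine integral_congr_ae (Filter.Eventually.of_forall fun x => ?_)
  have hpos : 0 < φ x + ε := add_pos_of_nonneg_of_pos (hφ0 x) hε
  have he : Real.exp (((n : ℝ) - 2) * (2 / ((n : ℝ) - 2) * Real.log (φ x + ε)))
      = (φ x + ε) ^ 2 := by
    rw [← mul_assoc, mul_div_cancel₀ _ hn2, ← Nat.cast_ofNat, Real.exp_nat_mul,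
      Real.exp_log hpos]
  simp only [gradInner_mul_log g hφ hφ0 hε, he]
  field_simp
  ring

/-- The bound (φ+ε)² ≤ 2φ² + 2ε² separates the part living on U, which compares with g₀, from the
part carried by ε. Off U only the latter remains, and there s_g is not controlled by g₀. -/
theorem energy_le {g g₀ : SmoothMetric n X} {U : Set X} {c C κ : ℝ} (hc : 0 < c) (hκ : 0 ≤ κ)
    (hge : ∀ x ∈ U, ∀ v : TangentSpace (𝓡 n) x, g₀.inner x v v ≤ c * g.inner x v v)
    (hs : ∀ x ∈ U, |scalarCurvature g x - scalarCurvature g₀ x| ≤ C) (hφU : tsupport φ ⊆ U)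
    (x : X) :
    (φ x + ε) ^ 2 * scalarCurvature g x + κ * gradInner g φ φ x
      ≤ 2 * φ x ^ 2 * (|scalarCurvature g₀ x| + |C|) + κ * c * gradInner g₀ φ φ x
        + 2 * ε ^ 2 * |scalarCurvature g x| := by
  have h1 : (φ x + ε) ^ 2 * scalarCurvature g x
      ≤ (2 * φ x ^ 2 + 2 * ε ^ 2) * |scalarCurvature g x| :=
    (mul_le_mul_of_nonneg_left (le_abs_self _) (sq_nonneg _)).trans
      (mul_le_mul_of_nonneg_right (by nlinarith [sq_nonneg (φ x - ε)]) (abs_nonneg _))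
  by_cases hx : x ∈ U
  · have h2 : |scalarCurvature g x| ≤ |scalarCurvature g₀ x| + |C| := by
      have h3 := abs_sub_abs_le_abs_sub (scalarCurvature g x) (scalarCurvature g₀ x)
      linarith [hs x hx, le_abs_self C]
    have h4 := mul_le_mul_of_nonneg_left (gradInner_self_le hc (hge x hx) φ) hκ
    have h5 := mul_le_mul_of_nonneg_left h2 (show 0 ≤ 2 * φ x ^ 2 by positivity)
    linarith
  · have hxt : x ∉ tsupport φ := fun h => hx (hφU h)
    rw [image_eq_zero_of_notMem_tsupport hxt] at h1 ⊢
    rw [gradInner_eq_zero_of_notMem_tsupport g φ hxt,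
      gradInner_eq_zero_of_notMem_tsupport g₀ φ hxt]
    linarith

/-- The two inequalities play different roles: g₀ ≤ c g bounds norms of differentials, while g ≤ c
g₀ replaces the volume of g by that of g₀. The ε-term stays integrated against g. -/
theorem integral_energy_le [T2Space X] [CompactSpace X] {g g₀ : SmoothMetric n X} {U : Set X}
    (hU : IsOpen U) {c C κ : ℝ} (hc : 0 < c) (hκ : 0 ≤ κ)
    (hle : ∀ x ∈ U, ∀ v : TangentSpace (𝓡 n) x, g.inner x v v ≤ c * g₀.inner x v v)
    (hge : ∀ x ∈ U, ∀ v : TangentSpace (𝓡 n) x, g₀.inner x v v ≤ c * g.inner x v v)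
    (hs : ∀ x ∈ U, |scalarCurvature g x - scalarCurvature g₀ x| ≤ C)
    (hφ : ContMDiff (𝓡 n) 𝓘(ℝ) ∞ φ) (hφU : tsupport φ ⊆ U) :
    ∫ x, ((φ x + ε) ^ 2 * scalarCurvature g x + κ * gradInner g φ φ x) ∂(riemannianVolume g)
      ≤ Real.sqrt (c ^ n) * ∫ x, (2 * φ x ^ 2 * (|scalarCurvature g₀ x| + |C|)
          + κ * c * gradInner g₀ φ φ x) ∂(riemannianVolume g₀)
        + 2 * ε ^ 2 * ∫ x, |scalarCurvature g x| ∂(riemannianVolume g) := by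
  have hφc : Continuous φ := hφ.continuous
  have hsc := continuous_scalarCurvature g
  have hsc₀ := continuous_scalarCurvature g₀
  have hgc := continuous_gradInner g hφ hφ
  have hgc₀ := continuous_gradInner g₀ hφ hφ
  have hFc : Continuous fun x => 2 * φ x ^ 2 * (|scalarCurvature g₀ x| + |C|)
      + κ * c * gradInner g₀ φ φ x :=
    ((continuous_const.mul (hφc.pow 2)).mul (hsc₀.abs.add continuous_const)).add
      (continuous_const.mul hgc₀)
  have hF0 : ∀ x, 0 ≤ 2 * φ x ^ 2 * (|scalarCurvature g₀ x| + |C|)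
      + κ * c * gradInner g₀ φ φ x := fun x => by
    have := gradInner_self_nonneg g₀ φ x
    positivity
  have hcomp := integral_le_of_metric_le hc.le hU.measurableSet hle hFc hF0 fun x hx => by
    have hxt : x ∉ tsupport φ := fun h => hx (hφU h)
    rw [gradInner_eq_zero_of_notMem_tsupport g₀ φ hxt, image_eq_zero_of_notMem_tsupport hxt]
    ring
  have hiF := integrable_of_continuous g hFc
  have hiS : Integrable (fun x => 2 * ε ^ 2 * |scalarCurvature g x|) (riemannianVolume g) :=
    integrable_of_continuous g (continuous_const.mul hsc.abs)
  have hi : Integrable (fun x => (φ x + ε) ^ 2 * scalarCurvature g x + κ * gradInner g φ φ x)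
      (riemannianVolume g) := integrable_of_continuous g
    ((((hφc.add continuous_const).pow 2).mul hsc).add (continuous_const.mul hgc))
  refine (integral_mono hi (hiF.add hiS) fun x => energy_le hc hκ hge hs hφU x).trans ?_
  rw [integral_add' hiF hiS, integral_const_mul]
  exact add_le_add hcomp le_rfl

/-- On S the conformal factor is at least b^{4/(n-2)} whatever ε is, so there g₀ is at most a fixed
multiple of the test metric. -/
theorem volume_testMetric_ge [CompactSpace X] (hn : 3 ≤ n) {g g₀ : SmoothMetric n X} {S : Set X}
    (hS : MeasurableSet S) {c b : ℝ} (hc : 0 ≤ c) (hb : 0 < b)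
    (hge : ∀ x ∈ S, ∀ v : TangentSpace (𝓡 n) x, g₀.inner x v v ≤ c * g.inner x v v)
    (hφ : ContMDiff (𝓡 n) 𝓘(ℝ) ∞ φ) (hφ0 : ∀ x, 0 ≤ φ x) (hφS : ∀ x ∈ S, b ≤ φ x)
    (hε : 0 < ε) :
    (riemannianVolume g₀).real S
      ≤ Real.sqrt ((c * Real.exp (-(2 * (2 / ((n : ℝ) - 2) * Real.log b)))) ^ n)
        * (riemannianVolume (testMetric g hφ hφ0 hε)).real univ := by
  have hn2 : 0 < (n : ℝ) - 2 := by
    have : (3 : ℝ) ≤ n := by exact_mod_cast hn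
    linarith
  -- This number is b^{-4/(n-2)}.
  set e := Real.exp (-(2 * (2 / ((n : ℝ) - 2) * Real.log b)))
  have hcomp : ∀ x ∈ S, ∀ v : TangentSpace (𝓡 n) x,
      g₀.inner x v v ≤ c * e * (testMetric g hφ hφ0 hε).inner x v v := by
    intro x hx v
    have hgv : 0 ≤ g.inner x v v := by
      by_cases hv : v = 0
      · subst hv
        simp
      · exact (g.pos x v hv).le
    rw [testMetric, isConformalExp_conformalMetric g (contMDiff_mul_log hφ hφ0 hε) x v v,
      mul_assoc, ← mul_assoc e, ← Real.exp_add]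
    refine (hge x hx v).trans (mul_le_mul_of_nonneg_left (le_mul_of_one_le_left hgv ?_) hc)
    refine Real.one_le_exp ?_
    have h1 : Real.log b ≤ Real.log (φ x + ε) :=
      Real.log_le_log hb ((hφS x hx).trans (le_add_of_nonneg_right hε.le))
    have h2 := mul_le_mul_of_nonneg_left h1 (div_pos two_pos hn2).le
    linarith
  have h := riemannianVolume_le_of_metric_le (mul_nonneg hc (Real.exp_pos _).le) hS hcomp hS
    subset_rfl
  have h' := h.trans (mul_le_mul_right (measure_mono (subset_univ S)) _)
  have h2 := ENNReal.toReal_mono (ENNReal.mul_ne_top ENNReal.ofReal_ne_top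
    (measure_lt_top (riemannianVolume (testMetric g hφ hφ0 hε)) univ).ne) h'
  rwa [ENNReal.toReal_mul, ENNReal.toReal_ofReal (Real.sqrt_nonneg _)] at h2

end TestMetric

end EquivariantYamabe

/-! ### The uniform bound on the Yamabe constants -/

open EquivariantYamabe

theorem mainTheorem7
    {n : ℕ} (hn : 3 ≤ n)
    -- a smooth compact `n`-manifold
    {X : Type*} [TopologicalSpace X] [ChartedSpace (EuclideanSpace ℝ (Fin n)) X]
    [IsManifold (𝓡 n) ∞ X] [T2Space X] [CompactSpace X] [MeasurableSpace X] [BorelSpace X]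
    -- a compact Lie group acting smoothly on it
    {d : ℕ} {G : Type*} [Group G] [TopologicalSpace G]
    [ChartedSpace (EuclideanSpace ℝ (Fin d)) G] [LieGroup (𝓡 d) ∞ G] [T2Space G] [CompactSpace G]
    [MulAction G X] [ContMDiffSMul (𝓡 d) (𝓡 n) ∞ G X]
    -- a family of smooth `G`-invariant metrics
    {ι : Type*} (g : ι → EquivariantYamabe.SmoothMetric n X)
    (hg : ∀ α, EquivariantYamabe.IsInvariantMetric G (g α))
    -- a nonempty `G`-invariant open set on which the metrics and scalar curvatures are close
    (U : Set X) (hUopen : IsOpen U) (hUne : U.Nonempty)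
    (hUinv : ∀ (a : G), ∀ x ∈ U, a • x ∈ U)
    (D₁ D₂ : ℝ)
    (hmetric : ∀ α β, ∀ x ∈ U, EquivariantYamabe.DiffNormLE (g α) (g β) x D₁)
    (hscal : ∀ α β, ∀ x ∈ U,
      |EquivariantYamabe.scalarCurvature (g α) x
        - EquivariantYamabe.scalarCurvature (g β) x| ≤ D₂) :
    ∃ D : ℝ, ∀ α, EquivariantYamabe.yamabeConstant G (g α) ≤ (D : EReal) := by
  -- For an empty family any D works; otherwise some β serves as the reference metric.
  rcases isEmpty_or_nonempty ι with hι | ⟨⟨β⟩⟩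
  · exact ⟨0, fun α => (hι.false α).elim⟩
  obtain ⟨φ, hφ, hφ0, hφinv, hφU, x₁, hx₁⟩ :=
    exists_invariant_bump (n := n) (d := d) (G := G) hUopen hUne hUinv
  have hn3 : (3 : ℝ) ≤ n := by exact_mod_cast hn
  set c : ℝ := 1 + |D₁|
  have hc : 0 < c := by positivity
  set κ : ℝ := 4 * ((n : ℝ) - 1) / ((n : ℝ) - 2) with hκdef
  have hκ : 0 ≤ κ := div_nonneg (by linarith) (by linarith)
  -- The main part of the energy bound, expressed through g β and φ only.
  set M : ℝ := Real.sqrt (c ^ n) * ∫ x, (2 * φ x ^ 2 * (|scalarCurvature (g β) x| + |D₂|)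
    + κ * c * gradInner (g β) φ φ x) ∂(riemannianVolume (g β)) with hM
  -- The sign matters at the end: dividing M + 1 by a smaller volume factor must not decrease the
  -- quotient.
  have hM0 : 0 ≤ M := mul_nonneg (Real.sqrt_nonneg _) (integral_nonneg fun x => by
    have := gradInner_self_nonneg (g β) φ x
    positivity)
  -- A nonempty open subset of U on which φ is bounded below by a positive number.
  set S : Set X := {x | φ x₁ / 2 < φ x} with hSdef
  have hSo : IsOpen S := isOpen_lt continuous_const hφ.continuous
  have hSne : S.Nonempty := ⟨x₁, half_lt_self hx₁⟩
  have hSU : S ⊆ U := fun x hx => hφU (subset_tsupport φ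
    (ne_of_gt (lt_trans (half_pos hx₁) hx)))
  -- The constant of `volume_testMetric_ge` with b = φ x₁ / 2. It depends neither on α nor on ε,
  -- hence neither does v₀.
  set r : ℝ := Real.sqrt ((c * Real.exp (-(2 * (2 / ((n : ℝ) - 2) * Real.log (φ x₁ / 2))))) ^ n)
  have hr : 0 < r := by positivity
  have hvS : 0 < (riemannianVolume (g β)).real S :=
    ENNReal.toReal_pos (riemannianVolume_pos (g β) hSo hSne).ne' (measure_lt_top _ _).ne
  set v₀ : ℝ := (riemannianVolume (g β)).real S / r
  have hv₀ : 0 < v₀ := div_pos hvS hr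
  have hp : 0 ≤ ((n : ℝ) - 2) / n := div_nonneg (by linarith) (by linarith)
  refine ⟨(M + 1) / v₀ ^ (((n : ℝ) - 2) / n), fun α => ?_⟩
  -- No bound on T uniform in α is available. Therefore ε depends on α, with 2ε² = 1/(T+1), so that
  -- 2ε²T ≤ 1; the summand 1 covers the case T = 0.
  set T : ℝ := ∫ x, |scalarCurvature (g α) x| ∂(riemannianVolume (g α))
  have hT : 0 ≤ T := integral_nonneg fun x => abs_nonneg _
  have hε : 0 < Real.sqrt (1 / (2 * (T + 1))) := by positivity
  set ε : ℝ := Real.sqrt (1 / (2 * (T + 1)))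
  have hεT : 2 * ε ^ 2 * T ≤ 1 := by
    rw [Real.sq_sqrt (by positivity)]
    have : 2 * (1 / (2 * (T + 1))) * T = T / (T + 1) := by field_simp
    rw [this, div_le_one (by positivity)]
    linarith
  have hmem : testMetric (g α) hφ hφ0 hε ∈ conformalClass G (g α) :=
    conformalMetric_mem_conformalClass (hg α) _ fun a x => by rw [hφinv]
  refine iInf₂_le_of_le _ hmem (EReal.coe_le_coe_iff.2 ?_)
  -- The inequality g β ≤ c · g α is applied on S ⊆ U.
  have hvol : v₀ ≤ (riemannianVolume (testMetric (g α) hφ hφ0 hε)).real univ := by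
    rw [div_le_iff₀' hr]
    exact volume_testMetric_ge hn hSo.measurableSet hc.le (half_pos hx₁)
      (fun x hx v => (hmetric β α x (hSU hx)).inner_self_le v) hφ hφ0 (fun x hx => le_of_lt hx) hε
  have hnum : ∫ x, scalarCurvature (testMetric (g α) hφ hφ0 hε) x
      ∂(riemannianVolume (testMetric (g α) hφ hφ0 hε)) ≤ M + 1 := by
    rw [integral_scalarCurvature_testMetric hn]
    refine (integral_energy_le hUopen hc hκ
      (fun x hx v => (hmetric α β x hx).inner_self_le v)
      (fun x hx v => (hmetric β α x hx).inner_self_le v) (hscal α β) hφ hφU).trans ?_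
    linarith
  exact div_le_div₀ (by linarith) hnum (Real.rpow_pos_of_pos hv₀ _)
    (Real.rpow_le_rpow hv₀.le hvol hp)
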